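/- Let $N\ge 1$, $\alpha>0$, $0<\beta\le 2$, $\frac13\le\gamma\le\min\{\frac1{\beta+1},\frac12\}$, $\delta\ge 0$, $\omega\ge 0$, and define on $\mathbb{R}^N\times\mathbb{R}^N$ $$f_0(x,v)=(1+|x|)^{-\omega}(1+|v|^2)^{-\delta}e^{-\alpha|v|^\beta}\mathbf 1_{\{|x|^\gamma\le|v|\le 2|x|^\gamma+10\}}.$$ For $f=f(t,x,v)\ge 0$ let the density $\rho$, bulk velocity $u$ and temperature $T$ be given by $\rho=\int f\,dv$, $\rho u=\int vf\,dv$, $\rho(|u|^2+NT)=\int|v|^2f\,dv$, and let $\mathcal M(f)=\rho(2\pi T)^{-N/2}\exp\!\big(-\tfrac{|v-u|^2}{2T}\big)$. A solution on $[0,t_0]$ of the BGK equation $\partial_tf+v\cdot\nabla_xf=\mathcal M(f)-f$, $f|_{t=0}=f_0$, means a non-negative measurable function $f$ such that, for all $0\le t\le t_0$ and $x,v\in\mathbb{R}^N$, $\int(1+|w|^2)f(t,x,w)\,dw<\infty$, the time integral below converges absolutely, and $$f(t,x,v)=e^{-t}f_0(x-tv,v)+\int_0^te^{-(t-\tau)}\mathcal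 M(f)(\tau,x-(t-\tau)v,v)\,d\tau .$$ Then there are $t_0>0$ and constants $0<C_1,\dots,C_5<\infty$, depending only on $\alpha,\beta,\gamma,\delta,\omega,N$, and a solution $f$ on $[0,t_0]$ such that for all $0\le t\le t_0$ and $x\in\mathbb{R}^N$ $$C_1\le\frac{\rho(t,x)}{(1+|x|)^{(N-2\delta-\beta)\gamma-\omega}\,e^{-\alpha|x|^{\beta\gamma}}}\le C_2,\qquad |u(t,x)|\le C_3(1+|x|^\gamma)\,t^{1/4},\qquad C_4\le\frac{T(t,x)}{1+|x|^{2\gamma}}\le C_5 .$$ This solution is unique: any solution on $[0,t_0]$ with the same initial datum whose macroscopic fields satisfy bounds of this form for some positive constants (possibly different from $C_1,\dots,C_5$) coincides with $f$ on $[0,t_0]\times\mathbb{R}^N\times\mathbb{R}^N$. -/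

import Mathlib

open MeasureTheory Set

namespace BGK

/-- Euclidean space `ℝ^N`, used both for positions `x` and for velocities `v`. -/
abbrev E (N : ℕ) : Type := EuclideanSpace ℝ (Fin N)

/-- Local density `ρ(x) = ∫ g(x,v) dv` of a phase-space density `g` (at a fixed time). -/
noncomputable def density {N : ℕ} (g : E N → E N → ℝ) (x : E N) : ℝ :=
  ∫ v, g x v

/-- Bulk velocity `u`, given by `ρ u = ∫ v g dv` (and `u = 0` at vacuum points). -/
noncomputable def bulkVelocity {N : ℕ} (g : E N → E N → ℝ) (x : E N) : E N :=
  (density g x)⁻¹ • ∫ v, g x v • v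

/-- Local temperature `T`, given by `ρ (|u|² + N T) = ∫ |v|² g dv`. -/
noncomputable def temperature {N : ℕ} (g : E N → E N → ℝ) (x : E N) : ℝ :=
  ((∫ v, ‖v‖ ^ 2 * g x v) / density g x - ‖bulkVelocity g x‖ ^ 2) / (N : ℝ)

/-- Local Maxwellian `M(g)(x,v) = ρ (2πT)^{-N/2} exp(-|v-u|²/(2T))`. -/
noncomputable def maxwellian {N : ℕ} (g : E N → E N → ℝ) (x v : E N) : ℝ :=
  density g x / (2 * Real.pi * temperature g x) ^ ((N : ℝ) / 2) *
    Real.exp (-(‖v - bulkVelocity g x‖ ^ 2 / (2 * temperature g x)))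

/-- The initial datum
`(1+|x|)^{-ω} (1+|v|²)^{-δ} exp(-α|v|^β) 1_{|x|^γ ≤ |v| ≤ 2|x|^γ + 10}`. -/
noncomputable def initialDatum {N : ℕ} (α β γ δ ω : ℝ) (x v : E N) : ℝ :=
  {w : E N | ‖x‖ ^ γ ≤ ‖w‖ ∧ ‖w‖ ≤ 2 * ‖x‖ ^ γ + 10}.indicator
    (fun w => (1 + ‖x‖) ^ (-ω) * (1 + ‖w‖ ^ 2) ^ (-δ) * Real.exp (-α * ‖w‖ ^ β)) v

/-- `f` is a (mild) solution on `[0,t₀]` of the BGK equation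
`∂ₜ f + v · ∇ₓ f = M(f) - f`, `f(0) = f₀`, on `ℝ^N × ℝ^N`: a non-negative measurable function
with finite velocity moments up to order two (so that the macroscopic fields make sense),
satisfying the equation integrated along characteristics (Duhamel's formula).
Values of `f` at times outside `[0,t₀]` play no role; one may think of `f` as set to zero there. -/
structure IsSolution {N : ℕ} (f₀ : E N → E N → ℝ) (t₀ : ℝ)
    (f : ℝ → E N → E N → ℝ) : Prop where
  measurable : Measurable fun p : ℝ × E N × E N => f p.1 p.2.1 p.2.2
  nonneg : ∀ t ∈ Icc 0 t₀, ∀ x v, 0 ≤ f t x v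
  integrable_moments : ∀ t ∈ Icc 0 t₀, ∀ x,
    Integrable fun v => (1 + ‖v‖ ^ 2) * f t x v
  integrable_gain : ∀ t ∈ Icc 0 t₀, ∀ x v,
    IntervalIntegrable
      (fun τ => Real.exp (-(t - τ)) * maxwellian (f τ) (x - (t - τ) • v) v) volume 0 t
  duhamel : ∀ t ∈ Icc 0 t₀, ∀ x v,
    f t x v = Real.exp (-t) * f₀ (x - t • v) v +
      ∫ τ in (0 : ℝ)..t, Real.exp (-(t - τ)) * maxwellian (f τ) (x - (t - τ) • v) v

/-- The bounds on the macroscopic fields, with explicit constants `C₁, …, C₅`,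
at all times `t ∈ [0,t₀]` and all positions `x`. -/
structure MacroBounds {N : ℕ} (α β γ δ ω t₀ C₁ C₂ C₃ C₄ C₅ : ℝ)
    (f : ℝ → E N → E N → ℝ) : Prop where
  density_bounds : ∀ t ∈ Icc 0 t₀, ∀ x,
    density (f t) x /
      ((1 + ‖x‖) ^ (((N : ℝ) - 2 * δ - β) * γ - ω) * Real.exp (-α * ‖x‖ ^ (β * γ)))
      ∈ Icc C₁ C₂
  velocity_bound : ∀ t ∈ Icc 0 t₀, ∀ x,
    ‖bulkVelocity (f t) x‖ ≤ C₃ * (1 + ‖x‖ ^ γ) * t ^ (1 / 4 : ℝ)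
  temperature_bounds : ∀ t ∈ Icc 0 t₀, ∀ x,
    temperature (f t) x / (1 + ‖x‖ ^ (2 * γ)) ∈ Icc C₄ C₅

end BGK

namespace BGK

/-- Admissible exponents for the weights. -/
structure WeightExponents (α a q γ : ℝ) : Prop where
  α_pos : 0 < α
  a_pos : 0 < a
  q_nonneg : 0 ≤ q
  γ_pos : 0 < γ
  γ_le : γ ≤ 1 / 2
  sum_le : a + γ ≤ 1

/-- The natural velocity scale at the position `x`. -/
noncomputable def scale {N : ℕ} (γ : ℝ) (x : E N) : ℝ := (1 + ‖x‖) ^ γ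

/-- The phase-space weight at the position `x`. -/
noncomputable def phaseWeight {N : ℕ} (α a q : ℝ) (x : E N) : ℝ :=
  (1 + ‖x‖) ^ (-q) * Real.exp (-α * ‖x‖ ^ a)

/-- The weight for the density. -/
noncomputable def densityWeight {N : ℕ} (α a q γ : ℝ) (x : E N) : ℝ :=
  phaseWeight α a q x * scale γ x ^ N

/-- The phase-space profile dominating gain terms. -/
noncomputable def profile {N : ℕ} (α a q γ : ℝ) (x v : E N) : ℝ :=
  phaseWeight α a q x * ((1 + ‖v‖ / scale γ x) ^ (N + 3))⁻¹

section
variable {N : ℕ} {α a q γ : ℝ}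

lemma scale_pos (x : E N) : 0 < scale γ x := by unfold scale; positivity

lemma phaseWeight_pos (x : E N) : 0 < phaseWeight α a q x := by unfold phaseWeight; positivity

lemma densityWeight_pos (x : E N) : 0 < densityWeight α a q γ x :=
  mul_pos (phaseWeight_pos x) (pow_pos (scale_pos x) N)

lemma profile_pos (x v : E N) : 0 < profile α a q γ x v := by
  have h1 := scale_pos (γ := γ) x
  have h2 := phaseWeight_pos (α := α) (a := a) (q := q) x
  unfold profile; positivity

lemma one_le_scale (hγ : 0 ≤ γ) (x : E N) : 1 ≤ scale γ x :=
  Real.one_le_rpow (by linarith [norm_nonneg x]) hγ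

/-- Tangent-line bound for the concave power. -/
lemma rpow_sub_rpow_le {a p r : ℝ} (ha1 : a ≤ 1) (hp : 0 ≤ p) (hpr : p ≤ r) (hr : 0 < r) :
    r ^ a - p ^ a ≤ r ^ (a - 1) * (r - p) := by
  have h1 : r ^ a = r ^ (a - 1) * r := by
    rw [← Real.rpow_add_one hr.ne']; ring_nf
  have h2 : r ^ (a - 1) * p ≤ p ^ a := by
    rcases hp.eq_or_lt with h | h
    · rw [← h]; simpa using Real.zero_rpow_nonneg a
    · have : p ^ a = p ^ (a - 1) * p := by
        rw [← Real.rpow_add_one h.ne']; ring_nf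
      rw [this]
      exact mul_le_mul_of_nonneg_right
        (Real.rpow_le_rpow_of_nonpos h hpr (by linarith)) hp
  rw [h1]; linarith

/-- Comparison of norms along a shift `y = x - s v`, `0 ≤ s ≤ 1`. -/
lemma one_add_norm_le_mul (hγ : γ ≤ 1) {s : ℝ} (hs : 0 ≤ s) (hs1 : s ≤ 1) (x v : E N) :
    1 + ‖x‖ ≤ (1 + ‖x - s • v‖) * (1 + ‖v‖ / scale γ (x - s • v)) := by
  set y := x - s • v with hy
  have hx : ‖x‖ ≤ ‖y‖ + ‖v‖ := by
    have : x = y + s • v := by rw [hy]; abel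
    calc ‖x‖ = ‖y + s • v‖ := by rw [← this]
      _ ≤ ‖y‖ + ‖s • v‖ := norm_add_le _ _
      _ ≤ ‖y‖ + ‖v‖ := by
        rw [norm_smul, Real.norm_of_nonneg hs]
        nlinarith [norm_nonneg v]
  have hS : scale γ y ≤ 1 + ‖y‖ := by
    have h1 : (1:ℝ) ≤ 1 + ‖y‖ := by linarith [norm_nonneg y]
    simpa [scale] using Real.rpow_le_rpow_of_exponent_le h1 hγ
  have hSp := scale_pos (γ := γ) y
  have h2 : ‖v‖ ≤ (1 + ‖y‖) * (‖v‖ / scale γ y) := by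
    rw [mul_div_assoc', le_div_iff₀ hSp]
    nlinarith [norm_nonneg v]
  nlinarith

lemma one_add_norm_shift_le (hγ : γ ≤ 1 / 2) {s : ℝ} (hs : 0 ≤ s) (hs1 : s ≤ 1) (x v : E N) :
    1 + ‖x - s • v‖ ≤ 4 * (1 + ‖x‖) * (1 + ‖v‖ / scale γ (x - s • v)) ^ 2 := by
  set y := x - s • v with hy
  have hyx : ‖y‖ ≤ ‖x‖ + ‖v‖ := by
    calc ‖y‖ ≤ ‖x‖ + ‖s • v‖ := norm_sub_le _ _
      _ ≤ ‖x‖ + ‖v‖ := by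
        rw [norm_smul, Real.norm_of_nonneg hs]
        nlinarith [norm_nonneg v]
  have hSp := scale_pos (γ := γ) y
  have hz : 0 ≤ ‖v‖ / scale γ y := by positivity
  have hy0 := norm_nonneg y
  have hx0 := norm_nonneg x
  have hS2 : scale γ y ^ 2 ≤ 1 + ‖y‖ := by
    have h1 : (1:ℝ) ≤ 1 + ‖y‖ := by linarith
    have h2 : scale γ y ^ 2 = (1 + ‖y‖) ^ (γ * 2) := by
      rw [scale, ← Real.rpow_natCast, ← Real.rpow_mul (by positivity)]; norm_num
    rw [h2]
    simpa using Real.rpow_le_rpow_of_exponent_le h1 (show γ * 2 ≤ 1 by linarith)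
  rcases le_or_gt (2 * ‖v‖) (1 + ‖y‖) with h | h
  · have : 1 + ‖y‖ ≤ 4 * (1 + ‖x‖) := by linarith
    have h1 : 1 ≤ (1 + ‖v‖ / scale γ y) ^ 2 := one_le_pow₀ (by linarith)
    nlinarith
  · have h3 : (‖v‖ / scale γ y) * scale γ y = ‖v‖ := by field_simp
    have h4 : (1 + ‖y‖) ^ 2 ≤ 4 * (‖v‖ / scale γ y) ^ 2 * (1 + ‖y‖) := by
      have : (1 + ‖y‖) ^ 2 ≤ 4 * ‖v‖ ^ 2 := by nlinarith
      rw [← h3, mul_pow] at this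
      nlinarith [sq_nonneg (‖v‖ / scale γ y)]
    have h5 : 1 + ‖y‖ ≤ 4 * (‖v‖ / scale γ y) ^ 2 := by
      have : 0 < 1 + ‖y‖ := by linarith
      nlinarith
    nlinarith [mul_nonneg hx0 (sq_nonneg (1 + ‖v‖ / scale γ y))]

lemma norm_rpow_le_shift (h : WeightExponents α a q γ) {s : ℝ} (hs : 0 ≤ s) (hs1 : s ≤ 1)
    (x v : E N) :
    ‖x‖ ^ a ≤ ‖x - s • v‖ ^ a + 1 + 2 * (‖v‖ / scale γ (x - s • v)) := by
  have ha := h.a_pos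
  have hγ := h.γ_pos
  have hγ' := h.γ_le
  have hsum := h.sum_le
  set y := x - s • v with hy
  have hSp := scale_pos (γ := γ) y
  have hz : 0 ≤ ‖v‖ / scale γ y := by positivity
  have hx0 := norm_nonneg x
  have hy0 := norm_nonneg y
  have hya : 0 ≤ ‖y‖ ^ a := by positivity
  rcases le_or_gt ‖x‖ 1 with h1 | h1
  · have := Real.rpow_le_one hx0 h1 ha.le
    linarith
  rcases le_or_gt ‖x‖ ‖y‖ with h2 | h2
  · have := Real.rpow_le_rpow hx0 h2 ha.le
    linarith
  have hxy : ‖x‖ - ‖y‖ ≤ ‖v‖ := by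
    have h3 : x = y + s • v := by rw [hy]; abel
    have : ‖x‖ ≤ ‖y‖ + ‖s • v‖ := by
      conv_lhs => rw [h3]
      exact norm_add_le _ _
    rw [norm_smul, Real.norm_of_nonneg hs] at this
    nlinarith [norm_nonneg v]
  have h3 := rpow_sub_rpow_le (a := a) (by linarith) hy0 h2.le (by linarith)
  have h4 : ‖x‖ ^ (a - 1) ≤ ‖x‖ ^ (-γ) :=
    Real.rpow_le_rpow_of_exponent_le h1.le (by linarith)
  have h5 : scale γ y ≤ 2 * ‖x‖ ^ γ := by
    calc scale γ y ≤ (2 * ‖x‖) ^ γ := Real.rpow_le_rpow (by linarith) (by linarith) hγ.le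
      _ = 2 ^ γ * ‖x‖ ^ γ := Real.mul_rpow (by norm_num) hx0
      _ ≤ 2 * ‖x‖ ^ γ := by
        have : (2:ℝ) ^ γ ≤ 2 ^ (1:ℝ) :=
          Real.rpow_le_rpow_of_exponent_le (by norm_num) (by linarith)
        rw [Real.rpow_one] at this
        gcongr
  have h6 : ‖x‖ ^ (-γ) ≤ 2 / scale γ y := by
    rw [Real.rpow_neg hx0, le_div_iff₀ hSp, inv_mul_le_iff₀ (by positivity)]
    linarith
  have h7 : ‖x‖ ^ (a - 1) * (‖x‖ - ‖y‖) ≤ 2 / scale γ y * ‖v‖ :=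
    mul_le_mul (h4.trans h6) hxy (by linarith) (by positivity)
  have h8 : 2 / scale γ y * ‖v‖ = 2 * (‖v‖ / scale γ y) := by ring
  linarith

/-- A polynomial-times-exponential is dominated by a Gaussian. -/
lemma poly_exp_le_gaussian (m A k : ℝ) (hm : 0 ≤ m) (hk : 0 < k) {z : ℝ} (hz : 0 ≤ z) :
    (1 + z) ^ m * Real.exp (A * z) * Real.exp (-k * z ^ 2) ≤ Real.exp ((m + A) ^ 2 / (4 * k)) := by
  have h1 : (1 + z) ^ m ≤ Real.exp (m * z) := by
    have : 1 + z ≤ Real.exp z := by linarith [Real.add_one_le_exp z]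
    calc (1 + z) ^ m ≤ (Real.exp z) ^ m := Real.rpow_le_rpow (by linarith) this hm
      _ = Real.exp (m * z) := by rw [← Real.exp_mul]; ring_nf
  calc (1 + z) ^ m * Real.exp (A * z) * Real.exp (-k * z ^ 2)
      ≤ Real.exp (m * z) * Real.exp (A * z) * Real.exp (-k * z ^ 2) := by gcongr
    _ = Real.exp (m * z + A * z + -k * z ^ 2) := by rw [Real.exp_add, Real.exp_add]
    _ ≤ _ := by
      apply Real.exp_le_exp.mpr
      rw [le_div_iff₀ (by positivity)]
      nlinarith [sq_nonneg (2 * k * z - (m + A))]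

/-- Gaussians at shifted positions are dominated by the profile. -/
lemma exists_gaussian_shift_le (N : ℕ) (h : WeightExponents α a q γ) {k : ℝ} (hk : 0 < k) :
    ∃ K : ℝ, 0 < K ∧ ∀ s : ℝ, 0 ≤ s → s ≤ 1 → ∀ x v : E N,
      phaseWeight α a q (x - s • v) * ((1 + ‖v‖ / scale γ (x - s • v)) ^ 2 *
        Real.exp (-k * (‖v‖ / scale γ (x - s • v)) ^ 2)) ≤ K * profile α a q γ x v := by
  have hα := h.α_pos
  have hq := h.q_nonneg
  have hγ := h.γ_pos
  have hγ' := h.γ_le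
  refine ⟨Real.exp α * 5 ^ (N + 3) *
    Real.exp ((q + (2 * (N + 3 : ℕ) + 2) + 2 * α) ^ 2 / (4 * k)), by positivity, ?_⟩
  intro s hs hs1 x v
  have b1 := one_add_norm_le_mul (γ := γ) (by linarith) hs hs1 x v
  have b2 := one_add_norm_shift_le hγ' hs hs1 x v
  have b3 := norm_rpow_le_shift h hs hs1 x v
  set y := x - s • v with hy
  have hSp := scale_pos (γ := γ) y
  have hSx := scale_pos (γ := γ) x
  set z := ‖v‖ / scale γ y with hzdef
  have hz : 0 ≤ z := by positivity
  have hx0 := norm_nonneg x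
  have hy0 := norm_nonneg y
  have c1 : (1 + ‖y‖) ^ (-q) ≤ (1 + ‖x‖) ^ (-q) * (1 + z) ^ q := by
    have : (1 + ‖x‖) ^ q ≤ (1 + ‖y‖) ^ q * (1 + z) ^ q := by
      rw [← Real.mul_rpow (by positivity) (by positivity)]
      exact Real.rpow_le_rpow (by positivity) b1 hq
    rw [Real.rpow_neg (by positivity), Real.rpow_neg (by positivity),
      inv_mul_eq_div, le_div_iff₀ (by positivity), inv_mul_le_iff₀ (by positivity)]
    exact this
  have c2 : Real.exp (-α * ‖y‖ ^ a) ≤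
      Real.exp (-α * ‖x‖ ^ a) * (Real.exp α * Real.exp (2 * α * z)) := by
    rw [← Real.exp_add, ← Real.exp_add]
    apply Real.exp_le_exp.mpr
    nlinarith
  have c3 : 1 + ‖v‖ / scale γ x ≤ 5 * (1 + z) ^ 2 := by
    have e1 : scale γ y ≤ 4 * scale γ x * (1 + z) := by
      have hb : (0:ℝ) ≤ 1 + ‖x‖ := by positivity
      calc scale γ y ≤ (4 * (1 + ‖x‖) * (1 + z) ^ 2) ^ γ :=
            Real.rpow_le_rpow (by positivity) b2 hγ.le
        _ = 4 ^ γ * (1 + ‖x‖) ^ γ * ((1 + z) ^ 2) ^ γ := by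
            rw [Real.mul_rpow (by positivity) (by positivity),
              Real.mul_rpow (by positivity) (by positivity)]
        _ ≤ 4 * (1 + ‖x‖) ^ γ * (1 + z) := by
            have f1 : (4:ℝ) ^ γ ≤ 4 := by
              simpa using Real.rpow_le_rpow_of_exponent_le (show (1:ℝ) ≤ 4 by norm_num)
                (show γ ≤ 1 by linarith)
            have f2 : ((1 + z) ^ 2) ^ γ ≤ 1 + z := by
              rw [← Real.rpow_natCast, ← Real.rpow_mul (by positivity)]
              have := Real.rpow_le_rpow_of_exponent_le (show (1:ℝ) ≤ 1 + z by linarith)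
                (show ((2:ℕ):ℝ) * γ ≤ 1 by push_cast; linarith)
              simpa using this
            gcongr
    have e2 : ‖v‖ / scale γ x ≤ 4 * z * (1 + z) := by
      rw [div_le_iff₀ hSx]
      have : ‖v‖ = z * scale γ y := by rw [hzdef]; field_simp
      rw [this]
      nlinarith
    nlinarith
  have c4 : 1 ≤ (5 * (1 + z) ^ 2) ^ (N + 3) * ((1 + ‖v‖ / scale γ x) ^ (N + 3))⁻¹ := by
    rw [← div_eq_mul_inv, one_le_div (by positivity)]
    gcongr
  have c5 := poly_exp_le_gaussian (q + (2 * (N + 3 : ℕ) + 2)) (2 * α) k (by positivity) hk hz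
  have c6 : (1 + z) ^ (q + (2 * (N + 3 : ℕ) + 2)) =
      (1 + z) ^ q * ((1 + z) ^ 2) ^ (N + 3) * (1 + z) ^ 2 := by
    rw [Real.rpow_add (by positivity), Real.rpow_add (by positivity), ← pow_mul, mul_assoc]
    congr 2
    · rw [← Real.rpow_natCast]; push_cast; rfl
    · rw [← Real.rpow_natCast]; push_cast; rfl
  rw [c6] at c5
  set X := ((1 + ‖v‖ / scale γ x) ^ (N + 3))⁻¹ with hX
  have hXp : 0 < X := by positivity
  unfold profile
  rw [← hX]
  unfold phaseWeight
  calc (1 + ‖y‖) ^ (-q) * Real.exp (-α * ‖y‖ ^ a) *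
        ((1 + z) ^ 2 * Real.exp (-k * z ^ 2))
      ≤ ((1 + ‖x‖) ^ (-q) * (1 + z) ^ q) *
        (Real.exp (-α * ‖x‖ ^ a) * (Real.exp α * Real.exp (2 * α * z))) *
        ((1 + z) ^ 2 * Real.exp (-k * z ^ 2)) := by gcongr
    _ ≤ ((1 + ‖x‖) ^ (-q) * (1 + z) ^ q) *
        (Real.exp (-α * ‖x‖ ^ a) * (Real.exp α * Real.exp (2 * α * z))) *
        ((1 + z) ^ 2 * Real.exp (-k * z ^ 2)) * ((5 * (1 + z) ^ 2) ^ (N + 3) * X) :=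
        le_mul_of_one_le_right (by positivity) c4
    _ = ((1 + z) ^ q * ((1 + z) ^ 2) ^ (N + 3) * (1 + z) ^ 2 * Real.exp (2 * α * z) *
        Real.exp (-k * z ^ 2)) * (Real.exp α * 5 ^ (N + 3) *
        ((1 + ‖x‖) ^ (-q) * Real.exp (-α * ‖x‖ ^ a) * X)) := by rw [mul_pow]; ring
    _ ≤ Real.exp ((q + (2 * (N + 3 : ℕ) + 2) + 2 * α) ^ 2 / (4 * k)) *
        (Real.exp α * 5 ^ (N + 3) *
        ((1 + ‖x‖) ^ (-q) * Real.exp (-α * ‖x‖ ^ a) * X)) := by gcongr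
    _ = _ := by ring

end

/-- Two-sided bounds for the macroscopic fields of `g` at the position `x`. -/
structure FieldBounds {N : ℕ} (K α a q γ : ℝ) (g : E N → E N → ℝ) (x : E N) : Prop where
  le_density : densityWeight α a q γ x ≤ K * density g x
  density_le : density g x ≤ K * densityWeight α a q γ x
  velocity_le : ‖bulkVelocity g x‖ ≤ K * scale γ x
  le_temperature : scale γ x ^ 2 ≤ K * temperature g x
  temperature_le : temperature g x ≤ K * scale γ x ^ 2

section
variable {N : ℕ} {α a q γ K : ℝ}

lemma FieldBounds.density_pos {g : E N → E N → ℝ} {x : E N} (hK : 1 ≤ K)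
    (h : FieldBounds K α a q γ g x) : 0 < density g x := by
  have h1 := densityWeight_pos (α := α) (a := a) (q := q) (γ := γ) x
  have h2 := h.le_density
  by_contra hc
  push Not at hc
  nlinarith

lemma FieldBounds.temperature_pos {g : E N → E N → ℝ} {x : E N} (hK : 1 ≤ K)
    (h : FieldBounds K α a q γ g x) : 0 < temperature g x := by
  have h1 := pow_pos (scale_pos (γ := γ) x) 2
  have h2 := h.le_temperature
  by_contra hc
  push Not at hc
  nlinarith

lemma maxwellian_nonneg {g : E N → E N → ℝ} {x : E N} (hρ : 0 ≤ density g x)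
    (hT : 0 ≤ temperature g x) (v : E N) : 0 ≤ maxwellian g x v := by
  unfold maxwellian; positivity

lemma maxwellian_le {g : E N → E N → ℝ} {x : E N} (hK : 1 ≤ K)
    (h : FieldBounds K α a q γ g x) (v : E N) :
    maxwellian g x v ≤ K * K ^ ((N : ℝ) / 2) * Real.exp (K / 2) *
      (phaseWeight α a q x * Real.exp (-(1 / (4 * K)) * (‖v‖ / scale γ x) ^ 2)) := by
  have hK0 : 0 < K := by linarith
  have hρ := h.density_pos hK
  have hT := h.temperature_pos hK
  have hS := scale_pos (γ := γ) x
  have hQ := phaseWeight_pos (α := α) (a := a) (q := q) x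
  obtain ⟨-, h2, h3, h4, h5⟩ := h
  unfold maxwellian
  set ρ := density g x
  set u := bulkVelocity g x
  set T := temperature g x
  set S := scale γ x
  set Q := phaseWeight α a q x
  have hW : densityWeight α a q γ x = Q * S ^ N := rfl
  rw [hW] at h2
  have e1 : S ^ N ≤ K ^ ((N : ℝ) / 2) * (2 * Real.pi * T) ^ ((N : ℝ) / 2) := by
    have : S ^ N = (S ^ 2) ^ ((N : ℝ) / 2) := by
      rw [← Real.rpow_natCast S 2, ← Real.rpow_mul hS.le, ← Real.rpow_natCast S N]
      congr 1; push_cast; ring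
    rw [this, ← Real.mul_rpow hK0.le (by positivity)]
    apply Real.rpow_le_rpow (by positivity) _ (by positivity)
    have : 1 ≤ 2 * Real.pi := by linarith [Real.pi_gt_three]
    nlinarith [mul_pos hK0 hT]
  have e2 : ρ / (2 * Real.pi * T) ^ ((N : ℝ) / 2) ≤ K * K ^ ((N : ℝ) / 2) * Q := by
    rw [div_le_iff₀ (by positivity)]
    calc ρ ≤ K * (Q * S ^ N) := h2
      _ ≤ K * (Q * (K ^ ((N : ℝ) / 2) * (2 * Real.pi * T) ^ ((N : ℝ) / 2))) := by gcongr
      _ = _ := by ring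
  have e3 : Real.exp (-(‖v - u‖ ^ 2 / (2 * T))) ≤
      Real.exp (K / 2) * Real.exp (-(1 / (4 * K)) * (‖v‖ / S) ^ 2) := by
    rw [← Real.exp_add]
    apply Real.exp_le_exp.mpr
    have f1 : ‖v‖ ≤ ‖v - u‖ + ‖u‖ := by simpa using norm_add_le (v - u) u
    have f2 : ‖v‖ ^ 2 ≤ 2 * ‖v - u‖ ^ 2 + 2 * (K * S) ^ 2 := by
      have : ‖v‖ ^ 2 ≤ (‖v - u‖ + K * S) ^ 2 :=
        pow_le_pow_left₀ (norm_nonneg v) (by linarith) 2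
      nlinarith [sq_nonneg (‖v - u‖ - K * S)]
    have f3 : ‖v - u‖ ^ 2 / (2 * (K * S ^ 2)) ≤ ‖v - u‖ ^ 2 / (2 * T) := by gcongr
    have f4 : ‖v‖ ^ 2 / (4 * (K * S ^ 2)) ≤
        ‖v - u‖ ^ 2 / (2 * (K * S ^ 2)) + K / 2 := by
      rw [div_le_iff₀ (by positivity), add_mul]
      have : ‖v - u‖ ^ 2 / (2 * (K * S ^ 2)) * (4 * (K * S ^ 2)) = 2 * ‖v - u‖ ^ 2 := by
        field_simp; ring
      rw [this]
      nlinarith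
    have f5 : -(1 / (4 * K)) * (‖v‖ / S) ^ 2 = - (‖v‖ ^ 2 / (4 * (K * S ^ 2))) := by
      field_simp
    rw [f5]
    linarith
  calc _ ≤ (K * K ^ ((N : ℝ) / 2) * Q) *
      (Real.exp (K / 2) * Real.exp (-(1 / (4 * K)) * (‖v‖ / S) ^ 2)) :=
        mul_le_mul e2 e3 (by positivity) (by positivity)
    _ = _ := by ring

lemma abs_log_sub_log_le {x y m : ℝ} (hm : 0 < m) (hx : m ≤ x) (hy : m ≤ y) :
    |Real.log x - Real.log y| ≤ |x - y| / m := by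
  have key : ∀ x y : ℝ, m ≤ x → m ≤ y → Real.log x - Real.log y ≤ |x - y| / m := by
    intro x y hx hy
    have hx0 : 0 < x := by linarith
    have hy0 : 0 < y := by linarith
    rw [← Real.log_div hx0.ne' hy0.ne']
    calc Real.log (x / y) ≤ x / y - 1 := Real.log_le_sub_one_of_pos (by positivity)
      _ = (x - y) / y := by field_simp
      _ ≤ |x - y| / y := by gcongr; exact le_abs_self _
      _ ≤ |x - y| / m := by gcongr
  rw [abs_le]
  constructor
  · have := key y x hy hx
    rw [abs_sub_comm] at this; linarith
  · exact key x y hx hy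

lemma abs_exp_sub_exp_le (x y : ℝ) :
    |Real.exp x - Real.exp y| ≤ |x - y| * (Real.exp x + Real.exp y) := by
  have key : ∀ x y : ℝ, y ≤ x →
      |Real.exp x - Real.exp y| ≤ |x - y| * (Real.exp x + Real.exp y) := by
    intro x y hxy
    rw [abs_of_nonneg (sub_nonneg.mpr (Real.exp_le_exp.mpr hxy)),
      abs_of_nonneg (sub_nonneg.mpr hxy)]
    have h1 : Real.exp y = Real.exp x * Real.exp (y - x) := by rw [← Real.exp_add]; ring_nf
    have h2 := Real.add_one_le_exp (y - x)
    have h3 := Real.exp_pos x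
    have h4 := Real.exp_pos y
    have h5 : Real.exp x * (y - x + 1) ≤ Real.exp y := by rw [h1]; gcongr
    nlinarith [mul_nonneg (sub_nonneg.mpr hxy) h4.le]
  rcases le_total y x with h | h
  · exact key x y h
  · rw [abs_sub_comm, abs_sub_comm x y, add_comm]; exact key y x h

lemma maxwellian_eq_exp {g : E N → E N → ℝ} {x : E N} (hρ : 0 < density g x)
    (hT : 0 < temperature g x) (v : E N) :
    maxwellian g x v = Real.exp (Real.log (density g x) -
      (N : ℝ) / 2 * (Real.log (2 * Real.pi) + Real.log (temperature g x)) -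
      ‖v - bulkVelocity g x‖ ^ 2 / (2 * temperature g x)) := by
  have hpi := Real.pi_pos
  rw [sub_eq_add_neg, Real.exp_add, Real.exp_sub, Real.exp_log hρ, maxwellian,
    Real.rpow_def_of_pos (by positivity), Real.log_mul (by positivity) hT.ne']
  ring_nf

lemma abs_quadratic_sub_le {u₁ u₂ v : E N} {T₁ T₂ S z d : ℝ} (hK0 : 0 < K) (hS : 0 < S)
    (hz0 : 0 ≤ z) (hd : 0 ≤ d) (hT1 : 0 < T₁) (hT2 : 0 < T₂) (hK : 1 ≤ K) (hvz : ‖v‖ = z * S)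
    (a3 : ‖u₁‖ ≤ K * S) (b3 : ‖u₂‖ ≤ K * S) (a4 : S ^ 2 ≤ K * T₁) (b4 : S ^ 2 ≤ K * T₂)
    (hu : ‖u₁ - u₂‖ ≤ d * S) (hT : |T₁ - T₂| ≤ d * S ^ 2) :
    |‖v - u₁‖ ^ 2 / (2 * T₁) - ‖v - u₂‖ ^ 2 / (2 * T₂)| ≤
      d * (K ^ 2 * (1 + z)) + d * (K ^ 4 * (1 + z) ^ 2) := by
  have v1 : ‖v - u₁‖ ≤ K * (1 + z) * S := by
    calc ‖v - u₁‖ ≤ ‖v‖ + ‖u₁‖ := norm_sub_le _ _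
      _ ≤ z * S + K * S := by rw [hvz]; gcongr
      _ ≤ _ := by nlinarith [mul_nonneg hz0 hS.le]
  have v2 : ‖v - u₂‖ ≤ K * (1 + z) * S := by
    calc ‖v - u₂‖ ≤ ‖v‖ + ‖u₂‖ := norm_sub_le _ _
      _ ≤ z * S + K * S := by rw [hvz]; gcongr
      _ ≤ _ := by nlinarith [mul_nonneg hz0 hS.le]
  have i1 : 1 / T₁ ≤ K / S ^ 2 := by
    rw [div_le_div_iff₀ hT1 (by positivity)]; linarith
  have i2 : 1 / T₂ ≤ K / S ^ 2 := by
    rw [div_le_div_iff₀ hT2 (by positivity)]; linarith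
  have e : ‖v - u₁‖ ^ 2 / (2 * T₁) - ‖v - u₂‖ ^ 2 / (2 * T₂) =
      (‖v - u₁‖ - ‖v - u₂‖) * (‖v - u₁‖ + ‖v - u₂‖) / 2 * (1 / T₁) +
      ‖v - u₂‖ ^ 2 / 2 * (T₂ - T₁) * (1 / T₁ * (1 / T₂)) := by
    field_simp; ring
  rw [e]
  refine (abs_add_le _ _).trans (add_le_add ?_ ?_)
  · have f1 : |‖v - u₁‖ - ‖v - u₂‖| ≤ d * S := by
      refine (abs_norm_sub_norm_le _ _).trans ?_
      rw [sub_sub_sub_cancel_left, norm_sub_rev]; exact hu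
    rw [abs_mul, abs_div, abs_mul, abs_of_pos (show 0 < 1 / T₁ by positivity),
      abs_of_nonneg (show 0 ≤ ‖v - u₁‖ + ‖v - u₂‖ by positivity), abs_two]
    calc _ ≤ d * S * (K * (1 + z) * S + K * (1 + z) * S) / 2 * (K / S ^ 2) := by gcongr
      _ = d * (K ^ 2 * (1 + z)) := by field_simp; ring
  · rw [abs_mul, abs_mul, abs_of_nonneg (show 0 ≤ ‖v - u₂‖ ^ 2 / 2 by positivity),
      abs_of_pos (show 0 < 1 / T₁ * (1 / T₂) by positivity), abs_sub_comm]
    calc _ ≤ (K * (1 + z) * S) ^ 2 / 2 * (d * S ^ 2) * (K / S ^ 2 * (K / S ^ 2)) := by gcongr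
      _ = d * (K ^ 4 * (1 + z) ^ 2) / 2 := by field_simp
      _ ≤ d * (K ^ 4 * (1 + z) ^ 2) := half_le_self (by positivity)

/-- Lipschitz dependence of the Maxwellian on the macroscopic fields. -/
lemma abs_maxwellian_sub_le {g₁ g₂ : E N → E N → ℝ} {x : E N} (hK : 1 ≤ K)
    (h₁ : FieldBounds K α a q γ g₁ x) (h₂ : FieldBounds K α a q γ g₂ x) {d : ℝ} (hd : 0 ≤ d)
    (hρ : |density g₁ x - density g₂ x| ≤ d * densityWeight α a q γ x)
    (hu : ‖bulkVelocity g₁ x - bulkVelocity g₂ x‖ ≤ d * scale γ x)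
    (hT : |temperature g₁ x - temperature g₂ x| ≤ d * scale γ x ^ 2) (v : E N) :
    |maxwellian g₁ x v - maxwellian g₂ x v| ≤
      d * ((N + 4) * K ^ 4) * (1 + ‖v‖ / scale γ x) ^ 2 *
        (maxwellian g₁ x v + maxwellian g₂ x v) := by
  have hK0 : 0 < K := by linarith
  have hρ1 := h₁.density_pos hK
  have hT1 := h₁.temperature_pos hK
  have hρ2 := h₂.density_pos hK
  have hT2 := h₂.temperature_pos hK
  have hS := scale_pos (γ := γ) x
  have hW := densityWeight_pos (α := α) (a := a) (q := q) (γ := γ) x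
  rw [maxwellian_eq_exp hρ1 hT1, maxwellian_eq_exp hρ2 hT2]
  refine (abs_exp_sub_exp_le _ _).trans ?_
  refine mul_le_mul_of_nonneg_right ?_ (by positivity)
  obtain ⟨a1, -, a3, a4, -⟩ := h₁
  obtain ⟨b1, -, b3, b4, -⟩ := h₂
  set ρ₁ := density g₁ x
  set u₁ := bulkVelocity g₁ x
  set T₁ := temperature g₁ x
  set ρ₂ := density g₂ x
  set u₂ := bulkVelocity g₂ x
  set T₂ := temperature g₂ x
  set S := scale γ x
  set W := densityWeight α a q γ x
  set z := ‖v‖ / S with hz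
  have hz0 : 0 ≤ z := by positivity
  have hvz : ‖v‖ = z * S := by rw [hz]; field_simp
  have c1 : |Real.log ρ₁ - Real.log ρ₂| ≤ K * d := by
    refine (abs_log_sub_log_le (m := W / K) (by positivity) ?_ ?_).trans ?_
    · rw [div_le_iff₀ hK0]; linarith
    · rw [div_le_iff₀ hK0]; linarith
    · rw [div_le_iff₀ (by positivity)]
      calc _ ≤ d * W := hρ
        _ = _ := by field_simp
  have c2 : |Real.log T₁ - Real.log T₂| ≤ K * d := by
    refine (abs_log_sub_log_le (m := S ^ 2 / K) (by positivity) ?_ ?_).trans ?_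
    · rw [div_le_iff₀ hK0]; linarith
    · rw [div_le_iff₀ hK0]; linarith
    · rw [div_le_iff₀ (by positivity)]
      calc _ ≤ d * S ^ 2 := hT
        _ = _ := by field_simp
  have c3 := abs_quadratic_sub_le (v := v) hK0 hS hz0 hd hT1 hT2 hK hvz a3 b3 a4 b4 hu hT
  have e : (Real.log ρ₁ - ↑N / 2 * (Real.log (2 * Real.pi) + Real.log T₁) -
      ‖v - u₁‖ ^ 2 / (2 * T₁)) - (Real.log ρ₂ - ↑N / 2 * (Real.log (2 * Real.pi) + Real.log T₂) -
      ‖v - u₂‖ ^ 2 / (2 * T₂)) = (Real.log ρ₁ - Real.log ρ₂) +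
      (-(N / 2 * (Real.log T₁ - Real.log T₂))) +
      (-(‖v - u₁‖ ^ 2 / (2 * T₁) - ‖v - u₂‖ ^ 2 / (2 * T₂))) := by ring
  rw [e]
  refine (abs_add_three _ _ _).trans ?_
  rw [abs_neg, abs_neg, abs_mul, abs_of_nonneg (show (0:ℝ) ≤ N / 2 by positivity)]
  have p1 : K ≤ K ^ 4 := le_self_pow₀ hK (by norm_num)
  have p2 : K ^ 2 ≤ K ^ 4 := pow_le_pow_right₀ hK (by norm_num)
  have p3 : 1 + z ≤ (1 + z) ^ 2 := le_self_pow₀ (by linarith) (by norm_num)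
  have p4 : 1 ≤ (1 + z) ^ 2 := one_le_pow₀ (by linarith)
  have q1 : K * d ≤ d * (K ^ 4 * (1 + z) ^ 2) := by
    rw [mul_comm]
    gcongr
    nlinarith
  have q2 : d * (K ^ 2 * (1 + z)) ≤ d * (K ^ 4 * (1 + z) ^ 2) := by gcongr
  have q3 : (N:ℝ) / 2 * |Real.log T₁ - Real.log T₂| ≤ N * (d * (K ^ 4 * (1 + z) ^ 2)) := by
    have : (0:ℝ) ≤ N := by positivity
    calc (N:ℝ) / 2 * |Real.log T₁ - Real.log T₂| ≤ N * (K * d) := by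
          gcongr; linarith
      _ ≤ _ := by gcongr
  have hX : 0 ≤ d * (K ^ 4 * (1 + z) ^ 2) := by positivity
  calc _ ≤ d * (K ^ 4 * (1 + z) ^ 2) + N * (d * (K ^ 4 * (1 + z) ^ 2)) +
        (d * (K ^ 4 * (1 + z) ^ 2) + d * (K ^ 4 * (1 + z) ^ 2)) := by linarith
    _ ≤ d * ((N + 4) * K ^ 4) * (1 + z) ^ 2 := by nlinarith

end

/-- The integral `∫ (1+|w|)^{-(N+1)} dw`. -/
noncomputable def tailMass (N : ℕ) : ℝ := ∫ w : E N, ((1 + ‖w‖) ^ (N + 1))⁻¹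

section
variable {N : ℕ} {α a q γ K : ℝ}

lemma tailMass_nonneg (N : ℕ) : 0 ≤ tailMass N := integral_nonneg fun w => by positivity

lemma integrable_tail (N : ℕ) : Integrable fun w : E N => ((1 + ‖w‖) ^ (N + 1))⁻¹ := by
  have h := integrable_one_add_norm (E := E N) (μ := volume) (r := N + 1)
    (by rw [finrank_euclideanSpace_fin]; linarith)
  refine h.congr (Filter.Eventually.of_forall fun w => ?_)
  have : (0:ℝ) ≤ 1 + ‖w‖ := by positivity
  simp only
  rw [Real.rpow_neg this, ← Real.rpow_natCast]; push_cast; rfl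

lemma integrable_tail_scaled {S : ℝ} (hS : 0 < S) :
    Integrable fun v : E N => ((1 + ‖v‖ / S) ^ (N + 1))⁻¹ := by
  have h := (integrable_tail N).comp_smul (inv_ne_zero hS.ne')
  refine h.congr (Filter.Eventually.of_forall fun w => ?_)
  simp only [norm_smul, norm_inv, Real.norm_of_nonneg hS.le, inv_mul_eq_div]

lemma integral_tail_scaled {S : ℝ} (hS : 0 < S) :
    ∫ v : E N, ((1 + ‖v‖ / S) ^ (N + 1))⁻¹ = S ^ N * tailMass N := by
  have h := Measure.integral_comp_inv_smul (volume : Measure (E N))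
    (fun w => ((1 + ‖w‖) ^ (N + 1))⁻¹) S
  simp only [norm_smul, norm_inv, Real.norm_of_nonneg hS.le, inv_mul_eq_div,
    finrank_euclideanSpace_fin, smul_eq_mul, abs_of_pos (pow_pos hS N)] at h
  exact h

lemma pow_mul_inv_le {S r : ℝ} (hS : 0 < S) (hr : 0 ≤ r) {j : ℕ} (hj : j ≤ 2) :
    r ^ j * ((1 + r / S) ^ (N + 3))⁻¹ ≤ S ^ j * ((1 + r / S) ^ (N + 1))⁻¹ := by
  have h1 : 1 ≤ 1 + r / S := by
    have : 0 ≤ r / S := by positivity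
    linarith
  have h2 : r ^ j ≤ S ^ j * (1 + r / S) ^ 2 := by
    calc r ^ j = S ^ j * (r / S) ^ j := by rw [← mul_pow]; congr 1; field_simp
      _ ≤ S ^ j * (1 + r / S) ^ j := by gcongr; linarith
      _ ≤ S ^ j * (1 + r / S) ^ 2 := by gcongr
  have h3 : (1 + r / S) ^ (N + 3) = (1 + r / S) ^ 2 * (1 + r / S) ^ (N + 1) := by
    rw [← pow_add]; congr 1; omega
  rw [h3, mul_inv, ← mul_assoc]
  refine mul_le_mul_of_nonneg_right ?_ (by positivity)
  rw [← div_eq_mul_inv, div_le_iff₀ (by positivity)]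
  exact h2

lemma norm_pow_mul_profile_le (x v : E N) {j : ℕ} (hj : j ≤ 2) :
    ‖v‖ ^ j * profile α a q γ x v ≤
      phaseWeight α a q x * scale γ x ^ j * ((1 + ‖v‖ / scale γ x) ^ (N + 1))⁻¹ := by
  have h := pow_mul_inv_le (N := N) (scale_pos (γ := γ) x) (norm_nonneg v) hj
  have hQ := phaseWeight_pos (α := α) (a := a) (q := q) x
  unfold profile
  calc _ = phaseWeight α a q x * (‖v‖ ^ j * ((1 + ‖v‖ / scale γ x) ^ (N + 3))⁻¹) := by ring
    _ ≤ phaseWeight α a q x * (scale γ x ^ j * ((1 + ‖v‖ / scale γ x) ^ (N + 1))⁻¹) := by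
      gcongr
    _ = _ := by ring

lemma integral_majorant (x : E N) (j : ℕ) :
    ∫ v : E N, phaseWeight α a q x * scale γ x ^ j * ((1 + ‖v‖ / scale γ x) ^ (N + 1))⁻¹ =
      tailMass N * densityWeight α a q γ x * scale γ x ^ j := by
  rw [integral_const_mul, integral_tail_scaled (scale_pos x)]
  unfold densityWeight; ring

/-- Moments up to order two of a function dominated by the profile. -/
lemma integrable_of_le_profile {h : E N → ℝ} (hm : AEStronglyMeasurable h volume) {x : E N}
    {d : ℝ} (hd : ∀ v, |h v| ≤ d * profile α a q γ x v) {j : ℕ} (hj : j ≤ 2) :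
    Integrable (fun v => ‖v‖ ^ j * h v) ∧
    ∫ v, ‖v‖ ^ j * |h v| ≤ d * (tailMass N * densityWeight α a q γ x * scale γ x ^ j) := by
  have hd0 : 0 ≤ d := by
    have h1 := hd 0
    have h2 := profile_pos (α := α) (a := a) (q := q) (γ := γ) x 0
    by_contra hc
    push Not at hc
    have := abs_nonneg (h 0)
    nlinarith
  have hM : Integrable fun v : E N =>
      d * (phaseWeight α a q x * scale γ x ^ j * ((1 + ‖v‖ / scale γ x) ^ (N + 1))⁻¹) :=
    ((integrable_tail_scaled (scale_pos x)).const_mul _).const_mul _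
  have hb : ∀ v : E N, ‖v‖ ^ j * |h v| ≤
      d * (phaseWeight α a q x * scale γ x ^ j * ((1 + ‖v‖ / scale γ x) ^ (N + 1))⁻¹) := by
    intro v
    calc ‖v‖ ^ j * |h v| ≤ ‖v‖ ^ j * (d * profile α a q γ x v) := by gcongr; exact hd v
      _ = d * (‖v‖ ^ j * profile α a q γ x v) := by ring
      _ ≤ _ := mul_le_mul_of_nonneg_left (norm_pow_mul_profile_le x v hj) hd0
  have hI : Integrable (fun v => ‖v‖ ^ j * h v) := by
    refine hM.mono' ((continuous_norm.pow j).aestronglyMeasurable.mul hm) ?_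
    refine Filter.Eventually.of_forall fun v => ?_
    rw [Real.norm_eq_abs, abs_mul, abs_of_nonneg (by positivity : 0 ≤ ‖v‖ ^ j)]
    exact hb v
  refine ⟨hI, ?_⟩
  rw [← integral_majorant, ← integral_const_mul]
  refine integral_mono_of_nonneg (Filter.Eventually.of_forall fun v => by positivity) hM
    (Filter.Eventually.of_forall hb)

lemma integrable_moment {g : E N → ℝ} (h : Integrable fun v => (1 + ‖v‖ ^ 2) * g v) {j : ℕ}
    (hj : j ≤ 2) : Integrable fun v => ‖v‖ ^ j * g v := by
  have hm : AEStronglyMeasurable g volume := by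
    have : g = fun v => (1 + ‖v‖ ^ 2)⁻¹ * ((1 + ‖v‖ ^ 2) * g v) := by
      funext v
      have : (1 + ‖v‖ ^ 2) ≠ 0 := by positivity
      field_simp
    rw [this]
    refine AEStronglyMeasurable.mul (Continuous.aestronglyMeasurable ?_) h.aestronglyMeasurable
    exact Continuous.inv₀ (by fun_prop) fun v => by positivity
  refine h.mono ((continuous_norm.pow j).aestronglyMeasurable.mul hm) ?_
  refine Filter.Eventually.of_forall fun v => ?_
  rw [norm_mul, norm_mul]
  gcongr
  rw [Real.norm_of_nonneg (by positivity), Real.norm_of_nonneg (by positivity)]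
  interval_cases j
  · simp
  · nlinarith [sq_nonneg (‖v‖ - 1), norm_nonneg v]
  · linarith

lemma integrable_momentum {g : E N → ℝ} (h : Integrable fun v => (1 + ‖v‖ ^ 2) * g v) :
    Integrable fun v => g v • v := by
  have h0 := integrable_moment h (j := 0) (by norm_num)
  have h1 := integrable_moment h (j := 1) (by norm_num)
  simp only [pow_zero, one_mul] at h0
  refine h1.mono (h0.aestronglyMeasurable.smul continuous_id.aestronglyMeasurable) ?_
  refine Filter.Eventually.of_forall fun v => ?_
  rw [norm_smul, norm_mul, pow_one, norm_norm, mul_comm]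

/-- Moments of functions that differ by at most a multiple of the profile. -/
lemma moments_sub_le {g₁ g₂ : E N → ℝ} {x : E N} {d : ℝ}
    (h₁ : Integrable fun v => (1 + ‖v‖ ^ 2) * g₁ v)
    (h₂ : Integrable fun v => (1 + ‖v‖ ^ 2) * g₂ v)
    (hd : ∀ v, |g₁ v - g₂ v| ≤ d * profile α a q γ x v) :
    |(∫ v, g₁ v) - ∫ v, g₂ v| ≤ d * tailMass N * densityWeight α a q γ x ∧
    ‖(∫ v, g₁ v • v) - ∫ v, g₂ v • v‖ ≤
      d * tailMass N * densityWeight α a q γ x * scale γ x ∧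
    |(∫ v, ‖v‖ ^ 2 * g₁ v) - ∫ v, ‖v‖ ^ 2 * g₂ v| ≤
      d * tailMass N * densityWeight α a q γ x * scale γ x ^ 2 := by
  have i1 := integrable_moment h₁ (j := 0) (by norm_num)
  have i2 := integrable_moment h₂ (j := 0) (by norm_num)
  simp only [pow_zero, one_mul] at i1 i2
  have hm : AEStronglyMeasurable (fun v => g₁ v - g₂ v) volume :=
    i1.aestronglyMeasurable.sub i2.aestronglyMeasurable
  refine ⟨?_, ?_, ?_⟩
  · have h := (integrable_of_le_profile hm hd (j := 0) (by norm_num)).2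
    simp only [pow_zero, one_mul, mul_one] at h
    rw [← integral_sub i1 i2]
    refine (abs_integral_le_integral_abs).trans (h.trans (le_of_eq (by ring)))
  · have h := (integrable_of_le_profile hm hd (j := 1) (by norm_num)).2
    simp only [pow_one] at h
    rw [← integral_sub (integrable_momentum h₁) (integrable_momentum h₂)]
    refine (norm_integral_le_integral_norm _).trans ?_
    refine (le_of_eq ?_).trans (h.trans (le_of_eq (by ring)))
    congr 1; funext v
    rw [← sub_smul, norm_smul, Real.norm_eq_abs, mul_comm]
  · have h := (integrable_of_le_profile hm hd (j := 2) (by norm_num)).2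
    rw [← integral_sub (integrable_moment h₁ le_rfl) (integrable_moment h₂ le_rfl)]
    refine (abs_integral_le_integral_abs).trans ?_
    refine (le_of_eq ?_).trans (h.trans (le_of_eq (by ring)))
    congr 1; funext v
    rw [← mul_sub, abs_mul, abs_of_nonneg (by positivity)]

lemma energy_div_density_eq (hN : 1 ≤ N) (g : E N → E N → ℝ) (x : E N) :
    (∫ v, ‖v‖ ^ 2 * g x v) / density g x = N * temperature g x + ‖bulkVelocity g x‖ ^ 2 := by
  have : (N:ℝ) ≠ 0 := by positivity
  unfold temperature
  field_simp
  ring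

set_option maxHeartbeats 1000000 in
/-- Macroscopic fields depend in a Lipschitz way on the phase-space density. -/
lemma fields_sub_le (hN : 1 ≤ N) (hK : 1 ≤ K) {g₁ g₂ : E N → E N → ℝ} {x : E N} {d : ℝ}
    (hd0 : 0 ≤ d)
    (f₁ : FieldBounds K α a q γ g₁ x) (f₂ : FieldBounds K α a q γ g₂ x)
    (h₁ : Integrable fun v => (1 + ‖v‖ ^ 2) * g₁ x v)
    (h₂ : Integrable fun v => (1 + ‖v‖ ^ 2) * g₂ x v)
    (hd : ∀ v, |g₁ x v - g₂ x v| ≤ d * profile α a q γ x v) :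
    |density g₁ x - density g₂ x| ≤
      (8 * N * K ^ 3 * tailMass N * d) * densityWeight α a q γ x ∧
    ‖bulkVelocity g₁ x - bulkVelocity g₂ x‖ ≤ (8 * N * K ^ 3 * tailMass N * d) * scale γ x ∧
    |temperature g₁ x - temperature g₂ x| ≤
      (8 * N * K ^ 3 * tailMass N * d) * scale γ x ^ 2 := by
  have hK0 : 0 < K := by linarith
  have hN' : (1:ℝ) ≤ N := by exact_mod_cast hN
  obtain ⟨b0, b1, b2⟩ := moments_sub_le h₁ h₂ hd
  have hρ1 := f₁.density_pos hK
  have hρ2 := f₂.density_pos hK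
  have hT2 := f₂.temperature_pos hK
  have hS := scale_pos (γ := γ) x
  have hW := densityWeight_pos (α := α) (a := a) (q := q) (γ := γ) x
  have hκ := tailMass_nonneg N
  have e1 := energy_div_density_eq hN g₁ x
  have e2 := energy_div_density_eq hN g₂ x
  have r1 : (1 / density g₁ x) * densityWeight α a q γ x ≤ K := by
    rw [one_div, inv_mul_le_iff₀ hρ1, mul_comm]
    exact f₁.le_density
  have m1 : bulkVelocity g₁ x = (density g₁ x)⁻¹ • ∫ v, g₁ x v • v := rfl
  have m2 : (∫ v, g₂ x v • v) = density g₂ x • bulkVelocity g₂ x := by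
    rw [bulkVelocity, smul_smul, mul_inv_cancel₀ hρ2.ne', one_smul]
  rw [m2] at b1
  change |density g₁ x - density g₂ x| ≤ _ at b0
  have hu1 := f₁.velocity_le
  have hu2 := f₂.velocity_le
  have ht2 := f₂.temperature_le
  set D := d * tailMass N with hD
  have hD0 : 0 ≤ D := by positivity
  have hK3 : 1 ≤ K ^ 3 := one_le_pow₀ hK
  have big : ∀ c : ℝ, c ≤ 8 * N * K ^ 3 → c * D ≤ 8 * N * K ^ 3 * tailMass N * d := by
    intro c hc
    calc c * D ≤ (8 * N * K ^ 3) * D := by gcongr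
      _ = _ := by rw [hD]; ring
  have hρr : |density g₁ x - density g₂ x| * (1 / density g₁ x) ≤ D * K := by
    calc _ ≤ D * densityWeight α a q γ x * (1 / density g₁ x) := by gcongr
      _ = D * ((1 / density g₁ x) * densityWeight α a q γ x) := by ring
      _ ≤ D * K := by gcongr
  have hK12 : K ≤ K ^ 3 := le_self_pow₀ hK (by norm_num)
  have hK22 : K ^ 2 ≤ K ^ 3 := pow_le_pow_right₀ hK (by norm_num)
  have hNK : K ^ 3 ≤ N * K ^ 3 := le_mul_of_one_le_left (by positivity) hN'
  have hu : ‖bulkVelocity g₁ x - bulkVelocity g₂ x‖ ≤ (2 * K ^ 2) * D * scale γ x := by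
    have e : bulkVelocity g₁ x - bulkVelocity g₂ x =
        (1 / density g₁ x) • ((∫ v, g₁ x v • v) - density g₂ x • bulkVelocity g₂ x) +
        ((density g₂ x - density g₁ x) * (1 / density g₁ x)) • bulkVelocity g₂ x := by
      rw [smul_sub, smul_smul, m1, one_div, sub_mul, mul_inv_cancel₀ hρ1.ne', sub_smul, one_smul,
        mul_comm (density g₂ x)]
      abel
    rw [e]
    refine (norm_add_le _ _).trans ?_
    rw [norm_smul, norm_smul, norm_mul, Real.norm_of_nonneg (by positivity : 0 ≤ 1 / density g₁ x),
      Real.norm_eq_abs, abs_sub_comm]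
    have t1 : 1 / density g₁ x * ‖(∫ v, g₁ x v • v) - density g₂ x • bulkVelocity g₂ x‖ ≤
        K * (D * scale γ x) := by
      calc _ ≤ 1 / density g₁ x * (D * densityWeight α a q γ x * scale γ x) := by gcongr
        _ = ((1 / density g₁ x) * densityWeight α a q γ x) * (D * scale γ x) := by ring
        _ ≤ _ := by gcongr
    have t2 : |density g₁ x - density g₂ x| * (1 / density g₁ x) * ‖bulkVelocity g₂ x‖ ≤
        D * K * (K * scale γ x) := by gcongr
    have t3 : K * (D * scale γ x) ≤ K ^ 2 * (D * scale γ x) := by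
      gcongr; nlinarith
    nlinarith
  refine ⟨?_, ?_, ?_⟩
  · refine b0.trans ?_
    refine mul_le_mul_of_nonneg_right ?_ hW.le
    simpa using big 1 (by linarith)
  · refine hu.trans ?_
    refine mul_le_mul_of_nonneg_right ?_ hS.le
    exact big _ (by linarith)
  · set e₁ := ∫ v, ‖v‖ ^ 2 * g₁ x v
    set e₂ := ∫ v, ‖v‖ ^ 2 * g₂ x v
    have e3 : e₂ = density g₂ x * (N * temperature g₂ x + ‖bulkVelocity g₂ x‖ ^ 2) := by
      rw [← e2]; field_simp
    have bE : N * temperature g₂ x + ‖bulkVelocity g₂ x‖ ^ 2 ≤ 2 * N * K ^ 2 * scale γ x ^ 2 := by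
      have s1 : ‖bulkVelocity g₂ x‖ ^ 2 ≤ (K * scale γ x) ^ 2 := by gcongr
      have s2 : N * temperature g₂ x ≤ N * (K * scale γ x ^ 2) := by gcongr
      have s3 : N * (K * scale γ x ^ 2) ≤ N * (K ^ 2 * scale γ x ^ 2) := by
        gcongr; nlinarith
      have s4 : (K * scale γ x) ^ 2 ≤ N * (K ^ 2 * scale γ x ^ 2) := by
        rw [mul_pow]; exact le_mul_of_one_le_left (by positivity) hN'
      linarith
    have dE : |e₁ / density g₁ x - e₂ / density g₂ x| ≤ 3 * N * K ^ 3 * D * scale γ x ^ 2 := by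
      have e : e₁ / density g₁ x - e₂ / density g₂ x = (1 / density g₁ x) * (e₁ - e₂) +
          ((density g₂ x - density g₁ x) * (1 / density g₁ x)) *
          (N * temperature g₂ x + ‖bulkVelocity g₂ x‖ ^ 2) := by
        rw [← e2]; field_simp; ring
      rw [e]
      refine (abs_add_le _ _).trans ?_
      rw [abs_mul, abs_mul, abs_mul, abs_of_nonneg (by positivity : 0 ≤ 1 / density g₁ x),
        abs_sub_comm (density g₂ x),
        abs_of_nonneg (by positivity : 0 ≤ N * temperature g₂ x + ‖bulkVelocity g₂ x‖ ^ 2)]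
      have t1 : 1 / density g₁ x * |e₁ - e₂| ≤ K * (D * scale γ x ^ 2) := by
        calc _ ≤ 1 / density g₁ x * (D * densityWeight α a q γ x * scale γ x ^ 2) := by gcongr
          _ = ((1 / density g₁ x) * densityWeight α a q γ x) * (D * scale γ x ^ 2) := by ring
          _ ≤ _ := by gcongr
      have t2 : |density g₁ x - density g₂ x| * (1 / density g₁ x) *
          (N * temperature g₂ x + ‖bulkVelocity g₂ x‖ ^ 2) ≤
          D * K * (2 * N * K ^ 2 * scale γ x ^ 2) := by gcongr
      have t3 : K * (D * scale γ x ^ 2) ≤ (N * K ^ 3) * (D * scale γ x ^ 2) := by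
        gcongr; linarith
      nlinarith
    have dU : |‖bulkVelocity g₁ x‖ ^ 2 - ‖bulkVelocity g₂ x‖ ^ 2| ≤
        4 * N * K ^ 3 * D * scale γ x ^ 2 := by
      have : ‖bulkVelocity g₁ x‖ ^ 2 - ‖bulkVelocity g₂ x‖ ^ 2 =
        (‖bulkVelocity g₁ x‖ - ‖bulkVelocity g₂ x‖) *
          (‖bulkVelocity g₁ x‖ + ‖bulkVelocity g₂ x‖) := by ring
      rw [this, abs_mul, abs_of_nonneg
        (by positivity : 0 ≤ ‖bulkVelocity g₁ x‖ + ‖bulkVelocity g₂ x‖)]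
      calc _ ≤ (2 * K ^ 2) * D * scale γ x * (K * scale γ x + K * scale γ x) := by
            gcongr; exact (abs_norm_sub_norm_le _ _).trans hu
        _ = 4 * K ^ 3 * (D * scale γ x ^ 2) := by ring
        _ ≤ 4 * (N * K ^ 3) * (D * scale γ x ^ 2) := by gcongr
        _ = _ := by ring
    have e4 : N * (temperature g₁ x - temperature g₂ x) =
        (e₁ / density g₁ x - e₂ / density g₂ x) -
        (‖bulkVelocity g₁ x‖ ^ 2 - ‖bulkVelocity g₂ x‖ ^ 2) := by
      rw [e1, e2]; ring
    have e5 : |temperature g₁ x - temperature g₂ x| ≤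
        |N * (temperature g₁ x - temperature g₂ x)| := by
      rw [abs_mul, abs_of_nonneg (by positivity : (0:ℝ) ≤ N)]
      exact le_mul_of_one_le_left (abs_nonneg _) hN'
    rw [e4] at e5
    have e6 := e5.trans (abs_sub _ _)
    have e7 : (7 * N * K ^ 3) * D * scale γ x ^ 2 ≤
        8 * N * K ^ 3 * tailMass N * d * scale γ x ^ 2 :=
      mul_le_mul_of_nonneg_right (big (7 * N * K ^ 3) (by linarith)) (by positivity)
    linarith

/-- Fields controlled by moments. -/
lemma fields_of_moments (hN : 1 ≤ N) {g : E N → E N → ℝ} {x : E N} {c C η : ℝ} (hc : 0 < c)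
    (hη0 : 0 ≤ η)
    (h1 : c * densityWeight α a q γ x ≤ density g x)
    (h2 : density g x ≤ C * densityWeight α a q γ x)
    (h3 : ‖∫ v, g x v • v‖ ≤ η * densityWeight α a q γ x * scale γ x)
    (h4 : c * densityWeight α a q γ x * scale γ x ^ 2 ≤ ∫ v, ‖v‖ ^ 2 * g x v)
    (h5 : ∫ v, ‖v‖ ^ 2 * g x v ≤ C * densityWeight α a q γ x * scale γ x ^ 2)
    (hη : (η / c) ^ 2 ≤ c / (2 * C)) :
    ‖bulkVelocity g x‖ ≤ η / c * scale γ x ∧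
    c / (2 * C * N) * scale γ x ^ 2 ≤ temperature g x ∧
    temperature g x ≤ C / c * scale γ x ^ 2 := by
  have hN' : (1:ℝ) ≤ N := by exact_mod_cast hN
  have hS := scale_pos (γ := γ) x
  have hW := densityWeight_pos (α := α) (a := a) (q := q) (γ := γ) x
  have e1 := energy_div_density_eq hN g x
  set W := densityWeight α a q γ x
  set S := scale γ x
  have hρ : 0 < density g x := lt_of_lt_of_le (by positivity) h1
  have hC : 0 < C := by
    by_contra hcc
    push Not at hcc
    nlinarith
  have hu : ‖bulkVelocity g x‖ ≤ η / c * S := by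
    rw [bulkVelocity, norm_smul, norm_inv, Real.norm_of_nonneg hρ.le, inv_mul_le_iff₀ hρ]
    calc _ ≤ η * W * S := h3
      _ = (c * W) * (η / c * S) := by field_simp
      _ ≤ density g x * (η / c * S) := by gcongr
  have hu2 : ‖bulkVelocity g x‖ ^ 2 ≤ c / (2 * C) * S ^ 2 := by
    calc ‖bulkVelocity g x‖ ^ 2 ≤ (η / c * S) ^ 2 := by gcongr
      _ = (η / c) ^ 2 * S ^ 2 := by ring
      _ ≤ _ := by gcongr
  refine ⟨hu, ?_, ?_⟩
  · have : c / C * S ^ 2 ≤ (∫ v, ‖v‖ ^ 2 * g x v) / density g x := by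
      rw [le_div_iff₀ hρ]
      calc c / C * S ^ 2 * density g x ≤ c / C * S ^ 2 * (C * W) := by gcongr
        _ = c * W * S ^ 2 := by field_simp
        _ ≤ _ := h4
    have h6 : c / (2 * C * N) * S ^ 2 = (c / C * S ^ 2 - c / (2 * C) * S ^ 2) / N := by
      field_simp; ring
    rw [h6, div_le_iff₀ (by linarith)]
    linarith
  · have : (∫ v, ‖v‖ ^ 2 * g x v) / density g x ≤ C / c * S ^ 2 := by
      rw [div_le_iff₀ hρ]
      calc _ ≤ C * W * S ^ 2 := h5
        _ = C / c * S ^ 2 * (c * W) := by field_simp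
        _ ≤ _ := by gcongr
    have hT : N * temperature g x ≤ C / c * S ^ 2 := by
      nlinarith [sq_nonneg ‖bulkVelocity g x‖]
    have h6 : (0:ℝ) ≤ C / c * S ^ 2 := by positivity
    rcases le_or_gt (temperature g x) 0 with h | h
    · linarith
    · nlinarith

end

/-- The gain term in Duhamel's formula. -/
noncomputable def gain {N : ℕ} (f : ℝ → E N → E N → ℝ) (t : ℝ) (x v : E N) : ℝ :=
  ∫ τ in (0 : ℝ)..t, Real.exp (-(t - τ)) * maxwellian (f τ) (x - (t - τ) • v) v

/-- The free transport term in Duhamel's formula. -/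
noncomputable def freeTransport {N : ℕ} (f₀ : E N → E N → ℝ) (t : ℝ) (x v : E N) : ℝ :=
  Real.exp (-t) * f₀ (x - t • v) v

/-- One step of the Picard iteration on `[0,t₀]`. -/
noncomputable def picardStep {N : ℕ} (f₀ : E N → E N → ℝ) (t₀ : ℝ) (f : ℝ → E N → E N → ℝ)
    (t : ℝ) (x v : E N) : ℝ :=
  {s : ℝ | s ∈ Icc 0 t₀}.indicator (fun s => freeTransport f₀ s x v + gain f s x v) t

/-- Non-negative measurable phase-space densities with controlled macroscopic fields. -/
structure Admissible {N : ℕ} (K α a q γ t₀ : ℝ) (f : ℝ → E N → E N → ℝ) : Prop where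
  measurable : Measurable fun p : ℝ × E N × E N => f p.1 p.2.1 p.2.2
  nonneg : ∀ t ∈ Icc 0 t₀, ∀ x v, 0 ≤ f t x v
  integrable_moments : ∀ t ∈ Icc 0 t₀, ∀ x, Integrable fun v => (1 + ‖v‖ ^ 2) * f t x v
  fields : ∀ t ∈ Icc 0 t₀, ∀ x, FieldBounds K α a q γ (f t) x

section
variable {N : ℕ} {α a q γ K t₀ : ℝ}

lemma exists_maxwellian_shift_le (N : ℕ) (h : WeightExponents α a q γ) (hK : 1 ≤ K) :
    ∃ A : ℝ, 0 < A ∧ ∀ g : E N → E N → ℝ, (∀ x, FieldBounds K α a q γ g x) →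
      ∀ s : ℝ, 0 ≤ s → s ≤ 1 → ∀ x v : E N,
        maxwellian g (x - s • v) v ≤ A * profile α a q γ x v := by
  have hK0 : 0 < K := by linarith
  obtain ⟨B, hB, hb⟩ := exists_gaussian_shift_le N h (k := 1 / (4 * K)) (by positivity)
  refine ⟨K * K ^ ((N : ℝ) / 2) * Real.exp (K / 2) * B, by positivity, ?_⟩
  intro g hg s hs hs1 x v
  refine (maxwellian_le hK (hg (x - s • v)) v).trans ?_
  rw [mul_assoc _ B]
  refine mul_le_mul_of_nonneg_left ?_ (by positivity)
  refine le_trans ?_ (hb s hs hs1 x v)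
  refine mul_le_mul_of_nonneg_left ?_ (phaseWeight_pos _).le
  refine le_mul_of_one_le_left (by positivity) (one_le_pow₀ ?_)
  have := scale_pos (γ := γ) (x - s • v)
  have : 0 ≤ ‖v‖ / scale γ (x - s • v) := by positivity
  linarith

lemma exists_maxwellian_shift_sub_le (hN : 1 ≤ N) (h : WeightExponents α a q γ) (hK : 1 ≤ K) :
    ∃ A : ℝ, 0 < A ∧ ∀ g₁ g₂ : E N → E N → ℝ, (∀ x, FieldBounds K α a q γ g₁ x) →
      (∀ x, FieldBounds K α a q γ g₂ x) →
      (∀ x, Integrable fun v => (1 + ‖v‖ ^ 2) * g₁ x v) →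
      (∀ x, Integrable fun v => (1 + ‖v‖ ^ 2) * g₂ x v) →
      ∀ d : ℝ, 0 ≤ d → (∀ x v, |g₁ x v - g₂ x v| ≤ d * profile α a q γ x v) →
      ∀ s : ℝ, 0 ≤ s → s ≤ 1 → ∀ x v : E N,
        |maxwellian g₁ (x - s • v) v - maxwellian g₂ (x - s • v) v| ≤
          A * d * profile α a q γ x v := by
  have hK0 : 0 < K := by linarith
  obtain ⟨B, hB, hb⟩ := exists_gaussian_shift_le N h (k := 1 / (4 * K)) (by positivity)
  have hκ := tailMass_nonneg N
  set R := K * K ^ ((N : ℝ) / 2) * Real.exp (K / 2) with hR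
  have hR0 : 0 < R := by positivity
  set L := 8 * N * K ^ 3 * tailMass N with hL
  have hL0 : 0 ≤ L := by positivity
  refine ⟨L * ((N + 4) * K ^ 4) * (2 * R) * B + 1, by positivity, ?_⟩
  intro g₁ g₂ f₁ f₂ i₁ i₂ d hd hdiff s hs hs1 x v
  set y := x - s • v with hy
  obtain ⟨c0, c1, c2⟩ := fields_sub_le hN hK hd (f₁ y) (f₂ y) (i₁ y) (i₂ y) (hdiff y)
  have hP := profile_pos (α := α) (a := a) (q := q) (γ := γ) x v
  have m1 := maxwellian_le hK (f₁ y) v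
  have m2 := maxwellian_le hK (f₂ y) v
  have hz : 0 ≤ ‖v‖ / scale γ y := div_nonneg (norm_nonneg v) (scale_pos y).le
  have hb' := hb s hs hs1 x v
  rw [← hy] at hb'
  rw [← hR] at m1 m2
  calc |maxwellian g₁ y v - maxwellian g₂ y v|
      ≤ (L * d) * ((N + 4) * K ^ 4) * (1 + ‖v‖ / scale γ y) ^ 2 *
        (maxwellian g₁ y v + maxwellian g₂ y v) :=
        abs_maxwellian_sub_le hK (f₁ y) (f₂ y) (by positivity) c0 c1 c2 v
    _ ≤ (L * d) * ((N + 4) * K ^ 4) * (1 + ‖v‖ / scale γ y) ^ 2 *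
        (R * (phaseWeight α a q y * Real.exp (-(1 / (4 * K)) * (‖v‖ / scale γ y) ^ 2)) +
        R * (phaseWeight α a q y * Real.exp (-(1 / (4 * K)) * (‖v‖ / scale γ y) ^ 2))) := by
        gcongr
    _ = (L * d) * ((N + 4) * K ^ 4) * (2 * R) * (phaseWeight α a q y *
        ((1 + ‖v‖ / scale γ y) ^ 2 *
        Real.exp (-(1 / (4 * K)) * (‖v‖ / scale γ y) ^ 2))) := by ring
    _ ≤ (L * d) * ((N + 4) * K ^ 4) * (2 * R) * (B * profile α a q γ x v) := by gcongr
    _ = (L * ((N + 4) * K ^ 4) * (2 * R) * B) * d * profile α a q γ x v := by ring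
    _ ≤ _ := by gcongr; linarith

lemma measurable_maxwellian {f : ℝ → E N → E N → ℝ}
    (hf : Measurable fun p : ℝ × E N × E N => f p.1 p.2.1 p.2.2) :
    Measurable fun p : ℝ × E N × E N => maxwellian (f p.1) p.2.1 p.2.2 := by
  have hf' : Measurable fun p : (ℝ × E N) × E N => f p.1.1 p.1.2 p.2 :=
    hf.comp (by fun_prop : Measurable fun p : (ℝ × E N) × E N => (p.1.1, p.1.2, p.2))
  have hρ : Measurable fun p : ℝ × E N => density (f p.1) p.2 :=
    (hf'.stronglyMeasurable.integral_prod_right').measurable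
  have hm : Measurable fun p : ℝ × E N => ∫ v, f p.1 p.2 v • v :=
    (StronglyMeasurable.integral_prod_right'
      (f := fun p : (ℝ × E N) × E N => f p.1.1 p.1.2 p.2 • p.2)
      (hf'.smul measurable_snd).stronglyMeasurable).measurable
  have he : Measurable fun p : ℝ × E N => ∫ v, ‖v‖ ^ 2 * f p.1 p.2 v :=
    (StronglyMeasurable.integral_prod_right'
      (f := fun p : (ℝ × E N) × E N => ‖p.2‖ ^ 2 * f p.1.1 p.1.2 p.2)
      ((measurable_snd.norm.pow_const 2).mul hf').stronglyMeasurable).measurable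
  have hu : Measurable fun p : ℝ × E N => bulkVelocity (f p.1) p.2 := hρ.inv.smul hm
  have hT : Measurable fun p : ℝ × E N => temperature (f p.1) p.2 :=
    ((he.div hρ).sub (hu.norm.pow_const 2)).div_const _
  have hpr : Measurable fun p : ℝ × E N × E N => (p.1, p.2.1) := by fun_prop
  have hρ' := hρ.comp hpr
  have hu' := hu.comp hpr
  have hT' := hT.comp hpr
  have hv : Measurable fun p : ℝ × E N × E N => p.2.2 := by fun_prop
  exact (hρ'.div ((hT'.const_mul _).pow_const _)).mul
    (Real.measurable_exp.comp (((hv.sub hu').norm.pow_const 2).div (hT'.const_mul 2)).neg)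

lemma measurable_gain_integrand {f : ℝ → E N → E N → ℝ}
    (hf : Measurable fun p : ℝ × E N × E N => f p.1 p.2.1 p.2.2) :
    Measurable fun p : (ℝ × E N × E N) × ℝ => Real.exp (-(p.1.1 - p.2)) *
      maxwellian (f p.2) (p.1.2.1 - (p.1.1 - p.2) • p.1.2.2) p.1.2.2 := by
  refine Measurable.mul (by fun_prop) ((measurable_maxwellian hf).comp
    (by fun_prop : Measurable fun p : (ℝ × E N × E N) × ℝ =>
      (p.2, p.1.2.1 - (p.1.1 - p.2) • p.1.2.2, p.1.2.2)))

lemma measurable_picardStep {f₀ : E N → E N → ℝ} {f : ℝ → E N → E N → ℝ}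
    (hf₀ : Measurable fun p : E N × E N => f₀ p.1 p.2)
    (hf : Measurable fun p : ℝ × E N × E N => f p.1 p.2.1 p.2.2) :
    Measurable fun p : ℝ × E N × E N => picardStep f₀ t₀ f p.1 p.2.1 p.2.2 := by
  have h1 : Measurable fun p : ℝ × E N × E N => freeTransport f₀ p.1 p.2.1 p.2.2 :=
    Measurable.mul (by fun_prop) (hf₀.comp (by fun_prop :
      Measurable fun p : ℝ × E N × E N => (p.2.1 - p.1 • p.2.2, p.2.2)))
  have h2 : Measurable fun p : (ℝ × E N × E N) × ℝ =>
      {p : (ℝ × E N × E N) × ℝ | 0 < p.2 ∧ p.2 ≤ p.1.1}.indicator (fun p =>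
      Real.exp (-(p.1.1 - p.2)) *
      maxwellian (f p.2) (p.1.2.1 - (p.1.1 - p.2) • p.1.2.2) p.1.2.2) p := by
    refine (measurable_gain_integrand hf).indicator ?_
    exact (measurableSet_lt measurable_const measurable_snd).inter
      (measurableSet_le measurable_snd (by fun_prop))
  have h3 := (h2.stronglyMeasurable.integral_prod_right' (ν := volume)).measurable
  have hI : MeasurableSet {p : ℝ × E N × E N | p.1 ∈ Icc 0 t₀} :=
    measurable_fst measurableSet_Icc
  have h4 := (h1.add h3).indicator hI
  convert h4 using 1
  funext p
  unfold picardStep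
  by_cases hp : p.1 ∈ Icc 0 t₀
  · rw [indicator_of_mem (by exact hp), indicator_of_mem (by exact hp)]
    simp only [Pi.add_apply]
    congr 1
    rw [gain, intervalIntegral.integral_of_le hp.1, ← integral_indicator measurableSet_Ioc]
    rfl
  · rw [indicator_of_notMem (by exact hp), indicator_of_notMem (by exact hp)]

lemma Admissible.intervalIntegrable_gain (hex : WeightExponents α a q γ) (hK : 1 ≤ K)
    (ht₀ : t₀ ≤ 1) {f : ℝ → E N → E N → ℝ} (hf : Admissible K α a q γ t₀ f) {t : ℝ}
    (ht : t ∈ Icc 0 t₀) (x v : E N) : IntervalIntegrable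
      (fun τ => Real.exp (-(t - τ)) * maxwellian (f τ) (x - (t - τ) • v) v) volume 0 t := by
  obtain ⟨A, hA, hAb⟩ := exists_maxwellian_shift_le N hex hK
  rw [intervalIntegrable_iff_integrableOn_Ioc_of_le ht.1]
  have hm : Measurable (fun τ => Real.exp (-(t - τ)) * maxwellian (f τ) (x - (t - τ) • v) v) :=
    (measurable_gain_integrand hf.measurable).comp
      (by fun_prop : Measurable fun τ : ℝ => ((t, x, v), τ))
  refine Measure.integrableOn_of_bounded (M := A * profile α a q γ x v) (by simp)
    hm.aestronglyMeasurable ?_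
  refine (ae_restrict_mem measurableSet_Ioc).mono fun τ hτ => ?_
  have hτ' : τ ∈ Icc 0 t₀ := ⟨hτ.1.le, hτ.2.trans ht.2⟩
  have hg := hf.fields τ hτ'
  have hM := maxwellian_nonneg ((hg (x - (t - τ) • v)).density_pos hK).le
    ((hg (x - (t - τ) • v)).temperature_pos hK).le v
  rw [Real.norm_of_nonneg (mul_nonneg (Real.exp_pos _).le hM)]
  refine (mul_le_of_le_one_left hM ?_).trans
    (hAb (f τ) hg (t - τ) (by linarith [hτ.2]) (by linarith [hτ.1, ht.2]) x v)
  rw [Real.exp_le_one_iff]; linarith [hτ.2]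

lemma Admissible.gain_nonneg (hK : 1 ≤ K) {f : ℝ → E N → E N → ℝ}
    (hf : Admissible K α a q γ t₀ f) {t : ℝ} (ht : t ∈ Icc 0 t₀) (x v : E N) :
    0 ≤ gain f t x v := by
  refine intervalIntegral.integral_nonneg ht.1 fun τ hτ => ?_
  have hg := hf.fields τ ⟨hτ.1, hτ.2.trans ht.2⟩ (x - (t - τ) • v)
  exact mul_nonneg (Real.exp_pos _).le
    (maxwellian_nonneg (hg.density_pos hK).le (hg.temperature_pos hK).le v)

lemma exists_gain_le (N : ℕ) (hex : WeightExponents α a q γ) (hK : 1 ≤ K) :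
    ∃ A : ℝ, 0 < A ∧ ∀ t₀ ≤ 1, ∀ f : ℝ → E N → E N → ℝ, Admissible K α a q γ t₀ f →
      ∀ t ∈ Icc 0 t₀, ∀ x v, gain f t x v ≤ A * t * profile α a q γ x v := by
  obtain ⟨A, hA, hAb⟩ := exists_maxwellian_shift_le N hex hK
  refine ⟨A, hA, fun t₀ ht₀ f hf t ht x v => ?_⟩
  have h : gain f t x v ≤ ∫ τ in (0:ℝ)..t, A * profile α a q γ x v := by
    refine intervalIntegral.integral_mono_on ht.1 (hf.intervalIntegrable_gain hex hK ht₀ ht x v)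
      intervalIntegrable_const fun τ hτ => ?_
    have hg := hf.fields τ ⟨hτ.1, hτ.2.trans ht.2⟩
    have hM := maxwellian_nonneg ((hg (x - (t - τ) • v)).density_pos hK).le
      ((hg (x - (t - τ) • v)).temperature_pos hK).le v
    refine (mul_le_of_le_one_left hM ?_).trans
      (hAb (f τ) hg (t - τ) (by linarith [hτ.2]) (by linarith [hτ.1, ht.2]) x v)
    rw [Real.exp_le_one_iff]; linarith [hτ.2]
  rw [intervalIntegral.integral_const, smul_eq_mul] at h
  linarith

lemma exists_gain_sub_le (hN : 1 ≤ N) (hex : WeightExponents α a q γ) (hK : 1 ≤ K) :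
    ∃ A : ℝ, 0 < A ∧ ∀ t₀ ≤ 1, ∀ f g : ℝ → E N → E N → ℝ, Admissible K α a q γ t₀ f →
      Admissible K α a q γ t₀ g → ∀ B : ℝ, 0 ≤ B → ∀ n : ℕ,
      (∀ t ∈ Icc 0 t₀, ∀ x v,
        |f t x v - g t x v| ≤ B * ((A * t) ^ n / n.factorial) * profile α a q γ x v) →
      ∀ t ∈ Icc 0 t₀, ∀ x v, |gain f t x v - gain g t x v| ≤
        B * ((A * t) ^ (n + 1) / (n + 1).factorial) * profile α a q γ x v := by
  obtain ⟨A, hA, hAb⟩ := exists_maxwellian_shift_sub_le hN hex hK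
  refine ⟨A, hA, fun t₀ ht₀ f g hf hg B hB n hfg t ht x v => ?_⟩
  rw [gain, gain, ← intervalIntegral.integral_sub (hf.intervalIntegrable_gain hex hK ht₀ ht x v)
    (hg.intervalIntegrable_gain hex hK ht₀ ht x v), ← Real.norm_eq_abs]
  have h : ‖∫ τ in (0:ℝ)..t,
      (Real.exp (-(t - τ)) * maxwellian (f τ) (x - (t - τ) • v) v -
        Real.exp (-(t - τ)) * maxwellian (g τ) (x - (t - τ) • v) v)‖ ≤
      ∫ τ in (0:ℝ)..t, (A * (B * A ^ n / n.factorial) * profile α a q γ x v) * τ ^ n := by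
    refine intervalIntegral.norm_integral_le_of_norm_le ht.1
      (Filter.Eventually.of_forall fun τ hτ => ?_)
      (Continuous.intervalIntegrable (by fun_prop) _ _)
    have hτ' : τ ∈ Icc 0 t₀ := ⟨hτ.1.le, hτ.2.trans ht.2⟩
    have hτ0 : 0 ≤ τ := hτ.1.le
    rw [← mul_sub, norm_mul, Real.norm_of_nonneg (Real.exp_pos _).le, Real.norm_eq_abs]
    have hP := profile_pos (α := α) (a := a) (q := q) (γ := γ) x v
    refine (mul_le_of_le_one_left (abs_nonneg _) ?_).trans
      ((hAb (f τ) (g τ) (hf.fields τ hτ') (hg.fields τ hτ') (hf.integrable_moments τ hτ')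
        (hg.integrable_moments τ hτ') (B * ((A * τ) ^ n / n.factorial)) (by positivity)
        (hfg τ hτ') (t - τ) (by linarith [hτ.2]) (by linarith [hτ.1, ht.2]) x v).trans ?_)
    · rw [Real.exp_le_one_iff]; linarith [hτ.2]
    · rw [mul_pow]; apply le_of_eq; ring
  refine h.trans (le_of_eq ?_)
  rw [intervalIntegral.integral_const_mul, integral_pow, Nat.factorial_succ]
  push_cast
  have : ((n.factorial : ℕ) : ℝ) ≠ 0 := by positivity
  field_simp
  ring

/-- Uniqueness of admissible solutions. -/
theorem solution_unique (hN : 1 ≤ N) (hex : WeightExponents α a q γ) (hK : 1 ≤ K) (ht₀ : t₀ ≤ 1)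
    {f₀ : E N → E N → ℝ} {f g : ℝ → E N → E N → ℝ} (hf : IsSolution f₀ t₀ f)
    (hg : IsSolution f₀ t₀ g) (hfa : Admissible K α a q γ t₀ f)
    (hga : Admissible K α a q γ t₀ g) {t : ℝ} (ht : t ∈ Icc 0 t₀) (x v : E N) :
    g t x v = f t x v := by
  obtain ⟨A, hA, hAb⟩ := exists_gain_sub_le hN hex hK
  obtain ⟨A₁, hA₁, hAb₁⟩ := exists_gain_le N hex hK
  have hsub : ∀ t ∈ Icc 0 t₀, ∀ x v, f t x v - g t x v = gain f t x v - gain g t x v := by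
    intro t ht x v
    rw [hf.duhamel t ht x v, hg.duhamel t ht x v, gain, gain]; ring
  have key : ∀ n : ℕ, ∀ t ∈ Icc 0 t₀, ∀ x v,
      |f t x v - g t x v| ≤ A₁ * ((A * t) ^ n / n.factorial) * profile α a q γ x v := by
    intro n
    induction n with
    | zero =>
      intro t ht x v
      have hP := profile_pos (α := α) (a := a) (q := q) (γ := γ) x v
      have f1 := hAb₁ t₀ ht₀ f hfa t ht x v
      have f2 := hAb₁ t₀ ht₀ g hga t ht x v
      have f3 := hfa.gain_nonneg hK ht x v
      have f4 := hga.gain_nonneg hK ht x v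
      have f5 : A₁ * t * profile α a q γ x v ≤ A₁ * profile α a q γ x v := by
        have := ht.2.trans ht₀
        gcongr
        exact mul_le_of_le_one_right hA₁.le this
      rw [hsub t ht x v, abs_le]
      simp only [pow_zero, Nat.factorial_zero, Nat.cast_one, div_one, mul_one]
      constructor <;> linarith
    | succ n ih =>
      intro t ht x v
      rw [hsub t ht x v]
      exact hAb t₀ ht₀ f g hfa hga A₁ hA₁.le n ih t ht x v
  have hlim : Filter.Tendsto (fun n : ℕ =>
      A₁ * ((A * t) ^ n / n.factorial) * profile α a q γ x v) Filter.atTop (nhds 0) := by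
    simpa using ((FloorSemiring.tendsto_pow_div_factorial_atTop (A * t)).const_mul A₁).mul_const
      (profile α a q γ x v)
  have h0 : |f t x v - g t x v| ≤ 0 :=
    ge_of_tendsto' hlim fun n => key n t ht x v
  have := abs_nonpos_iff.mp h0
  linarith

end

/-- Measurable densities squeezed between free transport and free transport plus `A t` times
the profile. -/
structure NearTransport {N : ℕ} (A α a q γ t₀ : ℝ) (f₀ : E N → E N → ℝ)
    (f : ℝ → E N → E N → ℝ) : Prop where
  measurable : Measurable fun p : ℝ × E N × E N => f p.1 p.2.1 p.2.2
  le : ∀ t ∈ Icc 0 t₀, ∀ x v, freeTransport f₀ t x v ≤ f t x v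
  ge : ∀ t ∈ Icc 0 t₀, ∀ x v,
    f t x v ≤ freeTransport f₀ t x v + A * t * profile α a q γ x v

/-- Picard iterates starting from free transport. -/
noncomputable def picardIter {N : ℕ} (f₀ : E N → E N → ℝ) (t₀ : ℝ) (n : ℕ) :
    ℝ → E N → E N → ℝ :=
  (picardStep f₀ t₀)^[n]
    (fun t x v => {s : ℝ | s ∈ Icc 0 t₀}.indicator (fun s => freeTransport f₀ s x v) t)

section
variable {N : ℕ} {α a q γ K t₀ : ℝ}

lemma measurable_freeTransport {f₀ : E N → E N → ℝ}
    (hf₀ : Measurable fun p : E N × E N => f₀ p.1 p.2) :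
    Measurable fun p : ℝ × E N × E N => freeTransport f₀ p.1 p.2.1 p.2.2 :=
  Measurable.mul (by fun_prop) (hf₀.comp (by fun_prop :
    Measurable fun p : ℝ × E N × E N => (p.2.1 - p.1 • p.2.2, p.2.2)))

lemma picardStep_of_mem {f₀ : E N → E N → ℝ} {f : ℝ → E N → E N → ℝ} {t : ℝ}
    (ht : t ∈ Icc 0 t₀) (x v : E N) :
    picardStep f₀ t₀ f t x v = freeTransport f₀ t x v + gain f t x v :=
  indicator_of_mem (s := {s : ℝ | s ∈ Icc 0 t₀}) ht _

/-- Perturbations of free transport by a small multiple of the profile are under control on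
`[0,t₁]`. -/
def TransportStable {N : ℕ} (A K α a q γ t₁ : ℝ) (f₀ : E N → E N → ℝ) : Prop :=
  ∀ t ∈ Icc 0 t₁, ∀ g : E N → E N → ℝ, (∀ x, Measurable (g x)) →
    (∀ x v, freeTransport f₀ t x v ≤ g x v) →
    (∀ x v, g x v ≤ freeTransport f₀ t x v + A * t * profile α a q γ x v) →
    ∀ x, (Integrable fun v => (1 + ‖v‖ ^ 2) * g x v) ∧ FieldBounds K α a q γ g x

lemma NearTransport.admissible {A : ℝ} {f₀ : E N → E N → ℝ} {f : ℝ → E N → E N → ℝ}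
    (hst : TransportStable A K α a q γ t₀ f₀) (hf₀ : ∀ x v, 0 ≤ f₀ x v)
    (hf : NearTransport A α a q γ t₀ f₀ f) : Admissible K α a q γ t₀ f where
  measurable := hf.measurable
  nonneg t ht x v := (mul_nonneg (Real.exp_pos _).le (hf₀ _ _)).trans (hf.le t ht x v)
  integrable_moments t ht x := (hst t ht (f t) (fun x => hf.measurable.comp
    (by fun_prop : Measurable fun v : E N => (t, x, v))) (hf.le t ht) (hf.ge t ht) x).1
  fields t ht x := (hst t ht (f t) (fun x => hf.measurable.comp
    (by fun_prop : Measurable fun v : E N => (t, x, v))) (hf.le t ht) (hf.ge t ht) x).2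

/-- Existence of a solution by Picard iteration. -/
theorem exists_solution (hN : 1 ≤ N) (hex : WeightExponents α a q γ) (hK : 1 ≤ K)
    {f₀ : E N → E N → ℝ} (hf₀m : Measurable fun p : E N × E N => f₀ p.1 p.2)
    (hf₀ : ∀ x v, 0 ≤ f₀ x v) :
    ∃ A : ℝ, 0 < A ∧ ∃ t₁ : ℝ, 0 < t₁ ∧ ∀ t₀ ≤ t₁, TransportStable A K α a q γ t₀ f₀ →
      ∃ f : ℝ → E N → E N → ℝ, IsSolution f₀ t₀ f ∧ NearTransport A α a q γ t₀ f₀ f := by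
  obtain ⟨A, hA, hAb⟩ := exists_gain_le N hex hK
  obtain ⟨A₂, hA₂, hAb₂⟩ := exists_gain_sub_le hN hex hK
  refine ⟨A, hA, min 1 (1 / (2 * A₂)), by positivity, ?_⟩
  intro t₀ ht₀ hst
  have ht₀1 : t₀ ≤ 1 := ht₀.trans (min_le_left _ _)
  have ht₀2 : A₂ * t₀ ≤ 1 / 2 := by
    have := ht₀.trans (min_le_right _ _)
    rw [le_div_iff₀ (by positivity)] at this
    linarith
  have hPp := fun x v : E N => profile_pos (α := α) (a := a) (q := q) (γ := γ) x v
  have hstep : ∀ f, NearTransport A α a q γ t₀ f₀ f →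
      NearTransport A α a q γ t₀ f₀ (picardStep f₀ t₀ f) := by
    intro f hf
    have hfa := hf.admissible hst hf₀
    refine ⟨measurable_picardStep hf₀m hf.measurable, fun t ht x v => ?_, fun t ht x v => ?_⟩
    · rw [picardStep_of_mem ht]
      linarith [hfa.gain_nonneg hK ht x v]
    · rw [picardStep_of_mem ht]
      linarith [hAb t₀ ht₀1 f hfa t ht x v]
  set F := picardIter f₀ t₀ with hF
  have hsucc : ∀ n, F (n + 1) = picardStep f₀ t₀ (F n) := fun n =>
    Function.iterate_succ_apply' _ _ _
  have hzero : ∀ t ∈ Icc 0 t₀, ∀ x v, F 0 t x v = freeTransport f₀ t x v := fun t ht x v =>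
    indicator_of_mem (s := {s : ℝ | s ∈ Icc 0 t₀}) ht (fun s => freeTransport f₀ s x v)
  have hnear : ∀ n, NearTransport A α a q γ t₀ f₀ (F n) := by
    intro n
    induction n with
    | zero =>
      refine ⟨?_, fun t ht x v => (hzero t ht x v).ge, fun t ht x v => ?_⟩
      · have := (measurable_freeTransport hf₀m).indicator
          (measurable_fst measurableSet_Icc :
            MeasurableSet {p : ℝ × E N × E N | p.1 ∈ Icc 0 t₀})
        exact this
      · rw [hzero t ht x v]
        have := mul_nonneg (mul_nonneg hA.le ht.1) (hPp x v).le
        linarith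
    | succ n ih => rw [hsucc]; exact hstep _ ih
  have hadm := fun n => (hnear n).admissible hst hf₀
  have hdiff : ∀ n, ∀ t ∈ Icc 0 t₀, ∀ x v, |F (n + 1) t x v - F n t x v| ≤
      A * ((A₂ * t) ^ n / n.factorial) * profile α a q γ x v := by
    intro n
    induction n with
    | zero =>
      intro t ht x v
      rw [hsucc, picardStep_of_mem ht, hzero t ht x v, add_sub_cancel_left,
        abs_of_nonneg ((hadm 0).gain_nonneg hK ht x v)]
      refine (hAb t₀ ht₀1 _ (hadm 0) t ht x v).trans ?_
      refine mul_le_mul_of_nonneg_right ?_ (hPp x v).le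
      simpa using mul_le_of_le_one_right hA.le (ht.2.trans ht₀1)
    | succ n ih =>
      intro t ht x v
      have e : F (n + 1 + 1) t x v - F (n + 1) t x v =
          gain (F (n + 1)) t x v - gain (F n) t x v := by
        conv_lhs => rw [hsucc (n + 1), picardStep_of_mem ht]
        conv_lhs => rw [hsucc n, picardStep_of_mem ht, add_sub_add_left_eq_sub, ← hsucc n]
      rw [e]
      exact hAb₂ t₀ ht₀1 _ _ (hadm (n + 1)) (hadm n) A hA.le n ih t ht x v
  have hgeo : ∀ n, ∀ t ∈ Icc 0 t₀, ∀ x v, dist (F n t x v) (F (n + 1) t x v) ≤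
      A * profile α a q γ x v * (1 / 2) ^ n := by
    intro n t ht x v
    rw [dist_comm, Real.dist_eq]
    refine (hdiff n t ht x v).trans ?_
    have h1 : (A₂ * t) ^ n / n.factorial ≤ (1 / 2) ^ n := by
      have h2 : A₂ * t ≤ 1 / 2 := le_trans (by gcongr; exact ht.2) ht₀2
      have h3 : 0 ≤ A₂ * t := mul_nonneg hA₂.le ht.1
      have h4 : (1:ℝ) ≤ n.factorial := by exact_mod_cast n.factorial_pos
      exact (div_le_self (by positivity) h4).trans (pow_le_pow_left₀ h3 h2 n)
    have := hPp x v
    calc _ ≤ A * (1 / 2) ^ n * profile α a q γ x v := by gcongr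
      _ = _ := by ring
  have hout : ∀ n, ∀ t ∉ Icc 0 t₀, ∀ x v, F n t x v = 0 := by
    intro n t ht x v
    cases n with
    | zero =>
      exact indicator_of_notMem (s := {s : ℝ | s ∈ Icc 0 t₀}) ht
        (fun s => freeTransport f₀ s x v)
    | succ n =>
      rw [hsucc]
      exact indicator_of_notMem (s := {s : ℝ | s ∈ Icc 0 t₀}) ht
        (fun s => freeTransport f₀ s x v + gain (F n) s x v)
  have hex_lim : ∀ t x v, ∃ l, Filter.Tendsto (fun n => F n t x v) Filter.atTop (nhds l) := by
    intro t x v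
    by_cases ht : t ∈ Icc 0 t₀
    · exact cauchySeq_tendsto_of_complete
        (cauchySeq_of_le_geometric (1 / 2) _ (by norm_num) fun n => hgeo n t ht x v)
    · exact ⟨0, by simp only [hout _ t ht x v]; exact tendsto_const_nhds⟩
  choose f hf using hex_lim
  have hfm : Measurable fun p : ℝ × E N × E N => f p.1 p.2.1 p.2.2 :=
    measurable_of_tendsto_metrizable (fun n => (hnear n).measurable)
      (tendsto_pi_nhds.mpr fun p => hf p.1 p.2.1 p.2.2)
  have hfnear : NearTransport A α a q γ t₀ f₀ f :=
    ⟨hfm, fun t ht x v => ge_of_tendsto' (hf t x v) fun n => (hnear n).le t ht x v,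
      fun t ht x v => le_of_tendsto' (hf t x v) fun n => (hnear n).ge t ht x v⟩
  have hfa := hfnear.admissible hst hf₀
  refine ⟨f, ?_, hfnear⟩
  have hlimdist : ∀ n, ∀ t ∈ Icc 0 t₀, ∀ x v, |f t x v - F n t x v| ≤
      (A * 2 * (1 / 2) ^ n) * ((A₂ * t) ^ 0 / (Nat.factorial 0)) * profile α a q γ x v := by
    intro n t ht x v
    have := dist_le_of_le_geometric_of_tendsto (1 / 2) _ (by norm_num)
      (fun n => hgeo n t ht x v) (hf t x v) n
    rw [dist_comm, Real.dist_eq] at this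
    refine this.trans (le_of_eq ?_)
    simp; ring
  have hduh : ∀ t ∈ Icc 0 t₀, ∀ x v, f t x v = freeTransport f₀ t x v + gain f t x v := by
    intro t ht x v
    have hg : Filter.Tendsto (fun n => gain (F n) t x v) Filter.atTop (nhds (gain f t x v)) := by
      rw [tendsto_iff_dist_tendsto_zero]
      refine squeeze_zero (fun _ => dist_nonneg) (fun n => ?_)
        (?_ : Filter.Tendsto (fun n : ℕ => (A * 2 * (1 / 2) ^ n) *
          ((A₂ * t) ^ (0 + 1) / (Nat.factorial (0 + 1))) * profile α a q γ x v) _ _)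
      · rw [dist_comm, Real.dist_eq]
        exact hAb₂ t₀ ht₀1 f (F n) hfa (hadm n) (A * 2 * (1 / 2) ^ n) (by positivity) 0
          (hlimdist n) t ht x v
      · have := (((tendsto_pow_atTop_nhds_zero_of_lt_one (r := (1 / 2 : ℝ)) (by norm_num)
          (by norm_num)).const_mul (A * 2)).mul_const
          ((A₂ * t) ^ (0 + 1) / (Nat.factorial (0 + 1)))).mul_const (profile α a q γ x v)
        simpa using this
    have h1 := (Filter.tendsto_add_atTop_iff_nat 1).mpr (hf t x v)
    have h2 : Filter.Tendsto (fun n => F (n + 1) t x v) Filter.atTop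
        (nhds (freeTransport f₀ t x v + gain f t x v)) := by
      have := hg.const_add (freeTransport f₀ t x v)
      refine this.congr fun n => ?_
      rw [hsucc, picardStep_of_mem ht]
    exact tendsto_nhds_unique h1 h2
  exact ⟨hfm, hfa.nonneg, hfa.integrable_moments,
    fun t ht x v => hfa.intervalIntegrable_gain hex hK ht₀1 ht x v, hduh⟩

end

/-- Radial velocity dependence of the initial datum. -/
noncomputable def radialDatum (α β δ r : ℝ) : ℝ := (1 + r ^ 2) ^ (-δ) * Real.exp (-α * r ^ β)

/-- Mass of the radial datum in the velocity shell `r₁ ≤ |v| ≤ r₂`. -/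
noncomputable def shellMass (N : ℕ) (α β δ r₁ r₂ : ℝ) : ℝ :=
  ∫ v : E N, (Icc r₁ r₂).indicator (radialDatum α β δ) ‖v‖

/-- Size of the total mass of the radial datum outside the ball of radius `R`. -/
noncomputable def shellWeight (N : ℕ) (α β δ R : ℝ) : ℝ :=
  (1 + R) ^ ((N : ℝ) - 2 * δ - β) * Real.exp (-α * R ^ β)

section
variable {N : ℕ} {α β δ : ℝ}

lemma radialDatum_pos (r : ℝ) : 0 < radialDatum α β δ r := by unfold radialDatum; positivity

lemma radialDatum_le_one (hα : 0 ≤ α) (hδ : 0 ≤ δ) {r : ℝ} (hr : 0 ≤ r) :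
    radialDatum α β δ r ≤ 1 := by
  unfold radialDatum
  have h1 : (1 + r ^ 2) ^ (-δ) ≤ 1 :=
    Real.rpow_le_one_of_one_le_of_nonpos (by nlinarith [sq_nonneg r]) (by linarith)
  have h2 : Real.exp (-α * r ^ β) ≤ 1 := by
    rw [Real.exp_le_one_iff]
    have : 0 ≤ r ^ β := Real.rpow_nonneg hr β
    nlinarith
  exact mul_le_one₀ h1 (Real.exp_pos _).le h2

lemma continuous_radialDatum (hβ : 0 ≤ β) : Continuous (radialDatum α β δ) := by
  unfold radialDatum
  refine Continuous.mul ?_ (Real.continuous_exp.comp (continuous_const.mul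
    (Real.continuous_rpow_const hβ)))
  exact (by fun_prop : Continuous fun r : ℝ => 1 + r ^ 2).rpow_const
    fun r => Or.inl (by positivity)

lemma shellWeight_pos {R : ℝ} (hR : 0 ≤ R) : 0 < shellWeight N α β δ R := by
  unfold shellWeight; positivity

/-- Polar coordinates for radial shell integrals. -/
lemma exists_shellMass_eq (hN : 1 ≤ N) : ∃ c : ℝ, 0 < c ∧ ∀ α β δ r₁ r₂ : ℝ, 0 ≤ r₁ → r₁ ≤ r₂ →
    shellMass N α β δ r₁ r₂ = c * ∫ y in r₁..r₂, y ^ (N - 1) * radialDatum α β δ y := by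
  have : Nonempty (Fin N) := ⟨⟨0, hN⟩⟩
  have hb : 0 < (volume : Measure (E N)).real (Metric.ball 0 1) := by
    rw [Measure.real, ENNReal.toReal_pos_iff]
    exact ⟨Metric.measure_ball_pos _ _ one_pos, measure_ball_lt_top⟩
  have hN' : (0:ℝ) < N := by exact_mod_cast hN
  refine ⟨N * (volume : Measure (E N)).real (Metric.ball 0 1), by positivity, ?_⟩
  intro α β δ r₁ r₂ h0 h12
  have h := integral_fun_norm_addHaar (volume : Measure (E N))
    ((Icc r₁ r₂).indicator (radialDatum α β δ))
  rw [shellMass, h, finrank_euclideanSpace_fin, nsmul_eq_mul, smul_eq_mul, mul_assoc]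
  congr 2
  rw [intervalIntegral.integral_of_le h12, ← integral_indicator measurableSet_Ioi,
    ← integral_Icc_eq_integral_Ioc, ← integral_indicator measurableSet_Icc]
  refine integral_congr_ae ?_
  have : ∀ᵐ y : ℝ, y ≠ 0 := by simp [ae_iff, measure_singleton]
  filter_upwards [this] with y hy
  by_cases hm : y ∈ Icc r₁ r₂
  · have : y ∈ Ioi (0:ℝ) := lt_of_le_of_ne (h0.trans hm.1) hy.symm
    rw [indicator_of_mem this, indicator_of_mem hm, indicator_of_mem hm, smul_eq_mul]
  · rw [indicator_of_notMem hm, indicator_apply_eq_zero]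
    intro _
    rw [indicator_of_notMem hm, smul_zero]

lemma integrable_shell (hβ : 0 ≤ β) (r₁ r₂ : ℝ) :
    Integrable fun v : E N => (Icc r₁ r₂).indicator (radialDatum α β δ) ‖v‖ := by
  have h1 : (fun v : E N => (Icc r₁ r₂).indicator (radialDatum α β δ) ‖v‖) =
      (norm ⁻¹' Icc r₁ r₂).indicator fun v : E N => radialDatum α β δ ‖v‖ := by
    funext v; rfl
  rw [h1, integrable_indicator_iff (measurable_norm measurableSet_Icc)]
  have hsub : (norm ⁻¹' Icc r₁ r₂ : Set (E N)) ⊆ Metric.closedBall 0 r₂ := by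
    intro v hv
    simpa using hv.2
  refine IntegrableOn.mono_set ?_ hsub
  exact (((continuous_radialDatum hβ).comp continuous_norm).continuousOn).integrableOn_compact
    (isCompact_closedBall _ _)

lemma shellMass_nonneg (r₁ r₂ : ℝ) : 0 ≤ shellMass N α β δ r₁ r₂ :=
  integral_nonneg fun _ => indicator_nonneg (fun _ _ => (radialDatum_pos _).le) _

lemma rpow_comparable {κ L y : ℝ} (hκ : 0 < κ) (hL : 0 < L) (h1 : κ * L ≤ y) (h2 : y ≤ L / κ)
    (p : ℝ) : κ ^ |p| * L ^ p ≤ y ^ p ∧ y ^ p ≤ (κ ^ |p|)⁻¹ * L ^ p := by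
  have hy : 0 < y := lt_of_lt_of_le (by positivity) h1
  rcases le_or_gt 0 p with hp | hp
  · rw [abs_of_nonneg hp]
    constructor
    · rw [← Real.mul_rpow hκ.le hL.le]
      exact Real.rpow_le_rpow (by positivity) h1 hp
    · refine (Real.rpow_le_rpow hy.le h2 hp).trans (le_of_eq ?_)
      rw [Real.div_rpow hL.le hκ.le]; ring
  · rw [abs_of_neg hp]
    constructor
    · refine le_trans (le_of_eq ?_) (Real.rpow_le_rpow_of_nonpos hy h2 hp.le)
      rw [Real.div_rpow hL.le hκ.le, Real.rpow_neg hκ.le]; ring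
    · refine (Real.rpow_le_rpow_of_nonpos (by positivity) h1 hp.le).trans (le_of_eq ?_)
      rw [Real.mul_rpow hκ.le hL.le, Real.rpow_neg hκ.le, inv_inv]

/-- On `y ~ L` the volume-weighted algebraic part is comparable to a multiple of `y^(β-1)`. -/
lemma exists_algebraic_comparable (hN : 1 ≤ N) (β δ : ℝ) {κ : ℝ} (hκ : 0 < κ) (hκ1 : κ ≤ 1) :
    ∃ C : ℝ, 0 < C ∧ ∀ L y : ℝ, 1 ≤ L → κ * L ≤ y → y ≤ L / κ →
      C⁻¹ * L ^ ((N : ℝ) - 2 * δ - β) * y ^ (β - 1) ≤ y ^ (N - 1) * (1 + y ^ 2) ^ (-δ) ∧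
      y ^ (N - 1) * (1 + y ^ 2) ^ (-δ) ≤ C * L ^ ((N : ℝ) - 2 * δ - β) * y ^ (β - 1) := by
  set κ' := κ ^ 2 / 2 with hκ'
  have hκ'0 : 0 < κ' := by positivity
  refine ⟨(κ ^ |(N : ℝ) - β| * κ' ^ |-δ|)⁻¹, by positivity, ?_⟩
  intro L y hL h1 h2
  have hL0 : 0 < L := by linarith
  have hy : 0 < y := lt_of_lt_of_le (by positivity) h1
  obtain ⟨a1, a2⟩ := rpow_comparable hκ hL0 h1 h2 ((N : ℝ) - β)
  have b1 : κ' * L ^ 2 ≤ 1 + y ^ 2 := by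
    have : (κ * L) ^ 2 ≤ y ^ 2 := pow_le_pow_left₀ (by positivity) h1 2
    rw [hκ']
    nlinarith [sq_nonneg (κ * L)]
  have b2 : 1 + y ^ 2 ≤ L ^ 2 / κ' := by
    have : y ^ 2 ≤ (L / κ) ^ 2 := pow_le_pow_left₀ hy.le h2 2
    have h3 : 1 ≤ (L / κ) ^ 2 := by
      refine one_le_pow₀ ?_
      rw [le_div_iff₀ hκ]; linarith
    have h4 : L ^ 2 / κ' = 2 * (L / κ) ^ 2 := by rw [hκ']; field_simp
    linarith
  obtain ⟨c1, c2⟩ := rpow_comparable hκ'0 (by positivity : 0 < L ^ 2) b1 b2 (-δ)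
  have e1 : y ^ (N - 1) = y ^ ((N : ℝ) - β) * y ^ (β - 1) := by
    rw [← Real.rpow_add hy, ← Real.rpow_natCast]
    congr 1
    rw [Nat.cast_sub hN]; push_cast; ring
  have e2 : L ^ ((N : ℝ) - 2 * δ - β) = L ^ ((N : ℝ) - β) * (L ^ 2) ^ (-δ) := by
    rw [← Real.rpow_natCast L 2, ← Real.rpow_mul hL0.le, ← Real.rpow_add hL0]
    congr 1; push_cast; ring
  rw [e1, e2, inv_inv]
  constructor
  · calc _ = (κ ^ |(N : ℝ) - β| * L ^ ((N : ℝ) - β)) * y ^ (β - 1) *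
          (κ' ^ |-δ| * (L ^ 2) ^ (-δ)) := by ring
      _ ≤ _ := by gcongr
  · calc _ ≤ ((κ ^ |(N : ℝ) - β|)⁻¹ * L ^ ((N : ℝ) - β)) * y ^ (β - 1) *
          ((κ' ^ |-δ|)⁻¹ * (L ^ 2) ^ (-δ)) := by gcongr
      _ = _ := by rw [mul_inv]; ring

lemma integral_rpow_mul_exp (hα : 0 < α) (hβ : 0 < β) {r₁ r₂ : ℝ} (h1 : 0 < r₁) (h12 : r₁ ≤ r₂) :
    IntervalIntegrable (fun y => y ^ (β - 1) * Real.exp (-α * y ^ β)) volume r₁ r₂ ∧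
    ∫ y in r₁..r₂, y ^ (β - 1) * Real.exp (-α * y ^ β) =
      (Real.exp (-α * r₁ ^ β) - Real.exp (-α * r₂ ^ β)) / (α * β) := by
  have hpos : ∀ y ∈ uIcc r₁ r₂, 0 < y := by
    intro y hy
    rw [uIcc_of_le h12] at hy
    exact h1.trans_le hy.1
  have hc : ContinuousOn (fun y => y ^ (β - 1) * Real.exp (-α * y ^ β)) (uIcc r₁ r₂) := by
    refine ContinuousOn.mul (fun y hy => ?_) (Continuous.continuousOn ?_)
    · exact (Real.continuousAt_rpow_const y _ (Or.inl (hpos y hy).ne')).continuousWithinAt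
    · exact Real.continuous_exp.comp (continuous_const.mul (Real.continuous_rpow_const hβ.le))
  refine ⟨hc.intervalIntegrable, ?_⟩
  have hd : ∀ y ∈ uIcc r₁ r₂, HasDerivAt (fun y => -(Real.exp (-α * y ^ β)) / (α * β))
      (y ^ (β - 1) * Real.exp (-α * y ^ β)) y := by
    intro y hy
    have h := ((((Real.hasDerivAt_rpow_const (p := β) (Or.inl (hpos y hy).ne')).const_mul
      (-α)).exp).neg).div_const (α * β)
    refine h.congr_deriv ?_
    field_simp
  rw [intervalIntegral.integral_eq_sub_of_hasDerivAt hd hc.intervalIntegrable]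
  ring

lemma continuous_shell_integrand (hβ : 0 ≤ β) :
    Continuous fun y => y ^ (N - 1) * radialDatum α β δ y :=
  (continuous_pow _).mul (continuous_radialDatum hβ)

/-- Two-sided shell estimates at radii comparable to `1 + R`. -/
lemma exists_shellMass_comparable (hN : 1 ≤ N) (hα : 0 < α) (hβ : 0 < β) (δ : ℝ) {κ : ℝ}
    (hκ : 0 < κ) (hκ1 : κ ≤ 1) :
    ∃ C : ℝ, 0 < C ∧ ∀ R r₁ r₂ : ℝ, 0 ≤ R → r₁ ≤ r₂ → κ * (1 + R) ≤ r₁ → r₂ ≤ (1 + R) / κ →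
      C⁻¹ * ((1 + R) ^ ((N : ℝ) - 2 * δ - β) *
        (Real.exp (-α * r₁ ^ β) - Real.exp (-α * r₂ ^ β))) ≤ shellMass N α β δ r₁ r₂ ∧
      shellMass N α β δ r₁ r₂ ≤ C * ((1 + R) ^ ((N : ℝ) - 2 * δ - β) *
        (Real.exp (-α * r₁ ^ β) - Real.exp (-α * r₂ ^ β))) := by
  obtain ⟨c, hc, hceq⟩ := exists_shellMass_eq hN
  obtain ⟨C, hC, hCb⟩ := exists_algebraic_comparable hN β δ hκ hκ1
  refine ⟨max (C * c / (α * β)) ((c * C⁻¹ / (α * β))⁻¹), by positivity, ?_⟩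
  intro R r₁ r₂ hR h12 h1 h2
  have hr1 : 0 < r₁ := lt_of_lt_of_le (by positivity) h1
  obtain ⟨hi, he⟩ := integral_rpow_mul_exp hα hβ hr1 h12
  have hci : IntervalIntegrable (fun y => y ^ (N - 1) * radialDatum α β δ y) volume r₁ r₂ :=
    (continuous_shell_integrand hβ.le).intervalIntegrable _ _
  set L := (1 + R) ^ ((N : ℝ) - 2 * δ - β) with hL
  have hL0 : 0 < L := by positivity
  have hD : 0 ≤ Real.exp (-α * r₁ ^ β) - Real.exp (-α * r₂ ^ β) := by
    rw [sub_nonneg]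
    apply Real.exp_le_exp.mpr
    have := Real.rpow_le_rpow hr1.le h12 hβ.le
    nlinarith
  set D := Real.exp (-α * r₁ ^ β) - Real.exp (-α * r₂ ^ β) with hDdef
  rw [hceq α β δ r₁ r₂ hr1.le h12]
  have low : C⁻¹ * L * (D / (α * β)) ≤ ∫ y in r₁..r₂, y ^ (N - 1) * radialDatum α β δ y := by
    rw [← he, ← intervalIntegral.integral_const_mul]
    refine intervalIntegral.integral_mono_on h12 (hi.const_mul _) hci fun y hy => ?_
    have := (hCb (1 + R) y (by linarith) (h1.trans hy.1) (hy.2.trans h2)).1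
    unfold radialDatum
    rw [← mul_assoc, ← mul_assoc]
    gcongr
  have up : ∫ y in r₁..r₂, y ^ (N - 1) * radialDatum α β δ y ≤ C * L * (D / (α * β)) := by
    rw [← he, ← intervalIntegral.integral_const_mul]
    refine intervalIntegral.integral_mono_on h12 hci (hi.const_mul _) fun y hy => ?_
    have := (hCb (1 + R) y (by linarith) (h1.trans hy.1) (hy.2.trans h2)).2
    unfold radialDatum
    rw [← mul_assoc, ← mul_assoc]
    gcongr
  constructor
  · calc _ ≤ ((c * C⁻¹ / (α * β))⁻¹)⁻¹ * (L * D) := by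
          gcongr
          exact le_max_right _ _
      _ = c * (C⁻¹ * L * (D / (α * β))) := by rw [inv_inv]; ring
      _ ≤ _ := by gcongr
  · calc _ ≤ c * (C * L * (D / (α * β))) := by gcongr
      _ = C * c / (α * β) * (L * D) := by ring
      _ ≤ _ := by
          gcongr
          exact le_max_left _ _

/-- Shell estimate by length times supremum. -/
lemma exists_shellMass_le_length (hN : 1 ≤ N) : ∃ c : ℝ, 0 < c ∧ ∀ α β δ r₁ r₂ M : ℝ, 0 ≤ β →
    0 ≤ r₁ → r₁ ≤ r₂ → (∀ y ∈ Icc r₁ r₂, y ^ (N - 1) * radialDatum α β δ y ≤ M) →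
    shellMass N α β δ r₁ r₂ ≤ c * (M * (r₂ - r₁)) := by
  obtain ⟨c, hc, hceq⟩ := exists_shellMass_eq hN
  refine ⟨c, hc, fun α β δ r₁ r₂ M hβ h1 h12 hM => ?_⟩
  rw [hceq α β δ r₁ r₂ h1 h12]
  have : ∫ y in r₁..r₂, y ^ (N - 1) * radialDatum α β δ y ≤ ∫ y in r₁..r₂, M :=
    intervalIntegral.integral_mono_on h12
      ((continuous_shell_integrand hβ).intervalIntegrable _ _) intervalIntegrable_const hM
  rw [intervalIntegral.integral_const, smul_eq_mul] at this
  gcongr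
  linarith

end

section
variable {N : ℕ} {α β δ : ℝ}

lemma abs_rpow_sub_rpow_le_rpow {a p r : ℝ} (ha : 0 ≤ a) (ha1 : a ≤ 1) (hp : 0 ≤ p)
    (hr : 0 ≤ r) : |p ^ a - r ^ a| ≤ |p - r| ^ a := by
  have key : ∀ p r : ℝ, 0 ≤ r → r ≤ p → |p ^ a - r ^ a| ≤ |p - r| ^ a := by
    intro p r hr h
    rw [abs_of_nonneg (sub_nonneg.mpr h),
      abs_of_nonneg (sub_nonneg.mpr (Real.rpow_le_rpow hr h ha))]
    have := Real.rpow_add_le_add_rpow hr (sub_nonneg.mpr h) ha ha1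
    rw [add_sub_cancel] at this
    linarith
  rcases le_total r p with h | h
  · exact key p r hr h
  · rw [abs_sub_comm, abs_sub_comm p]; exact key r p hp h

/-- Powers of the position are stable under transport with admissible velocities. -/
lemma abs_rpow_sub_rpow_le_of_shift {a γ t p r : ℝ} (ha : 0 < a) (hγ : 0 ≤ γ) (hsum : a + γ ≤ 1)
    (hp : 0 ≤ p) (hr : 0 ≤ r) (ht : 0 ≤ t) (ht1 : t ≤ 1) (h : |p - r| ≤ t * (2 * p ^ γ + 10)) :
    |p ^ a - r ^ a| ≤ 12 * t ^ a ∧ (1 ≤ p → |p ^ a - r ^ a| ≤ 12 * t) := by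
  have ha1 : a ≤ 1 := by linarith
  have big : 1 ≤ p → |p ^ a - r ^ a| ≤ 12 * t := by
    intro hp1
    have hp0 : 0 < p := by linarith
    have h1 : 1 ≤ p ^ γ := Real.one_le_rpow hp1 hγ
    have h2 : |p - r| ≤ 12 * t * p ^ γ := by nlinarith
    have h3 : p ^ (a - 1) * |p - r| ≤ 12 * t := by
      calc p ^ (a - 1) * |p - r| ≤ p ^ (a - 1) * (12 * t * p ^ γ) := by gcongr
        _ = 12 * t * (p ^ (a - 1) * p ^ γ) := by ring
        _ = 12 * t * p ^ (a - 1 + γ) := by rw [Real.rpow_add hp0]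
        _ ≤ 12 * t * 1 := by
          gcongr
          exact Real.rpow_le_one_of_one_le_of_nonpos hp1 (by linarith)
        _ = 12 * t := by ring
    rcases le_total r p with hrp | hrp
    · rw [abs_of_nonneg (sub_nonneg.mpr (Real.rpow_le_rpow hr hrp ha.le))]
      refine (rpow_sub_rpow_le ha1 hr hrp hp0).trans ?_
      rwa [abs_of_nonneg (sub_nonneg.mpr hrp)] at h3
    · rw [abs_sub_comm, abs_of_nonneg (sub_nonneg.mpr (Real.rpow_le_rpow hp hrp ha.le))]
      refine (rpow_sub_rpow_le ha1 hp hrp (hp0.trans_le hrp)).trans ?_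
      rw [abs_sub_comm, abs_of_nonneg (sub_nonneg.mpr hrp)] at h3
      refine le_trans ?_ h3
      exact mul_le_mul_of_nonneg_right
        (Real.rpow_le_rpow_of_nonpos hp0 hrp (by linarith)) (sub_nonneg.mpr hrp)
  refine ⟨?_, big⟩
  rcases le_or_gt 1 p with hp1 | hp1
  · refine (big hp1).trans ?_
    have := Real.rpow_le_rpow_of_exponent_ge' ht ht1 ha.le ha1
    rw [Real.rpow_one] at this
    linarith
  · have h1 : p ^ γ ≤ 1 := Real.rpow_le_one hp hp1.le hγ
    have h2 : |p - r| ≤ 12 * t := by nlinarith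
    calc |p ^ a - r ^ a| ≤ |p - r| ^ a := abs_rpow_sub_rpow_le_rpow ha.le ha1 hp hr
      _ ≤ (12 * t) ^ a := Real.rpow_le_rpow (abs_nonneg _) h2 ha.le
      _ = 12 ^ a * t ^ a := Real.mul_rpow (by norm_num) ht
      _ ≤ 12 * t ^ a := by
        have : (12:ℝ) ^ a ≤ 12 := by
          simpa using Real.rpow_le_rpow_of_exponent_le (show (1:ℝ) ≤ 12 by norm_num) ha1
        gcongr

lemma exists_le_shellWeight (N : ℕ) (hα : 0 < α) (hβ : 0 < β) (δ : ℝ) :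
    ∃ w : ℝ, 0 < w ∧ ∀ R : ℝ, 0 ≤ R → R ≤ 2 → w ≤ shellWeight N α β δ R := by
  refine ⟨(1 / 3) ^ |(N : ℝ) - 2 * δ - β| * Real.exp (-α * 2 ^ β), by positivity, ?_⟩
  intro R h0 h2
  have h := (rpow_comparable (κ := 1 / 3) (L := 1) (y := 1 + R) (by norm_num) (by norm_num)
    (by linarith) (by linarith) ((N : ℝ) - 2 * δ - β)).1
  rw [Real.one_rpow, mul_one] at h
  have h3 := Real.rpow_le_rpow h0 h2 hβ.le
  have h4 : Real.exp (-α * 2 ^ β) ≤ Real.exp (-α * R ^ β) := Real.exp_le_exp.mpr (by nlinarith)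
  unfold shellWeight
  gcongr

lemma shell_integrand_le (hα : 0 ≤ α) (hδ : 0 ≤ δ) {y : ℝ} (h0 : 0 ≤ y) (h1 : y ≤ 16) :
    y ^ (N - 1) * radialDatum α β δ y ≤ 16 ^ (N - 1) := by
  have h2 := radialDatum_le_one (β := β) hα hδ h0
  have h3 := (radialDatum_pos (α := α) (β := β) (δ := δ) y).le
  calc y ^ (N - 1) * radialDatum α β δ y ≤ 16 ^ (N - 1) * 1 := by gcongr
    _ = _ := mul_one _

lemma le_rpow_inv_of_half {β R h : ℝ} (hβ : 0 < β) (hR : 2 ≤ R) (hh : h ≤ 1 / 2) :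
    2⁻¹ ^ β⁻¹ / 2 * (1 + R) ≤ (R ^ β - h) ^ β⁻¹ := by
  have hR0 : 0 ≤ R := by linarith
  have h1 : 1 ≤ R ^ β := Real.one_le_rpow (by linarith) hβ.le
  calc (2⁻¹ : ℝ) ^ β⁻¹ / 2 * (1 + R) = (2⁻¹ : ℝ) ^ β⁻¹ * ((1 + R) / 2) := by ring
    _ ≤ (2⁻¹ : ℝ) ^ β⁻¹ * R := by gcongr; linarith
    _ = (2⁻¹ : ℝ) ^ β⁻¹ * (R ^ β) ^ β⁻¹ := by rw [Real.rpow_rpow_inv hR0 hβ.ne']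
    _ = (2⁻¹ * R ^ β) ^ β⁻¹ := (Real.mul_rpow (by norm_num) (by positivity)).symm
    _ ≤ _ := Real.rpow_le_rpow (by positivity) (by linarith) (by positivity)

/-- Upper bound for the total mass. -/
lemma exists_shellMass_le (hN : 1 ≤ N) (hα : 0 < α) (hβ : 0 < β) (hδ : 0 ≤ δ) :
    ∃ C : ℝ, 0 < C ∧ ∀ R : ℝ, 0 ≤ R → ∃ r₁ : ℝ,
      shellMass N α β δ r₁ (2 * R + 12) ≤ C * shellWeight N α β δ R ∧
      ∀ r : ℝ, 0 ≤ r → R ^ β - 1 / 2 ≤ r ^ β → r₁ ≤ r := by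
  obtain ⟨c, hc, hcb⟩ := exists_shellMass_le_length hN
  obtain ⟨w, hw, hwb⟩ := exists_le_shellWeight N hα hβ δ
  set κ : ℝ := min (2⁻¹ ^ β⁻¹ / 2) (1 / 12) with hκdef
  have hκ : 0 < κ := by positivity
  have hκ12 : κ ≤ 1 / 12 := min_le_right _ _
  obtain ⟨C, hC, hCb⟩ := exists_shellMass_comparable hN hα hβ δ hκ (by linarith)
  refine ⟨max (c * (16 ^ (N - 1) * 16) / w) (C * Real.exp (α / 2)), by positivity, ?_⟩
  intro R hR
  have hsw := shellWeight_pos (N := N) (α := α) (β := β) (δ := δ) hR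
  rcases le_or_gt R 2 with h2 | h2
  · refine ⟨0, ?_, fun r hr _ => hr⟩
    have h := hcb α β δ 0 (2 * R + 12) (16 ^ (N - 1)) hβ.le le_rfl (by linarith) fun y hy =>
      shell_integrand_le hα.le hδ hy.1 (by linarith [hy.2])
    calc _ ≤ c * (16 ^ (N - 1) * (2 * R + 12 - 0)) := h
      _ ≤ c * (16 ^ (N - 1) * 16) := by gcongr; linarith
      _ = c * (16 ^ (N - 1) * 16) / w * w := by field_simp
      _ ≤ _ := by
        gcongr
        · exact le_max_left _ _
        · exact hwb R hR h2
  · have h1 : 1 ≤ R ^ β := Real.one_le_rpow (by linarith) hβ.le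
    have hX : 0 ≤ R ^ β - 1 / 2 := by linarith
    refine ⟨(R ^ β - 1 / 2) ^ β⁻¹, ?_, fun r hr h =>
      (Real.rpow_inv_le_iff_of_pos hX hr hβ).mpr h⟩
    have e := Real.rpow_inv_rpow hX hβ.ne'
    have a1 : κ * (1 + R) ≤ (R ^ β - 1 / 2) ^ β⁻¹ := by
      refine le_trans ?_ (le_rpow_inv_of_half hβ h2.le le_rfl)
      gcongr
      exact min_le_left _ _
    have a2 : 2 * R + 12 ≤ (1 + R) / κ := by
      rw [le_div_iff₀ hκ]; nlinarith
    have a3 : (R ^ β - 1 / 2) ^ β⁻¹ ≤ 2 * R + 12 := by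
      rw [Real.rpow_inv_le_iff_of_pos hX (by linarith) hβ]
      have := Real.rpow_le_rpow hR (by linarith : R ≤ 2 * R + 12) hβ.le
      linarith
    have h := (hCb R _ _ hR a3 a1 a2).2
    rw [e] at h
    refine h.trans ?_
    have h5 : Real.exp (-α * (R ^ β - 1 / 2)) - Real.exp (-α * (2 * R + 12) ^ β) ≤
        Real.exp (α / 2) * Real.exp (-α * R ^ β) := by
      rw [← Real.exp_add]
      have : -α * (R ^ β - 1 / 2) = α / 2 + -α * R ^ β := by ring
      rw [this]
      linarith [Real.exp_pos (-α * (2 * R + 12) ^ β)]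
    calc _ ≤ C * ((1 + R) ^ ((N : ℝ) - 2 * δ - β) *
          (Real.exp (α / 2) * Real.exp (-α * R ^ β))) := by gcongr
      _ = (C * Real.exp (α / 2)) * shellWeight N α β δ R := by unfold shellWeight; ring
      _ ≤ _ := by
        gcongr
        exact le_max_right _ _

/-- Mass of the layer near the inner boundary of the support. -/
lemma exists_innerLayer_le (hN : 1 ≤ N) (hα : 0 < α) (hβ : 0 < β) (hδ : 0 ≤ δ) :
    ∃ C : ℝ, 0 < C ∧ ∀ R t τ : ℝ, 0 ≤ R → 0 ≤ t → t ≤ τ → τ ≤ 1 / 24 → ∃ r₁ r₂ : ℝ,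
      shellMass N α β δ r₁ r₂ ≤ C * τ * shellWeight N α β δ R ∧
      ∀ r : ℝ, 0 ≤ r → |r - R| ≤ 12 * τ → (2 ≤ R → |r ^ β - R ^ β| ≤ 12 * t) →
        r ∈ Icc r₁ r₂ := by
  obtain ⟨c, hc, hcb⟩ := exists_shellMass_le_length hN
  obtain ⟨w, hw, hwb⟩ := exists_le_shellWeight N hα hβ δ
  set κ : ℝ := 2⁻¹ ^ β⁻¹ / 2 with hκdef
  have hκ : 0 < κ := by positivity
  have hκ1 : κ ≤ 1 := by
    have : (2⁻¹ : ℝ) ^ β⁻¹ ≤ 1 := Real.rpow_le_one (by norm_num) (by norm_num) (by positivity)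
    linarith
  obtain ⟨C, hC, hCb⟩ := exists_shellMass_comparable hN hα hβ δ hκ hκ1
  refine ⟨max (c * (16 ^ (N - 1) * 24) / w) (C * (24 * α * (2 * Real.exp α))), by positivity, ?_⟩
  intro R t τ hR ht htτ hτ
  have hτ0 : 0 ≤ τ := ht.trans htτ
  have hsw := shellWeight_pos (N := N) (α := α) (β := β) (δ := δ) hR
  rcases lt_or_ge R 2 with h2 | h2
  · refine ⟨max (R - 12 * τ) 0, R + 12 * τ, ?_, fun r hr h _ => ?_⟩
    · have h := hcb α β δ (max (R - 12 * τ) 0) (R + 12 * τ) (16 ^ (N - 1)) hβ.le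
        (le_max_right _ _) (max_le (by linarith) (by linarith)) fun y hy =>
        shell_integrand_le hα.le hδ ((le_max_right _ _).trans hy.1) (by linarith [hy.2])
      calc _ ≤ c * (16 ^ (N - 1) * (R + 12 * τ - max (R - 12 * τ) 0)) := h
        _ ≤ c * (16 ^ (N - 1) * (24 * τ)) := by
          gcongr
          linarith [le_max_left (R - 12 * τ) 0]
        _ = c * (16 ^ (N - 1) * 24) / w * τ * w := by field_simp
        _ ≤ _ := by
          gcongr
          · exact le_max_left _ _
          · exact hwb R hR h2.le
    · rw [abs_le] at h
      exact ⟨max_le (by linarith) hr, by linarith⟩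
  · have h1 : 1 ≤ R ^ β := Real.one_le_rpow (by linarith) hβ.le
    have hX : 0 ≤ R ^ β - 12 * t := by linarith
    have hY : 0 ≤ R ^ β + 12 * t := by linarith
    refine ⟨(R ^ β - 12 * t) ^ β⁻¹, (R ^ β + 12 * t) ^ β⁻¹, ?_, fun r hr _ h => ?_⟩
    · have a1 : κ * (1 + R) ≤ (R ^ β - 12 * t) ^ β⁻¹ :=
        le_rpow_inv_of_half hβ h2 (by linarith)
      have a2 : (R ^ β + 12 * t) ^ β⁻¹ ≤ (1 + R) / κ := by
        calc (R ^ β + 12 * t) ^ β⁻¹ ≤ (2 * R ^ β) ^ β⁻¹ :=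
              Real.rpow_le_rpow hY (by linarith) (by positivity)
          _ = 2 ^ β⁻¹ * R := by
              rw [Real.mul_rpow (by norm_num) (by positivity), Real.rpow_rpow_inv hR hβ.ne']
          _ ≤ 2 ^ β⁻¹ * (2 * (1 + R)) := by gcongr; linarith
          _ = _ := by
              rw [hκdef, Real.inv_rpow (by norm_num)]; field_simp
      have a3 : (R ^ β - 12 * t) ^ β⁻¹ ≤ (R ^ β + 12 * t) ^ β⁻¹ :=
        Real.rpow_le_rpow hX (by linarith) (by positivity)
      have h := (hCb R _ _ hR a3 a1 a2).2
      rw [Real.rpow_inv_rpow hX hβ.ne', Real.rpow_inv_rpow hY hβ.ne'] at h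
      refine h.trans ?_
      have h5 : Real.exp (-α * (R ^ β - 12 * t)) - Real.exp (-α * (R ^ β + 12 * t)) ≤
          (24 * α * (2 * Real.exp α)) * τ * Real.exp (-α * R ^ β) := by
        have e1 : Real.exp (-α * (R ^ β - 12 * t)) =
            Real.exp (-α * R ^ β) * Real.exp (12 * α * t) := by rw [← Real.exp_add]; ring_nf
        have e2 : Real.exp (-α * (R ^ β + 12 * t)) =
            Real.exp (-α * R ^ β) * Real.exp (-(12 * α * t)) := by rw [← Real.exp_add]; ring_nf
        rw [e1, e2, ← mul_sub, mul_comm]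
        refine mul_le_mul_of_nonneg_right ?_ (Real.exp_pos _).le
        refine (le_abs_self _).trans ((abs_exp_sub_exp_le _ _).trans ?_)
        have e3 : |12 * α * t - -(12 * α * t)| = 24 * α * t := by
          rw [abs_of_nonneg (by nlinarith [mul_nonneg hα.le ht])]; ring
        have e4 : Real.exp (12 * α * t) ≤ Real.exp α := Real.exp_le_exp.mpr (by nlinarith)
        have e5 : Real.exp (-(12 * α * t)) ≤ Real.exp α :=
          Real.exp_le_exp.mpr (by nlinarith [mul_nonneg hα.le ht])
        rw [e3]
        calc 24 * α * t * (Real.exp (12 * α * t) + Real.exp (-(12 * α * t)))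
            ≤ 24 * α * τ * (Real.exp α + Real.exp α) := by gcongr
          _ = _ := by ring
      calc _ ≤ C * ((1 + R) ^ ((N : ℝ) - 2 * δ - β) *
            ((24 * α * (2 * Real.exp α)) * τ * Real.exp (-α * R ^ β))) := by gcongr
        _ = (C * (24 * α * (2 * Real.exp α))) * τ * shellWeight N α β δ R := by
          unfold shellWeight; ring
        _ ≤ _ := by
          gcongr
          exact le_max_right _ _
    · have h := abs_le.mp (h h2)
      exact ⟨(Real.rpow_inv_le_iff_of_pos hX hr hβ).mpr (by linarith),
        (Real.le_rpow_inv_iff_of_pos hr hY hβ).mpr (by linarith)⟩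

lemma mul_exp_neg_le {c u : ℝ} (hc : 0 < c) : u * Real.exp (-(c * u)) ≤ 1 / c := by
  have h := Real.add_one_le_exp (c * u)
  rw [Real.exp_neg, ← div_eq_mul_inv, div_le_div_iff₀ (Real.exp_pos _) hc]
  linarith

lemma rpow_le_two_rpow_mul {β R y : ℝ} (hβ : 0 < β) (hR : 0 ≤ R) (hy : 2 * (1 + R) ≤ y) :
    R ^ β + (2 ^ β - 1) ≤ y ^ β ∧ R ^ β ≤ (2 ^ β)⁻¹ * y ^ β := by
  have h1 : (2 * (1 + R)) ^ β ≤ y ^ β := Real.rpow_le_rpow (by positivity) hy hβ.le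
  rw [Real.mul_rpow (by norm_num) (by positivity)] at h1
  have h2 : R ^ β ≤ (1 + R) ^ β := Real.rpow_le_rpow hR (by linarith) hβ.le
  have h3 : 1 ≤ (1 + R) ^ β := Real.one_le_rpow (by linarith) hβ.le
  have h4 : 1 ≤ (2:ℝ) ^ β := Real.one_le_rpow (by norm_num) hβ.le
  constructor
  · nlinarith
  · rw [le_inv_mul_iff₀ (by positivity)]
    nlinarith

/-- Mass of the layer near the outer boundary of the support. -/
lemma exists_outerLayer_le (hN : 1 ≤ N) (hα : 0 < α) (hβ : 0 < β) (δ : ℝ) :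
    ∃ C : ℝ, 0 < C ∧ ∀ R τ : ℝ, 0 ≤ R → 0 ≤ τ → τ ≤ 1 / 24 →
      shellMass N α β δ (2 * R + 10 - 24 * τ) (2 * R + 10 + 24 * τ) ≤
        C * τ * shellWeight N α β δ R := by
  obtain ⟨c, hc, hcb⟩ := exists_shellMass_le_length hN
  obtain ⟨C, hC, hCb⟩ := exists_algebraic_comparable hN β δ (κ := 1 / 11) (by norm_num)
    (by norm_num)
  have h2β : 1 < (2:ℝ) ^ β := Real.one_lt_rpow (by norm_num) hβ
  set θ : ℝ := 1 - (2 ^ β)⁻¹ with hθ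
  have hθ0 : 0 < θ := by
    have := inv_lt_one_of_one_lt₀ h2β
    linarith
  refine ⟨c * (C * (1 / (α * θ)) * 48), by positivity, ?_⟩
  intro R τ hR hτ hτ1
  have h := hcb α β δ (2 * R + 10 - 24 * τ) (2 * R + 10 + 24 * τ)
    (C * (1 / (α * θ)) * shellWeight N α β δ R) hβ.le (by linarith) (by linarith) ?_
  · refine h.trans (le_of_eq ?_); ring
  · intro y hy
    have hy1 : 2 * R + 9 ≤ y := by linarith [hy.1]
    have hy2 : y ≤ 2 * R + 11 := by linarith [hy.2]
    have hy0 : 1 ≤ y := by linarith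
    have a := (hCb (1 + R) y (by linarith) (by linarith) (by linarith)).2
    have b : y ^ (β - 1) ≤ y ^ β := Real.rpow_le_rpow_of_exponent_le hy0 (by linarith)
    have e1 : Real.exp (-α * y ^ β) ≤ Real.exp (-(α * θ * y ^ β)) * Real.exp (-α * R ^ β) := by
      rw [← Real.exp_add]
      apply Real.exp_le_exp.mpr
      have := (rpow_le_two_rpow_mul hβ hR (by linarith : 2 * (1 + R) ≤ y)).2
      have : α * R ^ β ≤ α * ((2 ^ β)⁻¹ * y ^ β) := by gcongr
      rw [hθ]; linarith
    have e2 : y ^ β * Real.exp (-(α * θ * y ^ β)) ≤ 1 / (α * θ) := mul_exp_neg_le (by positivity)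
    unfold radialDatum shellWeight
    rw [← mul_assoc]
    set L := (1 + R) ^ ((N : ℝ) - 2 * δ - β)
    have hL : 0 < L := by positivity
    calc _ ≤ (C * L * y ^ (β - 1)) * Real.exp (-α * y ^ β) := by gcongr
      _ ≤ (C * L * y ^ β) * (Real.exp (-(α * θ * y ^ β)) * Real.exp (-α * R ^ β)) := by gcongr
      _ = C * L * (y ^ β * Real.exp (-(α * θ * y ^ β))) * Real.exp (-α * R ^ β) := by ring
      _ ≤ C * L * (1 / (α * θ)) * Real.exp (-α * R ^ β) := by gcongr
      _ = _ := by ring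

/-- Lower bound for the mass in an interior shell. -/
lemma exists_le_shellMass (hN : 1 ≤ N) (hα : 0 < α) (hβ : 0 < β) (δ : ℝ) :
    ∃ c κ h : ℝ, 0 < c ∧ 0 < κ ∧ 0 < h ∧ ∀ R : ℝ, 0 ≤ R → ∃ r₁ r₂ : ℝ,
      c * shellWeight N α β δ R ≤ shellMass N α β δ r₁ r₂ ∧ κ * (1 + R) ≤ r₁ ∧
      r₂ ≤ 2 * R + 9 ∧ ∀ r ∈ Icc r₁ r₂, R ^ β + h ≤ r ^ β := by
  have h2β : 1 < (2:ℝ) ^ β := Real.one_lt_rpow (by norm_num) hβ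
  set h : ℝ := (2 ^ β - 1) / 2 with hh
  have hh0 : 0 < h := by rw [hh]; linarith
  set κ : ℝ := min (1 + (h ^ β⁻¹)⁻¹)⁻¹ (1 / 9) with hκdef
  have hκ : 0 < κ := by positivity
  have hκ9 : κ ≤ 1 / 9 := min_le_right _ _
  obtain ⟨C, hC, hCb⟩ := exists_shellMass_comparable hN hα hβ δ hκ (by linarith)
  have hD : 0 < Real.exp (-α * h) - Real.exp (-α * (2 * h)) := by
    rw [sub_pos]; exact Real.exp_lt_exp.mpr (by nlinarith)
  refine ⟨C⁻¹ * (Real.exp (-α * h) - Real.exp (-α * (2 * h))), κ, h, by positivity, hκ, hh0, ?_⟩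
  intro R hR
  have hRβ : 0 ≤ R ^ β := by positivity
  have hX : 0 ≤ R ^ β + h := by positivity
  have hY : 0 ≤ R ^ β + 2 * h := by positivity
  have a1 : κ * (1 + R) ≤ (R ^ β + h) ^ β⁻¹ := by
    have b1 : R ≤ (R ^ β + h) ^ β⁻¹ :=
      (Real.le_rpow_inv_iff_of_pos hR hX hβ).mpr (by linarith)
    have b2 : h ^ β⁻¹ ≤ (R ^ β + h) ^ β⁻¹ :=
      Real.rpow_le_rpow hh0.le (by linarith) (by positivity)
    set r := (R ^ β + h) ^ β⁻¹
    have hp : 0 < h ^ β⁻¹ := by positivity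
    have b3 : 1 ≤ (h ^ β⁻¹)⁻¹ * r := by
      rw [le_inv_mul_iff₀ hp]; linarith
    calc κ * (1 + R) ≤ (1 + (h ^ β⁻¹)⁻¹)⁻¹ * (1 + R) := by
          gcongr
          exact min_le_left _ _
      _ ≤ r := by
          rw [inv_mul_le_iff₀ (by positivity)]
          linarith
  have a2 : (R ^ β + 2 * h) ^ β⁻¹ ≤ 2 * R + 9 := by
    rw [Real.rpow_inv_le_iff_of_pos hY (by linarith) hβ]
    have := (rpow_le_two_rpow_mul hβ hR (by linarith : 2 * (1 + R) ≤ 2 * R + 9)).1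
    rw [hh]; linarith
  have a3 : (R ^ β + h) ^ β⁻¹ ≤ (R ^ β + 2 * h) ^ β⁻¹ :=
    Real.rpow_le_rpow hX (by linarith) (by positivity)
  refine ⟨(R ^ β + h) ^ β⁻¹, (R ^ β + 2 * h) ^ β⁻¹, ?_, a1, a2, fun r hr => ?_⟩
  · have a4 : (R ^ β + 2 * h) ^ β⁻¹ ≤ (1 + R) / κ := by
      refine a2.trans ?_
      rw [le_div_iff₀ hκ]; nlinarith
    have l := (hCb R _ _ hR a3 a1 a4).1
    rw [Real.rpow_inv_rpow hX hβ.ne', Real.rpow_inv_rpow hY hβ.ne'] at l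
    refine le_trans (le_of_eq ?_) l
    rw [mul_add, mul_add, Real.exp_add, Real.exp_add]
    unfold shellWeight; ring
  · have hr0 : 0 ≤ r := le_trans (by positivity) hr.1
    exact (Real.rpow_inv_le_iff_of_pos hX hr0 hβ).mp hr.1

end

section
variable {N : ℕ} {α β γ δ ω : ℝ}

lemma initialDatum_of_mem {x v : E N} (h1 : ‖x‖ ^ γ ≤ ‖v‖) (h2 : ‖v‖ ≤ 2 * ‖x‖ ^ γ + 10) :
    initialDatum α β γ δ ω x v = (1 + ‖x‖) ^ (-ω) * radialDatum α β δ ‖v‖ := by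
  unfold initialDatum radialDatum
  rw [indicator_of_mem (by exact ⟨h1, h2⟩), mul_assoc]

lemma initialDatum_of_not {x v : E N} (h : ¬(‖x‖ ^ γ ≤ ‖v‖ ∧ ‖v‖ ≤ 2 * ‖x‖ ^ γ + 10)) :
    initialDatum α β γ δ ω x v = 0 := by
  unfold initialDatum
  exact indicator_of_notMem (by exact h) _

lemma initialDatum_nonneg (x v : E N) : 0 ≤ initialDatum α β γ δ ω x v := by
  by_cases h : ‖x‖ ^ γ ≤ ‖v‖ ∧ ‖v‖ ≤ 2 * ‖x‖ ^ γ + 10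
  · rw [initialDatum_of_mem h.1 h.2]
    exact mul_nonneg (by positivity) (radialDatum_pos _).le
  · rw [initialDatum_of_not h]

lemma initialDatum_neg (x v : E N) :
    initialDatum α β γ δ ω x (-v) = initialDatum α β γ δ ω x v := by
  unfold initialDatum
  simp [indicator, norm_neg]

lemma measurable_initialDatum :
    Measurable fun p : E N × E N => initialDatum α β γ δ ω p.1 p.2 := by
  have hS : MeasurableSet {p : E N × E N | ‖p.1‖ ^ γ ≤ ‖p.2‖ ∧ ‖p.2‖ ≤ 2 * ‖p.1‖ ^ γ + 10} :=
    (measurableSet_le (f := fun p : E N × E N => ‖p.1‖ ^ γ) (g := fun p => ‖p.2‖)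
      (by fun_prop) (by fun_prop)).inter
      (measurableSet_le (f := fun p : E N × E N => ‖p.2‖) (g := fun p => 2 * ‖p.1‖ ^ γ + 10)
        (by fun_prop) (by fun_prop))
  have hm : Measurable fun p : E N × E N =>
      (1 + ‖p.1‖) ^ (-ω) * (1 + ‖p.2‖ ^ 2) ^ (-δ) * Real.exp (-α * ‖p.2‖ ^ β) := by fun_prop
  exact hm.indicator hS

lemma shift_factor {γ t p r : ℝ} (hγ0 : 0 ≤ γ) (hγ1 : γ ≤ 1) (hp : 0 ≤ p) (ht : 0 ≤ t)
    (ht1 : t ≤ 1 / 24) (h : |p - r| ≤ t * (2 * p ^ γ + 10)) :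
    |p - r| ≤ 12 * t * (1 + p) ∧ 1 + r ≤ 2 * (1 + p) ∧ 1 + p ≤ 2 * (1 + r) := by
  have h1 : p ^ γ ≤ 1 + p := by
    calc p ^ γ ≤ (1 + p) ^ γ := Real.rpow_le_rpow hp (by linarith) hγ0
      _ ≤ (1 + p) ^ (1:ℝ) := Real.rpow_le_rpow_of_exponent_le (by linarith) hγ1
      _ = 1 + p := Real.rpow_one _
  have h2 : |p - r| ≤ 12 * t * (1 + p) := by nlinarith
  have h3 : 12 * t * (1 + p) ≤ (1 + p) / 2 := by nlinarith
  have h4 := abs_le.mp (h2.trans h3)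
  exact ⟨h2, by linarith, by linarith⟩

lemma rpow_neg_le_of_le_two_mul {b c ω : ℝ} (hω : 0 ≤ ω) (hb : 0 < b) (hc : 0 < c)
    (h : b ≤ 2 * c) : c ^ (-ω) ≤ 2 ^ ω * b ^ (-ω) := by
  have h1 := Real.rpow_le_rpow hb.le h hω
  rw [Real.mul_rpow (by norm_num) hc.le] at h1
  rw [Real.rpow_neg hc.le, Real.rpow_neg hb.le, ← div_eq_mul_inv, le_div_iff₀ (by positivity),
    inv_mul_le_iff₀ (by positivity), mul_comm]
  exact h1

lemma abs_rpow_neg_sub_le {b c ω s : ℝ} (hω : 0 ≤ ω) (hb : 0 < b) (hc : 0 < c)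
    (h1 : b ≤ 2 * c) (h2 : |b - c| ≤ s * b) :
    |c ^ (-ω) - b ^ (-ω)| ≤ (2 * ω * (2 ^ ω + 1)) * s * b ^ (-ω) := by
  have e1 := rpow_neg_le_of_le_two_mul hω hb hc h1
  have hlog : |Real.log c - Real.log b| ≤ 2 * s := by
    refine (abs_log_sub_log_le (m := b / 2) (by linarith) (by linarith) (by linarith)).trans ?_
    rw [div_le_iff₀ (by positivity), abs_sub_comm]
    linarith
  rw [Real.rpow_def_of_pos hc, Real.rpow_def_of_pos hb] at *
  refine (abs_exp_sub_exp_le _ _).trans ?_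
  have e2 : |Real.log c * -ω - Real.log b * -ω| ≤ ω * (2 * s) := by
    rw [← sub_mul, abs_mul, abs_neg, abs_of_nonneg hω, mul_comm]
    gcongr
  have hs : 0 ≤ 2 * s := (abs_nonneg _).trans hlog
  have hs' : 0 ≤ s := by linarith
  calc _ ≤ (ω * (2 * s)) * (2 ^ ω * Real.exp (Real.log b * -ω) + Real.exp (Real.log b * -ω)) := by
        gcongr
    _ = _ := by ring

lemma norm_sub_norm_shift_le {t : ℝ} (ht : 0 ≤ t) (x v : E N) :
    |‖x‖ - ‖x - t • v‖| ≤ t * ‖v‖ := by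
  refine (abs_norm_sub_norm_le _ _).trans ?_
  rw [sub_sub_cancel, norm_smul, Real.norm_of_nonneg ht]

lemma one_le_of_rpow_ge_two {p r γ : ℝ} (hγ : 0 ≤ γ) (hγ2 : γ ≤ 1 / 2) (hp : 0 ≤ p)
    (h : 2 ≤ p ^ γ) (hpr : 1 + p ≤ 2 * (1 + r)) : 1 ≤ p ∧ 1 ≤ r := by
  have h1 : 1 ≤ p := by
    by_contra hc
    push Not at hc
    have := Real.rpow_le_one hp hc.le hγ
    linarith
  have h2 : 2 ≤ p ^ (1 / 2 : ℝ) := h.trans (Real.rpow_le_rpow_of_exponent_le h1 hγ2)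
  rw [← Real.sqrt_eq_rpow] at h2
  have h3 : 2 ^ 2 ≤ p := (Real.le_sqrt (by norm_num) hp).mp h2
  exact ⟨h1, by linarith⟩

/-- Consequences of a transport by an admissible velocity for the boundary radii. -/
lemma boundary_shift (hβ : 0 < β) (hγ : 0 < γ) (hγ2 : γ ≤ 1 / 2) (hsum : β * γ + γ ≤ 1) {t : ℝ}
    {x y : E N} (ht : 0 ≤ t) (ht1 : t ≤ 1 / 24) (h : |‖x‖ - ‖y‖| ≤ t * (2 * ‖x‖ ^ γ + 10)) :
    |‖x‖ ^ γ - ‖y‖ ^ γ| ≤ 12 * t ^ γ ∧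
    |(‖x‖ ^ γ) ^ β - (‖y‖ ^ γ) ^ β| ≤ 12 * t ^ (β * γ) ∧
    (1 ≤ ‖x‖ → |(‖x‖ ^ γ) ^ β - (‖y‖ ^ γ) ^ β| ≤ 12 * t) := by
  have hx := norm_nonneg x
  have hy := norm_nonneg y
  rw [← Real.rpow_mul hx, ← Real.rpow_mul hy, mul_comm γ β]
  obtain ⟨h1, -⟩ := abs_rpow_sub_rpow_le_of_shift hγ hγ.le (by linarith) hx hy ht (by linarith) h
  obtain ⟨h2, h3⟩ := abs_rpow_sub_rpow_le_of_shift (a := β * γ) (by positivity) hγ.le hsum hx hy ht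
    (by linarith) h
  exact ⟨h1, h2, h3⟩

/-- Smallness of the time for the free transport estimates. -/
structure SmallTime (β γ h t : ℝ) : Prop where
  nonneg : 0 ≤ t
  le : t ≤ 1 / 24
  rpow_le : t ^ γ ≤ 1 / 24
  rpow_mul_le : 12 * t ^ (β * γ) ≤ 1 / 2
  rpow_mul_le' : 12 * t ^ (β * γ) ≤ h

lemma exists_rpow_le {a ε : ℝ} (ha : 0 < a) (hε : 0 < ε) :
    ∃ s : ℝ, 0 < s ∧ ∀ t ∈ Icc 0 s, t ^ a ≤ ε := by
  refine ⟨ε ^ a⁻¹, by positivity, fun t ht => ?_⟩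
  calc t ^ a ≤ (ε ^ a⁻¹) ^ a := Real.rpow_le_rpow ht.1 ht.2 ha.le
    _ = ε := Real.rpow_inv_rpow hε.le ha.ne'

lemma exists_smallTime (hβ : 0 < β) (hγ : 0 < γ) {h : ℝ} (hh : 0 < h) :
    ∃ t₁ : ℝ, 0 < t₁ ∧ ∀ t ∈ Icc 0 t₁, SmallTime β γ h t := by
  obtain ⟨s₁, hs₁, h₁⟩ := exists_rpow_le (ε := 1 / 24) hγ (by norm_num)
  obtain ⟨s₂, hs₂, h₂⟩ := exists_rpow_le (a := β * γ) (ε := min (1 / 2) h / 12) (by positivity)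
    (by positivity)
  refine ⟨min (1 / 24) (min s₁ s₂), by positivity, fun t ht => ?_⟩
  have g1 := h₁ t ⟨ht.1, ht.2.trans ((min_le_right _ _).trans (min_le_left _ _))⟩
  have g2 := h₂ t ⟨ht.1, ht.2.trans ((min_le_right _ _).trans (min_le_right _ _))⟩
  have g3 := min_le_left (1 / 2) h
  have g4 := min_le_right (1 / 2) h
  exact ⟨ht.1, ht.2.trans (min_le_left _ _), g1, by linarith, by linarith⟩

/-- Support and size of the transported datum. -/
lemma transported_datum_upper (hβ : 0 < β) (hγ : 0 < γ) (hγ2 : γ ≤ 1 / 2)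
    (hsum : β * γ + γ ≤ 1) (hω : 0 ≤ ω) {t h : ℝ} (ht : SmallTime β γ h t) {x v : E N}
    (hv : ‖x - t • v‖ ^ γ ≤ ‖v‖ ∧ ‖v‖ ≤ 2 * ‖x - t • v‖ ^ γ + 10) :
    (‖x‖ ^ γ) ^ β - 1 / 2 ≤ ‖v‖ ^ β ∧ ‖v‖ ≤ 2 * ‖x‖ ^ γ + 12 ∧
    initialDatum α β γ δ ω (x - t • v) v ≤
      2 ^ ω * ((1 + ‖x‖) ^ (-ω) * radialDatum α β δ ‖v‖) := by
  have h0 := ht.nonneg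
  set y := x - t • v with hy
  have hd : |‖y‖ - ‖x‖| ≤ t * (2 * ‖y‖ ^ γ + 10) := by
    rw [abs_sub_comm]
    exact (norm_sub_norm_shift_le h0 x v).trans (by gcongr; exact hv.2)
  obtain ⟨b1, b2, -⟩ := boundary_shift hβ hγ hγ2 hsum h0 ht.le hd
  obtain ⟨-, -, s3⟩ := shift_factor hγ.le (by linarith) (norm_nonneg y) h0 ht.le hd
  obtain ⟨-, s2, -⟩ := shift_factor hγ.le (by linarith) (norm_nonneg y) h0 ht.le hd
  have b1' := abs_le.mp b1
  have b2' := abs_le.mp b2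
  have r1 := ht.rpow_le
  have r2 := ht.rpow_mul_le
  refine ⟨?_, by linarith [hv.2], ?_⟩
  · have := Real.rpow_le_rpow (by positivity) hv.1 hβ.le
    linarith
  · rw [initialDatum_of_mem hv.1 hv.2, ← mul_assoc]
    have := radialDatum_pos (α := α) (β := β) (δ := δ) ‖v‖
    gcongr
    exact rpow_neg_le_of_le_two_mul hω (by positivity) (by positivity) s2

lemma transported_datum_lower (hβ : 0 < β) (hγ : 0 < γ) (hγ2 : γ ≤ 1 / 2)
    (hsum : β * γ + γ ≤ 1) (hω : 0 ≤ ω) {t h : ℝ} (ht : SmallTime β γ h t) {x v : E N}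
    (hv1 : (‖x‖ ^ γ) ^ β + h ≤ ‖v‖ ^ β) (hv2 : ‖v‖ ≤ 2 * ‖x‖ ^ γ + 9) :
    (2 ^ ω)⁻¹ * ((1 + ‖x‖) ^ (-ω) * radialDatum α β δ ‖v‖) ≤
      initialDatum α β γ δ ω (x - t • v) v := by
  have h0 := ht.nonneg
  set y := x - t • v with hy
  have hd : |‖x‖ - ‖y‖| ≤ t * (2 * ‖x‖ ^ γ + 10) :=
    (norm_sub_norm_shift_le h0 x v).trans (by gcongr; linarith)
  obtain ⟨b1, b2, -⟩ := boundary_shift hβ hγ hγ2 hsum h0 ht.le hd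
  obtain ⟨-, s2, -⟩ := shift_factor hγ.le (by linarith) (norm_nonneg x) h0 ht.le hd
  have b1' := abs_le.mp b1
  have b2' := abs_le.mp b2
  have r1 := ht.rpow_le
  have r2 := ht.rpow_mul_le'
  have m1 : ‖y‖ ^ γ ≤ ‖v‖ := by
    rw [← Real.rpow_le_rpow_iff (by positivity) (norm_nonneg v) hβ]
    linarith
  rw [initialDatum_of_mem m1 (by linarith), ← mul_assoc]
  have := radialDatum_pos (α := α) (β := β) (δ := δ) ‖v‖
  gcongr
  rw [inv_mul_le_iff₀ (by positivity)]
  exact rpow_neg_le_of_le_two_mul hω (by positivity) (by positivity) s2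

/-- The change of the datum under transport lives in the bulk, with a factor `t`, and in two
boundary layers. -/
lemma transported_datum_sub (hβ : 0 < β) (hγ : 0 < γ) (hγ2 : γ ≤ 1 / 2)
    (hsum : β * γ + γ ≤ 1) (hω : 0 ≤ ω) {t h : ℝ} (ht : SmallTime β γ h t) {x : E N}
    {r₀ r₁ r₂ : ℝ} (hr₀ : ∀ r : ℝ, 0 ≤ r → (‖x‖ ^ γ) ^ β - 1 / 2 ≤ r ^ β → r₀ ≤ r)
    (hr : ∀ r : ℝ, 0 ≤ r → |r - ‖x‖ ^ γ| ≤ 12 * t ^ γ →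
      (2 ≤ ‖x‖ ^ γ → |r ^ β - (‖x‖ ^ γ) ^ β| ≤ 12 * t) → r ∈ Icc r₁ r₂) (v : E N) :
    |initialDatum α β γ δ ω (x - t • v) v - initialDatum α β γ δ ω x v| ≤
      (2 ^ ω + 48 * ω * (2 ^ ω + 1)) * (1 + ‖x‖) ^ (-ω) *
        (t * (Icc r₀ (2 * ‖x‖ ^ γ + 12)).indicator (radialDatum α β δ) ‖v‖ +
        (Icc r₁ r₂).indicator (radialDatum α β δ) ‖v‖ +
        (Icc (2 * ‖x‖ ^ γ + 10 - 24 * t ^ γ) (2 * ‖x‖ ^ γ + 10 + 24 * t ^ γ)).indicator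
          (radialDatum α β δ) ‖v‖) := by
  have h0 := ht.nonneg
  have hm := radialDatum_pos (α := α) (β := β) (δ := δ) ‖v‖
  have hi : ∀ s : Set ℝ, 0 ≤ s.indicator (radialDatum α β δ) ‖v‖ := fun s =>
    indicator_nonneg (fun _ _ => (radialDatum_pos _).le) _
  have hB : 0 < (1 + ‖x‖) ^ (-ω) := by positivity
  have h2ω : 1 ≤ (2:ℝ) ^ ω := Real.one_le_rpow (by norm_num) hω
  set D := 2 ^ ω + 48 * ω * (2 ^ ω + 1) with hD
  have hD1 : 2 ^ ω ≤ D := by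
    have : 0 ≤ 48 * ω * (2 ^ ω + 1) := by positivity
    linarith
  have hD2 : 48 * ω * (2 ^ ω + 1) ≤ D := by linarith
  have hD0 : 0 < D := by linarith
  set B := (1 + ‖x‖) ^ (-ω) with hBdef
  set m := radialDatum α β δ ‖v‖ with hmdef
  set up := (Icc r₀ (2 * ‖x‖ ^ γ + 12)).indicator (radialDatum α β δ) ‖v‖ with hup
  set inn := (Icc r₁ r₂).indicator (radialDatum α β δ) ‖v‖ with hinn
  set out := (Icc (2 * ‖x‖ ^ γ + 10 - 24 * t ^ γ) (2 * ‖x‖ ^ γ + 10 + 24 * t ^ γ)).indicator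
    (radialDatum α β δ) ‖v‖ with hout
  have i1 : 0 ≤ up := hi _
  have i2 : 0 ≤ inn := hi _
  have i3 : 0 ≤ out := hi _
  have goal_up : ∀ X : ℝ, X ≤ D * B * (t * m) → ‖v‖ ∈ Icc r₀ (2 * ‖x‖ ^ γ + 12) →
      X ≤ D * B * (t * up + inn + out) := by
    intro X hX hvm
    refine hX.trans ?_
    have : up = m := indicator_of_mem hvm _
    gcongr
    rw [this]; linarith
  have goal_in : ∀ X : ℝ, X ≤ D * B * m → ‖v‖ ∈ Icc r₁ r₂ →
      X ≤ D * B * (t * up + inn + out) := by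
    intro X hX hvm
    refine hX.trans ?_
    have : inn = m := indicator_of_mem hvm _
    have : 0 ≤ t * up := by positivity
    gcongr
    linarith
  have goal_out : ∀ X : ℝ, X ≤ D * B * m →
      ‖v‖ ∈ Icc (2 * ‖x‖ ^ γ + 10 - 24 * t ^ γ) (2 * ‖x‖ ^ γ + 10 + 24 * t ^ γ) →
      X ≤ D * B * (t * up + inn + out) := by
    intro X hX hvm
    refine hX.trans ?_
    have : out = m := indicator_of_mem hvm _
    have : 0 ≤ t * up := by positivity
    gcongr
    linarith
  set y := x - t • v with hy
  have hτ := ht.rpow_le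
  by_cases hvy : ‖y‖ ^ γ ≤ ‖v‖ ∧ ‖v‖ ≤ 2 * ‖y‖ ^ γ + 10
  · obtain ⟨u1, u2, u3⟩ := transported_datum_upper (α := α) (δ := δ) hβ hγ hγ2 hsum hω ht hvy
    rw [← hy] at u3
    have hd : |‖y‖ - ‖x‖| ≤ t * (2 * ‖y‖ ^ γ + 10) := by
      rw [abs_sub_comm]
      exact (norm_sub_norm_shift_le h0 x v).trans (by gcongr; exact hvy.2)
    obtain ⟨b1, b2, b3⟩ := boundary_shift hβ hγ hγ2 hsum h0 ht.le hd
    obtain ⟨s1, s2, s3⟩ := shift_factor hγ.le (by linarith) (norm_nonneg y) h0 ht.le hd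
    by_cases hvx : ‖x‖ ^ γ ≤ ‖v‖ ∧ ‖v‖ ≤ 2 * ‖x‖ ^ γ + 10
    · refine goal_up _ ?_ ⟨hr₀ _ (norm_nonneg v) u1, u2⟩
      rw [initialDatum_of_mem hvy.1 hvy.2, initialDatum_of_mem hvx.1 hvx.2, ← sub_mul, abs_mul,
        abs_of_pos hm]
      have := abs_rpow_neg_sub_le (b := 1 + ‖x‖) (c := 1 + ‖y‖) (s := 24 * t) hω (by positivity)
        (by positivity) s2 (by
          rw [add_sub_add_left_eq_sub, abs_sub_comm]
          refine s1.trans ?_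
          nlinarith)
      calc _ ≤ (2 * ω * (2 ^ ω + 1)) * (24 * t) * (1 + ‖x‖) ^ (-ω) * m := by gcongr
        _ = (48 * ω * (2 ^ ω + 1)) * B * (t * m) := by ring
        _ ≤ _ := by gcongr
    · rw [initialDatum_of_not hvx, sub_zero, abs_of_nonneg (initialDatum_nonneg _ _)]
      have u4 : initialDatum α β γ δ ω y v ≤ D * B * m := by
        refine u3.trans ?_
        rw [mul_assoc]
        gcongr
      have b1' := abs_le.mp b1
      rcases lt_or_ge ‖v‖ (‖x‖ ^ γ) with hlt | hge
      · refine goal_in _ u4 (hr _ (norm_nonneg v) ?_ fun h2 => ?_)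
        · rw [abs_le]; constructor <;> linarith [hvy.1]
        · obtain ⟨-, hy1⟩ := one_le_of_rpow_ge_two hγ.le hγ2 (norm_nonneg x) h2 s2
          have b3' := abs_le.mp (b3 hy1)
          have c1 := Real.rpow_le_rpow (by positivity) hvy.1 hβ.le
          have c2 := Real.rpow_le_rpow (norm_nonneg v) hlt.le hβ.le
          rw [abs_le]; constructor <;> linarith
      · have : 2 * ‖x‖ ^ γ + 10 < ‖v‖ := by
          by_contra hc
          exact hvx ⟨hge, not_lt.mp hc⟩
        refine goal_out _ u4 ⟨?_, ?_⟩
        · have : 0 ≤ t ^ γ := by positivity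
          linarith
        · linarith [hvy.2]
  · rw [initialDatum_of_not hvy, zero_sub, abs_neg, abs_of_nonneg (initialDatum_nonneg _ _)]
    by_cases hvx : ‖x‖ ^ γ ≤ ‖v‖ ∧ ‖v‖ ≤ 2 * ‖x‖ ^ γ + 10
    · have hd : |‖x‖ - ‖y‖| ≤ t * (2 * ‖x‖ ^ γ + 10) :=
        (norm_sub_norm_shift_le h0 x v).trans (by gcongr; exact hvx.2)
      obtain ⟨b1, b2, b3⟩ := boundary_shift hβ hγ hγ2 hsum h0 ht.le hd
      obtain ⟨s1, s2, s3⟩ := shift_factor hγ.le (by linarith) (norm_nonneg x) h0 ht.le hd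
      have u4 : initialDatum α β γ δ ω x v ≤ D * B * m := by
        rw [initialDatum_of_mem hvx.1 hvx.2]
        have : 1 ≤ D := by linarith
        rw [mul_assoc]
        exact le_mul_of_one_le_left (by positivity) this
      have b1' := abs_le.mp b1
      rcases lt_or_ge ‖v‖ (‖y‖ ^ γ) with hlt | hge
      · refine goal_in _ u4 (hr _ (norm_nonneg v) ?_ fun h2 => ?_)
        · rw [abs_le]; constructor <;> linarith [hvx.1]
        · obtain ⟨hx1, -⟩ := one_le_of_rpow_ge_two hγ.le hγ2 (norm_nonneg x) h2 s3
          have b3' := abs_le.mp (b3 hx1)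
          have c1 := Real.rpow_le_rpow (by positivity) hvx.1 hβ.le
          have c2 := Real.rpow_le_rpow (norm_nonneg v) hlt.le hβ.le
          rw [abs_le]; constructor <;> linarith
      · have : 2 * ‖y‖ ^ γ + 10 < ‖v‖ := by
          by_contra hc
          exact hvy ⟨hge, not_lt.mp hc⟩
        refine goal_out _ u4 ⟨?_, ?_⟩
        · linarith
        · have : 0 ≤ t ^ γ := by positivity
          linarith [hvx.2]
    · rw [initialDatum_of_not hvx]
      positivity

end

section
variable {N : ℕ} {α β γ δ ω : ℝ}

lemma scale_comparable (hγ : 0 ≤ γ) (hγ1 : γ ≤ 1) (x : E N) :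
    scale γ x ≤ 1 + ‖x‖ ^ γ ∧ 1 + ‖x‖ ^ γ ≤ 2 * scale γ x := by
  have hx := norm_nonneg x
  constructor
  · simpa [scale] using Real.rpow_add_le_add_rpow (zero_le_one) hx hγ hγ1
  · have h1 := one_le_scale hγ x
    have h2 : ‖x‖ ^ γ ≤ scale γ x := Real.rpow_le_rpow hx (by linarith) hγ
    linarith

lemma densityWeight_eq (x : E N) :
    densityWeight α (β * γ) ((2 * δ + β) * γ + ω) γ x =
      (1 + ‖x‖) ^ (((N : ℝ) - 2 * δ - β) * γ - ω) * Real.exp (-α * ‖x‖ ^ (β * γ)) := by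
  have h : 0 < 1 + ‖x‖ := by positivity
  unfold densityWeight phaseWeight scale
  rw [← Real.rpow_natCast, ← Real.rpow_mul h.le, mul_right_comm, ← Real.rpow_add h]
  congr 2; ring

lemma exists_weight_comparable (N : ℕ) (α β δ ω : ℝ) (hγ : 0 ≤ γ) (hγ1 : γ ≤ 1) :
    ∃ C : ℝ, 0 < C ∧ ∀ x : E N,
      C⁻¹ * densityWeight α (β * γ) ((2 * δ + β) * γ + ω) γ x ≤
        (1 + ‖x‖) ^ (-ω) * shellWeight N α β δ (‖x‖ ^ γ) ∧
      (1 + ‖x‖) ^ (-ω) * shellWeight N α β δ (‖x‖ ^ γ) ≤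
        C * densityWeight α (β * γ) ((2 * δ + β) * γ + ω) γ x := by
  refine ⟨((1 / 2) ^ |(N : ℝ) - 2 * δ - β|)⁻¹, by positivity, fun x => ?_⟩
  have h : 0 < 1 + ‖x‖ := by positivity
  have hS := scale_pos (γ := γ) x
  obtain ⟨s1, s2⟩ := scale_comparable hγ hγ1 x
  obtain ⟨a1, a2⟩ := rpow_comparable (κ := 1 / 2) (by norm_num) hS (by linarith)
    (by linarith : 1 + ‖x‖ ^ γ ≤ scale γ x / (1 / 2)) ((N : ℝ) - 2 * δ - β)
  have e : densityWeight α (β * γ) ((2 * δ + β) * γ + ω) γ x =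
      (1 + ‖x‖) ^ (-ω) * (scale γ x ^ ((N : ℝ) - 2 * δ - β) *
        Real.exp (-α * (‖x‖ ^ γ) ^ β)) := by
    rw [densityWeight_eq, scale, ← Real.rpow_mul h.le, ← Real.rpow_mul (norm_nonneg x),
      ← mul_assoc, ← Real.rpow_add h, mul_comm γ β]
    congr 2; ring
  rw [e, inv_inv]
  unfold shellWeight
  constructor
  · calc _ = (1 + ‖x‖) ^ (-ω) * (((1 / 2) ^ |(N : ℝ) - 2 * δ - β| *
          scale γ x ^ ((N : ℝ) - 2 * δ - β)) * Real.exp (-α * (‖x‖ ^ γ) ^ β)) := by ring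
      _ ≤ _ := by gcongr
  · calc _ ≤ (1 + ‖x‖) ^ (-ω) * ((((1 / 2) ^ |(N : ℝ) - 2 * δ - β|)⁻¹ *
          scale γ x ^ ((N : ℝ) - 2 * δ - β)) * Real.exp (-α * (‖x‖ ^ γ) ^ β)) := by gcongr
      _ = _ := by ring

lemma transported_le_bulk (hβ : 0 < β) (hγ : 0 < γ) (hγ2 : γ ≤ 1 / 2)
    (hsum : β * γ + γ ≤ 1) (hω : 0 ≤ ω) {t h : ℝ} (ht : SmallTime β γ h t) {x : E N} {r₀ : ℝ}
    (hr₀ : ∀ r : ℝ, 0 ≤ r → (‖x‖ ^ γ) ^ β - 1 / 2 ≤ r ^ β → r₀ ≤ r) (v : E N) :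
    initialDatum α β γ δ ω (x - t • v) v ≤ 2 ^ ω * (1 + ‖x‖) ^ (-ω) *
      (Icc r₀ (2 * ‖x‖ ^ γ + 12)).indicator (radialDatum α β δ) ‖v‖ ∧
    (‖v‖ ≤ 24 * scale γ x ∨ initialDatum α β γ δ ω (x - t • v) v = 0) := by
  by_cases hv : ‖x - t • v‖ ^ γ ≤ ‖v‖ ∧ ‖v‖ ≤ 2 * ‖x - t • v‖ ^ γ + 10
  · obtain ⟨u1, u2, u3⟩ := transported_datum_upper (α := α) (δ := δ) hβ hγ hγ2 hsum hω ht hv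
    have hx : 0 ≤ ‖x‖ ^ γ := by positivity
    refine ⟨u3.trans (le_of_eq ?_),
      Or.inl (by linarith [(scale_comparable hγ.le (by linarith : γ ≤ 1) x).2])⟩
    have hmem : ‖v‖ ∈ Icc r₀ (2 * ‖x‖ ^ γ + 12) := ⟨hr₀ _ (norm_nonneg v) u1, u2⟩
    rw [indicator_of_mem hmem, mul_assoc]
  · rw [initialDatum_of_not hv]
    exact ⟨mul_nonneg (by positivity) (indicator_nonneg (fun r _ => (radialDatum_pos r).le) _),
      Or.inr rfl⟩

lemma measurable_transported (t : ℝ) (x : E N) :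
    Measurable fun v : E N => initialDatum α β γ δ ω (x - t • v) v :=
  (measurable_initialDatum (N := N) (α := α) (β := β) (γ := γ) (δ := δ) (ω := ω)).comp
    (g := fun p : E N × E N => initialDatum α β γ δ ω p.1 p.2)
    (f := fun v : E N => (x - t • v, v)) (by fun_prop)

lemma moments_le_of_le {G U : E N → ℝ} (hGm : Measurable G) (hG : ∀ v, 0 ≤ G v)
    (hU : Integrable U) (hGU : ∀ v, G v ≤ U v) {r : ℝ} (hr : ∀ v, ‖v‖ ≤ r ∨ G v = 0) :
    (Integrable fun v => (1 + ‖v‖ ^ 2) * G v) ∧ ∫ v, G v ≤ ∫ v, U v ∧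
    ∫ v, ‖v‖ ^ 2 * G v ≤ r ^ 2 * ∫ v, U v := by
  have hU0 : ∀ v, 0 ≤ U v := fun v => (hG v).trans (hGU v)
  have hI : Integrable fun v => (1 + ‖v‖ ^ 2) * G v := by
    refine (hU.const_mul (1 + r ^ 2)).mono'
      ((by fun_prop : Measurable fun v : E N => 1 + ‖v‖ ^ 2).mul hGm).aestronglyMeasurable
      (Filter.Eventually.of_forall fun v => ?_)
    have hn := hG v
    rw [Real.norm_of_nonneg (by positivity)]
    rcases hr v with a | a
    · have := hGU v
      gcongr
    · rw [a, mul_zero]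
      exact mul_nonneg (by positivity) (hU0 v)
  have i0 := integrable_moment hI (j := 0) (by norm_num)
  simp only [pow_zero, one_mul] at i0
  refine ⟨hI, integral_mono i0 hU hGU, ?_⟩
  rw [← integral_const_mul]
  refine integral_mono (integrable_moment hI le_rfl) (hU.const_mul _) fun v => ?_
  have hn := hG v
  rcases hr v with a | a
  · exact mul_le_mul (pow_le_pow_left₀ (norm_nonneg v) a 2) (hGU v) hn (by positivity)
  · simp only [a, mul_zero]
    exact mul_nonneg (by positivity) (hU0 v)

lemma le_moments_of_le {G L : E N → ℝ} (hG : ∀ v, 0 ≤ G v)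
    (hI : Integrable fun v => (1 + ‖v‖ ^ 2) * G v) (hL : Integrable L)
    (hGL : ∀ v, L v ≤ G v) {r : ℝ} (hr0 : 0 ≤ r) (hr : ∀ v, r ≤ ‖v‖ ∨ L v = 0) :
    ∫ v, L v ≤ ∫ v, G v ∧ r ^ 2 * ∫ v, L v ≤ ∫ v, ‖v‖ ^ 2 * G v := by
  have i0 := integrable_moment hI (j := 0) (by norm_num)
  simp only [pow_zero, one_mul] at i0
  refine ⟨integral_mono hL i0 hGL, ?_⟩
  rw [← integral_const_mul]
  refine integral_mono (hL.const_mul _) (integrable_moment hI le_rfl) fun v => ?_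
  have hn := hG v
  rcases hr v with a | a
  · calc r ^ 2 * L v ≤ r ^ 2 * G v := mul_le_mul_of_nonneg_left (hGL v) (by positivity)
      _ ≤ ‖v‖ ^ 2 * G v := mul_le_mul_of_nonneg_right (pow_le_pow_left₀ hr0 a 2) hn
  · simp only [a, mul_zero]
    positivity

lemma integral_mul_add_add {f g h : E N → ℝ} (hf : Integrable f) (hg : Integrable g)
    (hh : Integrable h) (t : ℝ) : (Integrable fun v => t * f v + g v + h v) ∧
    ∫ v, (t * f v + g v + h v) = t * (∫ v, f v) + (∫ v, g v) + ∫ v, h v := by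
  have h1 : Integrable fun v => t * f v := hf.const_mul t
  have h2 : Integrable fun v => t * f v + g v := h1.add hg
  exact ⟨h2.add hh, by rw [integral_add h2 hh, integral_add h1 hg, integral_const_mul]⟩

lemma momentum_sub_le {G H V : E N → ℝ} (hG : Integrable fun v => (1 + ‖v‖ ^ 2) * G v)
    (hH : Integrable fun v => (1 + ‖v‖ ^ 2) * H v) (hV : Integrable V)
    (hGH : ∀ v, |G v - H v| ≤ V v) {r : ℝ} (hr0 : 0 ≤ r) (hrG : ∀ v, ‖v‖ ≤ r ∨ G v = 0)
    (hrH : ∀ v, ‖v‖ ≤ r ∨ H v = 0) (hsym : ∀ v, H (-v) = H v) :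
    ‖∫ v, G v • v‖ ≤ r * ∫ v, V v := by
  have h0 : ∫ v, H v • v = 0 := by
    have e := integral_neg_eq_self (fun v : E N => H v • v) volume
    simp only [hsym, smul_neg, integral_neg] at e
    have h2 : (∫ v, H v • v) + ∫ v, H v • v = 0 := by
      nth_rewrite 1 [← e]
      exact neg_add_cancel _
    rw [← two_smul ℝ] at h2
    exact (smul_eq_zero.mp h2).resolve_left two_ne_zero
  have e : ∫ v, G v • v = ∫ v, (G v - H v) • v := by
    simp only [sub_smul]
    rw [integral_sub (integrable_momentum hG) (integrable_momentum hH), h0, sub_zero]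
  rw [e, ← integral_const_mul]
  refine norm_integral_le_of_norm_le (hV.const_mul r) (Filter.Eventually.of_forall fun v => ?_)
  rw [norm_smul, Real.norm_eq_abs, mul_comm]
  by_cases hv : ‖v‖ ≤ r
  · exact mul_le_mul hv (hGH v) (abs_nonneg _) hr0
  · rw [(hrG v).resolve_left hv, (hrH v).resolve_left hv, sub_zero, abs_zero, mul_zero]
    exact mul_nonneg hr0 ((abs_nonneg _).trans (hGH v))

/-- Integrability and upper bounds for the moments of the transported datum. -/
lemma exists_transported_upper (hN : 1 ≤ N) (hα : 0 < α) (hβ : 0 < β) (hδ : 0 ≤ δ)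
    (hω : 0 ≤ ω) (hγ : 0 < γ) (hγ2 : γ ≤ 1 / 2) (hsum : β * γ + γ ≤ 1) :
    ∃ C : ℝ, 0 < C ∧ ∀ h t : ℝ, SmallTime β γ h t → ∀ x : E N,
      (Integrable fun v => (1 + ‖v‖ ^ 2) * initialDatum α β γ δ ω (x - t • v) v) ∧
      ∫ v, initialDatum α β γ δ ω (x - t • v) v ≤
        C * densityWeight α (β * γ) ((2 * δ + β) * γ + ω) γ x ∧
      ∫ v, ‖v‖ ^ 2 * initialDatum α β γ δ ω (x - t • v) v ≤
        C * densityWeight α (β * γ) ((2 * δ + β) * γ + ω) γ x * scale γ x ^ 2 := by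
  obtain ⟨Cw, hCw, hw⟩ := exists_weight_comparable N α β δ ω hγ.le (by linarith : γ ≤ 1)
  obtain ⟨C₁, hC₁, hup⟩ := exists_shellMass_le hN hα hβ hδ
  refine ⟨576 * (2 ^ ω * C₁ * Cw), by positivity, fun h t ht x => ?_⟩
  obtain ⟨-, w2⟩ := hw x
  obtain ⟨r₀, up1, up2⟩ := hup (‖x‖ ^ γ) (by positivity)
  have hbulk := transported_le_bulk (α := α) (δ := δ) hβ hγ hγ2 hsum hω ht up2
  have hUi := (integrable_shell (N := N) (α := α) (δ := δ) hβ.le r₀ (2 * ‖x‖ ^ γ + 12)).const_mul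
    (2 ^ ω * (1 + ‖x‖) ^ (-ω))
  have hUint : ∫ v : E N, 2 ^ ω * (1 + ‖x‖) ^ (-ω) *
      (Icc r₀ (2 * ‖x‖ ^ γ + 12)).indicator (radialDatum α β δ) ‖v‖ ≤
      2 ^ ω * C₁ * Cw * densityWeight α (β * γ) ((2 * δ + β) * γ + ω) γ x := by
    rw [integral_const_mul]
    calc _ ≤ 2 ^ ω * (1 + ‖x‖) ^ (-ω) * (C₁ * shellWeight N α β δ (‖x‖ ^ γ)) :=
          mul_le_mul_of_nonneg_left up1 (by positivity)
      _ = 2 ^ ω * C₁ * ((1 + ‖x‖) ^ (-ω) * shellWeight N α β δ (‖x‖ ^ γ)) := by ring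
      _ ≤ 2 ^ ω * C₁ * (Cw * densityWeight α (β * γ) ((2 * δ + β) * γ + ω) γ x) :=
          mul_le_mul_of_nonneg_left w2 (by positivity)
      _ = _ := by ring
  obtain ⟨a1, a2, a3⟩ := moments_le_of_le (measurable_transported t x)
    (fun v => initialDatum_nonneg _ _) hUi (fun v => (hbulk v).1) (fun v => (hbulk v).2)
  have hW := densityWeight_pos (α := α) (a := β * γ) (q := (2 * δ + β) * γ + ω) (γ := γ) x
  refine ⟨a1, (a2.trans hUint).trans ?_, (a3.trans (mul_le_mul_of_nonneg_left hUint
    (by positivity))).trans (le_of_eq (by ring))⟩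
  rw [mul_assoc 576]
  exact le_mul_of_one_le_left (by positivity) (by norm_num)

/-- Lower bounds for the moments of the transported datum. -/
lemma exists_transported_lower (hN : 1 ≤ N) (hα : 0 < α) (hβ : 0 < β) (hδ : 0 ≤ δ)
    (hω : 0 ≤ ω) (hγ : 0 < γ) (hγ2 : γ ≤ 1 / 2) (hsum : β * γ + γ ≤ 1) :
    ∃ c h : ℝ, 0 < c ∧ 0 < h ∧ ∀ t : ℝ, SmallTime β γ h t → ∀ x : E N,
      c * densityWeight α (β * γ) ((2 * δ + β) * γ + ω) γ x ≤
        ∫ v, initialDatum α β γ δ ω (x - t • v) v ∧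
      c * densityWeight α (β * γ) ((2 * δ + β) * γ + ω) γ x * scale γ x ^ 2 ≤
        ∫ v, ‖v‖ ^ 2 * initialDatum α β γ δ ω (x - t • v) v := by
  obtain ⟨Cw, hCw, hw⟩ := exists_weight_comparable N α β δ ω hγ.le (by linarith : γ ≤ 1)
  obtain ⟨C, hC, hupper⟩ := exists_transported_upper hN hα hβ hδ hω hγ hγ2 hsum
  obtain ⟨c₀, κ, h, hc₀, hκ, hh, hlow⟩ := exists_le_shellMass hN hα hβ δ
  refine ⟨min 1 (κ ^ 2) * ((2 ^ ω)⁻¹ * c₀ * Cw⁻¹), h, by positivity, hh, fun t ht x => ?_⟩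
  obtain ⟨w1, -⟩ := hw x
  obtain ⟨l₁, l₂, lo1, lo2, lo3, lo4⟩ := hlow (‖x‖ ^ γ) (by positivity)
  have hLi := (integrable_shell (N := N) (α := α) (δ := δ) hβ.le l₁ l₂).const_mul
    ((2 ^ ω)⁻¹ * (1 + ‖x‖) ^ (-ω))
  have hLint : (2 ^ ω)⁻¹ * c₀ * Cw⁻¹ *
      densityWeight α (β * γ) ((2 * δ + β) * γ + ω) γ x ≤ ∫ v : E N,
      (2 ^ ω)⁻¹ * (1 + ‖x‖) ^ (-ω) * (Icc l₁ l₂).indicator (radialDatum α β δ) ‖v‖ := by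
    rw [integral_const_mul]
    calc _ = (2 ^ ω)⁻¹ * c₀ *
          (Cw⁻¹ * densityWeight α (β * γ) ((2 * δ + β) * γ + ω) γ x) := by ring
      _ ≤ (2 ^ ω)⁻¹ * c₀ * ((1 + ‖x‖) ^ (-ω) * shellWeight N α β δ (‖x‖ ^ γ)) :=
          mul_le_mul_of_nonneg_left w1 (by positivity)
      _ = (2 ^ ω)⁻¹ * (1 + ‖x‖) ^ (-ω) * (c₀ * shellWeight N α β δ (‖x‖ ^ γ)) := by ring
      _ ≤ _ := mul_le_mul_of_nonneg_left lo1 (by positivity)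
  have lower : ∀ v : E N, (2 ^ ω)⁻¹ * (1 + ‖x‖) ^ (-ω) *
      (Icc l₁ l₂).indicator (radialDatum α β δ) ‖v‖ ≤
      initialDatum α β γ δ ω (x - t • v) v := by
    intro v
    by_cases hv : ‖v‖ ∈ Icc l₁ l₂
    · rw [indicator_of_mem hv, mul_assoc]
      exact transported_datum_lower hβ hγ hγ2 hsum hω ht (lo4 _ hv) (hv.2.trans lo3)
    · rw [indicator_of_notMem hv, mul_zero]
      exact initialDatum_nonneg _ _
  have hS := scale_pos (γ := γ) x
  have sc := (scale_comparable hγ.le (by linarith : γ ≤ 1) x).1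
  have hW := densityWeight_pos (α := α) (a := β * γ) (q := (2 * δ + β) * γ + ω) (γ := γ) x
  obtain ⟨a1, a2⟩ := le_moments_of_le (fun v => initialDatum_nonneg _ _) (hupper h t ht x).1 hLi
    lower (r := κ * scale γ x) (by positivity) (fun v => by
      by_cases hv : ‖v‖ ∈ Icc l₁ l₂
      · exact Or.inl ((mul_le_mul_of_nonneg_left sc hκ.le).trans (lo2.trans hv.1))
      · exact Or.inr (by rw [indicator_of_notMem hv, mul_zero]))
  constructor
  · refine le_trans ?_ (hLint.trans a1)
    rw [mul_assoc (min _ _)]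
    exact mul_le_of_le_one_left (by positivity) (min_le_left _ _)
  · refine le_trans ?_ ((mul_le_mul_of_nonneg_left hLint (by positivity)).trans a2)
    calc _ = min 1 (κ ^ 2) * ((2 ^ ω)⁻¹ * c₀ * Cw⁻¹ *
          densityWeight α (β * γ) ((2 * δ + β) * γ + ω) γ x * scale γ x ^ 2) := by ring
      _ ≤ κ ^ 2 * ((2 ^ ω)⁻¹ * c₀ * Cw⁻¹ *
          densityWeight α (β * γ) ((2 * δ + β) * γ + ω) γ x * scale γ x ^ 2) :=
          mul_le_mul_of_nonneg_right (min_le_right _ _) (by positivity)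
      _ = _ := by ring

/-- The transported datum has small momentum for small times. -/
lemma exists_transported_momentum (hN : 1 ≤ N) (hα : 0 < α) (hβ : 0 < β) (hδ : 0 ≤ δ)
    (hω : 0 ≤ ω) (hγ : 0 < γ) (hγ2 : γ ≤ 1 / 2) (hsum : β * γ + γ ≤ 1) :
    ∃ C : ℝ, 0 < C ∧ ∀ h t : ℝ, SmallTime β γ h 0 → SmallTime β γ h t → ∀ x : E N,
      ‖∫ v, initialDatum α β γ δ ω (x - t • v) v • v‖ ≤
        C * t ^ γ * densityWeight α (β * γ) ((2 * δ + β) * γ + ω) γ x * scale γ x := by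
  obtain ⟨Cw, hCw, hw⟩ := exists_weight_comparable N α β δ ω hγ.le (by linarith : γ ≤ 1)
  obtain ⟨C, hC, hupper⟩ := exists_transported_upper hN hα hβ hδ hω hγ hγ2 hsum
  obtain ⟨C₁, hC₁, hup⟩ := exists_shellMass_le hN hα hβ hδ
  obtain ⟨C₂, hC₂, hin⟩ := exists_innerLayer_le hN hα hβ hδ
  obtain ⟨C₃, hC₃, hout⟩ := exists_outerLayer_le hN hα hβ δ
  refine ⟨24 * (2 ^ ω + 48 * ω * (2 ^ ω + 1)) * (C₁ + C₂ + C₃) * Cw, by positivity,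
    fun h t ht0 ht x => ?_⟩
  have h0 := ht.nonneg
  have htτ : t ≤ t ^ γ := by
    simpa using Real.rpow_le_rpow_of_exponent_ge' h0 (ht.le.trans (by norm_num)) hγ.le
      (by linarith : γ ≤ 1)
  obtain ⟨-, w2⟩ := hw x
  have hR : 0 ≤ ‖x‖ ^ γ := by positivity
  obtain ⟨r₀, up1, up2⟩ := hup (‖x‖ ^ γ) hR
  obtain ⟨r₁, r₂, in1, in2⟩ := hin (‖x‖ ^ γ) t (t ^ γ) hR h0 htτ ht.rpow_le
  have out1 := hout (‖x‖ ^ γ) (t ^ γ) hR (by positivity) ht.rpow_le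
  have hsub := transported_datum_sub (α := α) (δ := δ) hβ hγ hγ2 hsum hω ht up2 in2
  have b1 := fun v => (transported_le_bulk (α := α) (δ := δ) hβ hγ hγ2 hsum hω ht up2 v).2
  have b0 := fun v => (transported_le_bulk (α := α) (δ := δ) hβ hγ hγ2 hsum hω ht0 up2 v).2
  have I1 := (hupper h t ht x).1
  have I0 := (hupper h 0 ht0 x).1
  simp only [zero_smul, sub_zero] at b0 I0
  have j1 := integrable_shell (N := N) (α := α) (δ := δ) hβ.le r₀ (2 * ‖x‖ ^ γ + 12)
  have j2 := integrable_shell (N := N) (α := α) (δ := δ) hβ.le r₁ r₂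
  have j3 := integrable_shell (N := N) (α := α) (δ := δ) hβ.le
    (2 * ‖x‖ ^ γ + 10 - 24 * t ^ γ) (2 * ‖x‖ ^ γ + 10 + 24 * t ^ γ)
  have hS := scale_pos (γ := γ) x
  obtain ⟨hVi', hVe⟩ := integral_mul_add_add j1 j2 j3 t
  have hVi := hVi'.const_mul ((2 ^ ω + 48 * ω * (2 ^ ω + 1)) * (1 + ‖x‖) ^ (-ω))
  refine (momentum_sub_le I1 I0 hVi hsub (r := 24 * scale γ x) (by positivity) b1 b0
    (initialDatum_neg x)).trans ?_
  rw [integral_const_mul, hVe]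
  have hsum3 : t * shellMass N α β δ r₀ (2 * ‖x‖ ^ γ + 12) + shellMass N α β δ r₁ r₂ +
      shellMass N α β δ (2 * ‖x‖ ^ γ + 10 - 24 * t ^ γ) (2 * ‖x‖ ^ γ + 10 + 24 * t ^ γ) ≤
      (C₁ + C₂ + C₃) * t ^ γ * shellWeight N α β δ (‖x‖ ^ γ) := by
    have := mul_le_mul htτ up1 (shellMass_nonneg _ _) (by positivity : 0 ≤ t ^ γ)
    linarith
  calc _ ≤ 24 * scale γ x * ((2 ^ ω + 48 * ω * (2 ^ ω + 1)) * (1 + ‖x‖) ^ (-ω) *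
        ((C₁ + C₂ + C₃) * t ^ γ * shellWeight N α β δ (‖x‖ ^ γ))) :=
        mul_le_mul_of_nonneg_left (mul_le_mul_of_nonneg_left hsum3 (by positivity)) (by positivity)
    _ = 24 * scale γ x * (2 ^ ω + 48 * ω * (2 ^ ω + 1)) * (C₁ + C₂ + C₃) * t ^ γ *
        ((1 + ‖x‖) ^ (-ω) * shellWeight N α β δ (‖x‖ ^ γ)) := by ring
    _ ≤ 24 * scale γ x * (2 ^ ω + 48 * ω * (2 ^ ω + 1)) * (C₁ + C₂ + C₃) * t ^ γ *
        (Cw * densityWeight α (β * γ) ((2 * δ + β) * γ + ω) γ x) :=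
        mul_le_mul_of_nonneg_left w2 (by positivity)
    _ = _ := by ring

/-- Moments of the transported initial datum. -/
lemma exists_transported_moments (hN : 1 ≤ N) (hα : 0 < α) (hβ : 0 < β) (hδ : 0 ≤ δ)
    (hω : 0 ≤ ω) (hγ : 0 < γ) (hγ2 : γ ≤ 1 / 2) (hsum : β * γ + γ ≤ 1) :
    ∃ c C t₁ : ℝ, 0 < c ∧ 0 < C ∧ 0 < t₁ ∧ t₁ ≤ 1 ∧ ∀ t ∈ Icc 0 t₁, ∀ x : E N,
      (Integrable fun v => (1 + ‖v‖ ^ 2) * initialDatum α β γ δ ω (x - t • v) v) ∧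
      c * densityWeight α (β * γ) ((2 * δ + β) * γ + ω) γ x ≤
        ∫ v, initialDatum α β γ δ ω (x - t • v) v ∧
      ∫ v, initialDatum α β γ δ ω (x - t • v) v ≤
        C * densityWeight α (β * γ) ((2 * δ + β) * γ + ω) γ x ∧
      ‖∫ v, initialDatum α β γ δ ω (x - t • v) v • v‖ ≤
        C * t ^ γ * densityWeight α (β * γ) ((2 * δ + β) * γ + ω) γ x * scale γ x ∧
      c * densityWeight α (β * γ) ((2 * δ + β) * γ + ω) γ x * scale γ x ^ 2 ≤
        ∫ v, ‖v‖ ^ 2 * initialDatum α β γ δ ω (x - t • v) v ∧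
      ∫ v, ‖v‖ ^ 2 * initialDatum α β γ δ ω (x - t • v) v ≤
        C * densityWeight α (β * γ) ((2 * δ + β) * γ + ω) γ x * scale γ x ^ 2 := by
  obtain ⟨C₁, hC₁, hu⟩ := exists_transported_upper hN hα hβ hδ hω hγ hγ2 hsum
  obtain ⟨C₂, hC₂, hm⟩ := exists_transported_momentum hN hα hβ hδ hω hγ hγ2 hsum
  obtain ⟨c, h, hc, hh, hl⟩ := exists_transported_lower hN hα hβ hδ hω hγ hγ2 hsum
  obtain ⟨t₁, ht₁, hs⟩ := exists_smallTime hβ hγ hh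
  refine ⟨c, C₁ + C₂, t₁, hc, by positivity, ht₁,
    (hs t₁ ⟨ht₁.le, le_rfl⟩).le.trans (by norm_num), fun t ht x => ?_⟩
  have hst := hs t ht
  have h0 := ht.1
  obtain ⟨u0, u1, u2⟩ := hu h t hst x
  obtain ⟨l1, l2⟩ := hl t hst x
  have m := hm h t (hs 0 ⟨le_rfl, ht₁.le⟩) hst x
  have hS := scale_pos (γ := γ) x
  have hW := densityWeight_pos (α := α) (a := β * γ) (q := (2 * δ + β) * γ + ω) (γ := γ) x
  refine ⟨u0, l1, u1.trans ?_, m.trans ?_, l2, u2.trans ?_⟩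
  · gcongr; linarith
  · gcongr; linarith
  · gcongr; linarith

end

section
variable {N : ℕ} {α β γ δ ω t₀ : ℝ}

set_option maxHeartbeats 800000 in
/-- Small perturbations of free transport have controlled macroscopic fields, with constants
that do not depend on the size `A` of the perturbation. -/
lemma exists_perturbed_fields (hN : 1 ≤ N) (hα : 0 < α) (hβ : 0 < β) (hδ : 0 ≤ δ)
    (hω : 0 ≤ ω) (hγ3 : 1 / 3 ≤ γ) (hγ2 : γ ≤ 1 / 2) (hsum : β * γ + γ ≤ 1) :
    ∃ c₁ c₂ c₃ c₄ c₅ : ℝ, 0 < c₁ ∧ 0 < c₂ ∧ 0 < c₃ ∧ 0 < c₄ ∧ 0 < c₅ ∧ ∀ A : ℝ, 0 < A →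
      ∃ t₁ : ℝ, 0 < t₁ ∧ t₁ ≤ 1 ∧ ∀ t ∈ Icc 0 t₁, ∀ g : E N → E N → ℝ,
      (∀ x, Measurable (g x)) →
      (∀ x v, freeTransport (initialDatum α β γ δ ω) t x v ≤ g x v) →
      (∀ x v, g x v ≤ freeTransport (initialDatum α β γ δ ω) t x v +
        A * t * profile α (β * γ) ((2 * δ + β) * γ + ω) γ x v) → ∀ x,
      (Integrable fun v => (1 + ‖v‖ ^ 2) * g x v) ∧
      c₁ * densityWeight α (β * γ) ((2 * δ + β) * γ + ω) γ x ≤ density g x ∧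
      density g x ≤ c₂ * densityWeight α (β * γ) ((2 * δ + β) * γ + ω) γ x ∧
      ‖bulkVelocity g x‖ ≤ c₃ * t ^ (1 / 4 : ℝ) * scale γ x ∧
      c₄ * scale γ x ^ 2 ≤ temperature g x ∧ temperature g x ≤ c₅ * scale γ x ^ 2 := by
  have hγ : 0 < γ := by linarith
  obtain ⟨c, C, s₀, hc, hC, hs₀, hs₀1, hmom⟩ :=
    exists_transported_moments hN hα hβ hδ hω hγ hγ2 hsum
  have hκ := tailMass_nonneg N
  set e₁ := Real.exp (-1) with he₁
  have he₁0 : 0 < e₁ := Real.exp_pos _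
  set c' := c * e₁ / 2 with hc'
  set C' := C + c' with hC'
  have hc'0 : 0 < c' := by positivity
  have hC'0 : 0 < C' := by positivity
  have hN' : (0:ℝ) < N := by exact_mod_cast hN
  refine ⟨c', C', (C + 1) / c', c' / (2 * C' * N), C' / c', hc'0, hC'0, by positivity,
    by positivity, by positivity, fun A hA => ?_⟩
  set M := A * tailMass N + 1 with hM
  have hM0 : 0 < M := by positivity
  obtain ⟨s₁, hs₁, h₁⟩ := exists_rpow_le (a := 3 / 4) (ε := 1 / M) (by norm_num) (by positivity)
  obtain ⟨s₂, hs₂, h₂⟩ := exists_rpow_le (a := 1) (ε := c' / M) (by norm_num) (by positivity)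
  obtain ⟨s₃, hs₃, h₃⟩ := exists_rpow_le (a := 1 / 2) (ε := c' / (2 * C') / ((C + 1) / c') ^ 2)
    (by norm_num) (by positivity)
  refine ⟨min s₀ (min s₁ (min s₂ s₃)), by positivity, (min_le_left _ _).trans hs₀1, ?_⟩
  intro t ht g hgm hg1 hg2 x
  have ht0 := ht.1
  have hts₀ : t ∈ Icc 0 s₀ := ⟨ht0, ht.2.trans (min_le_left _ _)⟩
  have ht1 : t ≤ 1 := hts₀.2.trans hs₀1
  have q1 := h₁ t ⟨ht0, ht.2.trans ((min_le_right _ _).trans (min_le_left _ _))⟩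
  have q2 := h₂ t ⟨ht0, ht.2.trans ((min_le_right _ _).trans
    ((min_le_right _ _).trans (min_le_left _ _)))⟩
  have q3 := h₃ t ⟨ht0, ht.2.trans ((min_le_right _ _).trans
    ((min_le_right _ _).trans (min_le_right _ _)))⟩
  rw [Real.rpow_one, le_div_iff₀ hM0] at q2
  rw [le_div_iff₀ hM0] at q1
  rw [le_div_iff₀ (by positivity)] at q3
  obtain ⟨m0, m1, m2, m3, m4, m5⟩ := hmom t hts₀ x
  set F : E N → E N → ℝ := freeTransport (initialDatum α β γ δ ω) t with hF
  have hFx : ∀ v, F x v = Real.exp (-t) * initialDatum α β γ δ ω (x - t • v) v := fun v => rfl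
  set W := densityWeight α (β * γ) ((2 * δ + β) * γ + ω) γ x with hW
  have hW0 : 0 < W := densityWeight_pos x
  have hS := scale_pos (γ := γ) x
  set S := scale γ x with hSdef
  have hP := fun v => profile_pos (α := α) (a := β * γ) (q := (2 * δ + β) * γ + ω) (γ := γ) x v
  have het : Real.exp (-t) ≤ 1 := by rw [Real.exp_le_one_iff]; linarith
  have het1 : e₁ ≤ Real.exp (-t) := Real.exp_le_exp.mpr (by linarith)
  have hFi : Integrable fun v => (1 + ‖v‖ ^ 2) * F x v := by
    refine (m0.const_mul (Real.exp (-t))).congr (Filter.Eventually.of_forall fun v => ?_)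
    simp only [hFx]; ring
  have hFm : AEStronglyMeasurable (F x) volume := by
    have := integrable_moment hFi (j := 0) (by norm_num)
    simp only [pow_zero, one_mul] at this
    exact this.aestronglyMeasurable
  have hdiff : ∀ v, |g x v - F x v| ≤
      (A * t) * profile α (β * γ) ((2 * δ + β) * γ + ω) γ x v := by
    intro v
    rw [abs_of_nonneg (sub_nonneg.mpr (hg1 x v))]
    linarith [hg2 x v]
  have hgi : Integrable fun v => (1 + ‖v‖ ^ 2) * g x v := by
    have hm : AEStronglyMeasurable (fun v => g x v - F x v) volume :=
      (hgm x).aestronglyMeasurable.sub hFm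
    have d0 := (integrable_of_le_profile hm hdiff (j := 0) (by norm_num)).1
    have d2 := (integrable_of_le_profile hm hdiff (j := 2) le_rfl).1
    refine ((hFi.add d0).add d2).congr (Filter.Eventually.of_forall fun v => ?_)
    simp only [Pi.add_apply]
    ring
  obtain ⟨b0, b1, b2⟩ := moments_sub_le hgi hFi hdiff
  rw [← hW] at b0 b1 b2
  rw [← hSdef] at b1 b2
  have f0 : ∫ v, F x v = Real.exp (-t) * ∫ v, initialDatum α β γ δ ω (x - t • v) v := by
    simp only [hFx]; exact integral_const_mul _ _
  have f1 : ∫ v, F x v • v =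
      Real.exp (-t) • ∫ v, initialDatum α β γ δ ω (x - t • v) v • v := by
    simp only [hFx, mul_smul]; exact integral_smul _ _
  have f2 : ∫ v, ‖v‖ ^ 2 * F x v =
      Real.exp (-t) * ∫ v, ‖v‖ ^ 2 * initialDatum α β γ δ ω (x - t • v) v := by
    simp only [hFx]; rw [← integral_const_mul]; congr 1; funext v; ring
  have kM : A * t * tailMass N ≤ t * M := by
    calc A * t * tailMass N = t * (A * tailMass N) := by ring
      _ ≤ t * M := mul_le_mul_of_nonneg_left (by rw [hM]; linarith) ht0
  have k1 : A * t * tailMass N ≤ c' := kM.trans q2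
  have k2 : A * t * tailMass N ≤ t ^ (1 / 4 : ℝ) := by
    have e : t = t ^ (1 / 4 : ℝ) * t ^ (3 / 4 : ℝ) := by
      rw [← Real.rpow_add_of_nonneg ht0 (by norm_num) (by norm_num)]; norm_num
    have hp : 0 ≤ t ^ (1 / 4 : ℝ) := by positivity
    calc _ ≤ t * M := kM
      _ = t ^ (1 / 4 : ℝ) * (t ^ (3 / 4 : ℝ) * M) := by rw [← mul_assoc, ← e]
      _ ≤ t ^ (1 / 4 : ℝ) * 1 := by gcongr
      _ = _ := mul_one _
  have hgr : t ^ γ ≤ t ^ (1 / 4 : ℝ) :=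
    Real.rpow_le_rpow_of_exponent_ge' ht0 ht1 (by norm_num) (by linarith)
  have a0 := abs_le.mp b0
  have a2 := abs_le.mp b2
  have kW : A * t * tailMass N * W ≤ c' * W := by gcongr
  have kW2 : A * t * tailMass N * W * S ^ 2 ≤ c' * W * S ^ 2 := by gcongr
  have hWS : 0 ≤ c * W * S ^ 2 := by positivity
  have g1 : c' * W ≤ density g x := by
    have : e₁ * (c * W) ≤ ∫ v, F x v := by
      rw [f0]; exact mul_le_mul het1 m1 (by positivity) (Real.exp_pos _).le
    have h3 : c' * W + c' * W = e₁ * (c * W) := by rw [hc']; ring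
    unfold density
    linarith
  have g2 : density g x ≤ C' * W := by
    have : ∫ v, F x v ≤ 1 * (C * W) := by
      rw [f0]; exact mul_le_mul het m2 (le_trans (by positivity) m1) zero_le_one
    have h3 : C' * W = C * W + c' * W := by rw [hC']; ring
    unfold density
    linarith
  have g3 : ‖∫ v, g x v • v‖ ≤ ((C + 1) * t ^ (1 / 4 : ℝ)) * W * S := by
    have : ‖∫ v, F x v • v‖ ≤ 1 * (C * t ^ γ * W * S) := by
      rw [f1, norm_smul, Real.norm_of_nonneg (Real.exp_pos _).le]
      exact mul_le_mul het m3 (norm_nonneg _) zero_le_one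
    have h3 := norm_le_norm_add_norm_sub' (∫ v, g x v • v) (∫ v, F x v • v)
    have h4 : C * t ^ γ * W * S ≤ C * t ^ (1 / 4 : ℝ) * W * S := by gcongr
    have h5 : A * t * tailMass N * W * S ≤ t ^ (1 / 4 : ℝ) * W * S := by gcongr
    linarith
  have g4 : c' * W * S ^ 2 ≤ ∫ v, ‖v‖ ^ 2 * g x v := by
    have : e₁ * (c * W * S ^ 2) ≤ ∫ v, ‖v‖ ^ 2 * F x v := by
      rw [f2]; exact mul_le_mul het1 m4 (by positivity) (Real.exp_pos _).le
    have h3 : c' * W * S ^ 2 + c' * W * S ^ 2 = e₁ * (c * W * S ^ 2) := by rw [hc']; ring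
    linarith
  have g5 : ∫ v, ‖v‖ ^ 2 * g x v ≤ C' * W * S ^ 2 := by
    have : ∫ v, ‖v‖ ^ 2 * F x v ≤ 1 * (C * W * S ^ 2) := by
      rw [f2]; exact mul_le_mul het m5 (le_trans (by positivity) m4) zero_le_one
    have h3 : C' * W * S ^ 2 = C * W * S ^ 2 + c' * W * S ^ 2 := by rw [hC']; ring
    linarith
  have hη : ((C + 1) * t ^ (1 / 4 : ℝ) / c') ^ 2 ≤ c' / (2 * C') := by
    have e : (t ^ (1 / 4 : ℝ)) ^ 2 = t ^ (1 / 2 : ℝ) := by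
      rw [← Real.rpow_natCast, ← Real.rpow_mul ht0]; norm_num
    calc _ = t ^ (1 / 2 : ℝ) * ((C + 1) / c') ^ 2 := by rw [← e]; ring
      _ ≤ _ := q3
  obtain ⟨u1, u2, u3⟩ := fields_of_moments hN hc'0 (by positivity) g1 g2 g3 g4 g5 hη
  refine ⟨hgi, g1, g2, u1.trans (le_of_eq ?_), u2, u3⟩
  rw [← hSdef]; ring

lemma fieldBounds_of_constants {a q K c₁ c₂ c₃ c₄ c₅ : ℝ} {g : E N → E N → ℝ} {x : E N}
    (h₁0 : 0 < c₁) (h₄0 : 0 < c₄)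
    (h1 : c₁ * densityWeight α a q γ x ≤ density g x)
    (h2 : density g x ≤ c₂ * densityWeight α a q γ x)
    (h3 : ‖bulkVelocity g x‖ ≤ c₃ * scale γ x)
    (h4 : c₄ * scale γ x ^ 2 ≤ temperature g x) (h5 : temperature g x ≤ c₅ * scale γ x ^ 2)
    (k1 : c₁⁻¹ ≤ K) (k2 : c₂ ≤ K) (k3 : c₃ ≤ K) (k4 : c₄⁻¹ ≤ K) (k5 : c₅ ≤ K) :
    FieldBounds K α a q γ g x := by
  have hS := scale_pos (γ := γ) x
  have hW := densityWeight_pos (α := α) (a := a) (q := q) (γ := γ) x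
  have hρ : 0 < density g x := lt_of_lt_of_le (by positivity) h1
  have hT : 0 < temperature g x := lt_of_lt_of_le (by positivity) h4
  refine ⟨?_, h2.trans (by gcongr), h3.trans (by gcongr), ?_, h5.trans (by gcongr)⟩
  · calc _ ≤ c₁⁻¹ * density g x := by rwa [le_inv_mul_iff₀ h₁0]
      _ ≤ _ := by gcongr
  · calc _ ≤ c₄⁻¹ * temperature g x := by rwa [le_inv_mul_iff₀ h₄0]
      _ ≤ _ := by gcongr

lemma scale_sq_comparable (hγ : 0 ≤ γ) (hγ2 : γ ≤ 1 / 2) (x : E N) :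
    scale γ x ^ 2 ≤ 1 + ‖x‖ ^ (2 * γ) ∧ 1 + ‖x‖ ^ (2 * γ) ≤ 2 * scale γ x ^ 2 := by
  have e : scale γ x ^ 2 = scale (2 * γ) x := by
    unfold scale
    rw [← Real.rpow_natCast, ← Real.rpow_mul (by positivity), mul_comm]; norm_num
  rw [e]
  exact scale_comparable (by linarith) (by linarith) x

lemma MacroBounds.exists_fieldBounds (hγ : 0 ≤ γ) (hγ2 : γ ≤ 1 / 2) (ht₀ : t₀ ≤ 1)
    {D₁ D₂ D₃ D₄ D₅ : ℝ} (h₁ : 0 < D₁) (h₃ : 0 < D₃) (h₄ : 0 < D₄) (h₅ : 0 < D₅)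
    {g : ℝ → E N → E N → ℝ} (h : MacroBounds α β γ δ ω t₀ D₁ D₂ D₃ D₄ D₅ g) :
    ∃ K₀ : ℝ, ∀ K, K₀ ≤ K → ∀ t ∈ Icc 0 t₀, ∀ x,
      FieldBounds K α (β * γ) ((2 * δ + β) * γ + ω) γ (g t) x := by
  refine ⟨max D₁⁻¹ (max D₂ (max (2 * D₃) (max D₄⁻¹ (2 * D₅)))), fun K hK t ht x => ?_⟩
  simp only [max_le_iff] at hK
  obtain ⟨k1, k2, k3, k4, k5⟩ := hK
  have hW := densityWeight_pos (α := α) (a := β * γ) (q := (2 * δ + β) * γ + ω) (γ := γ) x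
  have hS := scale_pos (γ := γ) x
  obtain ⟨s1, s2⟩ := scale_comparable hγ (by linarith : γ ≤ 1) x
  obtain ⟨r1, r2⟩ := scale_sq_comparable hγ hγ2 x
  have hd := h.density_bounds t ht x
  have hu := h.velocity_bound t ht x
  have hT := h.temperature_bounds t ht x
  rw [← densityWeight_eq] at hd
  have hr : 0 < 1 + ‖x‖ ^ (2 * γ) := by positivity
  obtain ⟨d1, d2⟩ := hd
  obtain ⟨t1, t2⟩ := hT
  rw [le_div_iff₀ hW] at d1
  rw [div_le_iff₀ hW] at d2
  rw [le_div_iff₀ hr] at t1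
  rw [div_le_iff₀ hr] at t2
  refine fieldBounds_of_constants h₁ h₄ d1 d2 ?_ ?_ ?_ k1 k2 k3 k4 k5
  · have : t ^ (1 / 4 : ℝ) ≤ 1 := Real.rpow_le_one ht.1 (ht.2.trans ht₀) (by norm_num)
    calc _ ≤ D₃ * (1 + ‖x‖ ^ γ) * t ^ (1 / 4 : ℝ) := hu
      _ ≤ D₃ * (2 * scale γ x) * 1 :=
          mul_le_mul (mul_le_mul_of_nonneg_left s2 h₃.le) this (Real.rpow_nonneg ht.1 _)
            (by positivity)
      _ = _ := by ring
  · exact le_trans (by gcongr) t1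
  · calc _ ≤ D₅ * (1 + ‖x‖ ^ (2 * γ)) := t2
      _ ≤ D₅ * (2 * scale γ x ^ 2) := by gcongr
      _ = _ := by ring

end

end BGK

theorem theorem4p1 (N : ℕ) (hN : 1 ≤ N) (α β γ δ ω : ℝ) (hα : 0 < α)
    (hβ : 0 < β) (hβ2 : β ≤ 2) (hγ : 1 / 3 ≤ γ) (hγ2 : γ ≤ min (1 / (β + 1)) (1 / 2))
    (hδ : 0 ≤ δ) (hω : 0 ≤ ω) :
    ∃ t₀ : ℝ, 0 < t₀ ∧
    ∃ C₁ C₂ C₃ C₄ C₅ : ℝ, 0 < C₁ ∧ 0 < C₂ ∧ 0 < C₃ ∧ 0 < C₄ ∧ 0 < C₅ ∧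
    ∃ f : ℝ → BGK.E N → BGK.E N → ℝ,
      BGK.IsSolution (BGK.initialDatum α β γ δ ω) t₀ f ∧
      BGK.MacroBounds α β γ δ ω t₀ C₁ C₂ C₃ C₄ C₅ f ∧
      -- uniqueness among all solutions whose macroscopic fields obey bounds of this form,
      -- with whatever positive constants
      ∀ g : ℝ → BGK.E N → BGK.E N → ℝ,
        BGK.IsSolution (BGK.initialDatum α β γ δ ω) t₀ g →
        (∃ D₁ D₂ D₃ D₄ D₅ : ℝ, 0 < D₁ ∧ 0 < D₂ ∧ 0 < D₃ ∧ 0 < D₄ ∧ 0 < D₅ ∧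
          BGK.MacroBounds α β γ δ ω t₀ D₁ D₂ D₃ D₄ D₅ g) →
        ∀ t ∈ Set.Icc 0 t₀, ∀ x v, g t x v = f t x v := by
  have hγ0 : 0 < γ := by linarith
  have hγh : γ ≤ 1 / 2 := hγ2.trans (min_le_right _ _)
  have hsum : β * γ + γ ≤ 1 := by
    have h := hγ2.trans (min_le_left _ _)
    rw [le_div_iff₀ (by linarith)] at h
    linarith
  have hex : BGK.WeightExponents α (β * γ) ((2 * δ + β) * γ + ω) γ :=
    ⟨hα, by positivity, by positivity, hγ0, hγh, hsum⟩
  obtain ⟨c₁, c₂, c₃, c₄, c₅, h₁, h₂, h₃, h₄, h₅, hper⟩ :=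
    BGK.exists_perturbed_fields hN hα hβ hδ hω hγ hγh hsum
  set K := max 1 (max c₁⁻¹ (max c₂ (max c₃ (max c₄⁻¹ c₅)))) with hK
  have hK' : K ≤ K := le_rfl
  conv_lhs at hK' => rw [hK]
  simp only [max_le_iff] at hK'
  obtain ⟨hK1, k1, k2, k3, k4, k5⟩ := hK'
  obtain ⟨A, hA, t₁, ht₁, hsol⟩ := BGK.exists_solution hN hex hK1
    (BGK.measurable_initialDatum (N := N) (α := α) (β := β) (γ := γ) (δ := δ) (ω := ω))
    BGK.initialDatum_nonneg
  obtain ⟨t₂, ht₂, ht₂1, hfields⟩ := hper A hA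
  set t₀ := min t₁ t₂ with ht₀
  have ht₀2 : t₀ ≤ t₂ := min_le_right _ _
  have ht₀1 : t₀ ≤ 1 := ht₀2.trans ht₂1
  have hstable : BGK.TransportStable A K α (β * γ) ((2 * δ + β) * γ + ω) γ t₀
      (BGK.initialDatum (N := N) α β γ δ ω) := by
    intro t ht g hgm hg1 hg2 x
    obtain ⟨i, d1, d2, u, T1, T2⟩ := hfields t ⟨ht.1, ht.2.trans ht₀2⟩ g hgm hg1 hg2 x
    refine ⟨i, BGK.fieldBounds_of_constants h₁ h₄ d1 d2 (u.trans ?_) T1 T2 k1 k2 k3 k4 k5⟩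
    have hS := BGK.scale_pos (γ := γ) x
    have : t ^ (1 / 4 : ℝ) ≤ 1 := Real.rpow_le_one ht.1 (ht.2.trans ht₀1) (by norm_num)
    refine mul_le_mul_of_nonneg_right ?_ hS.le
    exact mul_le_of_le_one_right h₃.le this
  obtain ⟨f, hf, hfn⟩ := hsol t₀ (min_le_left _ _) hstable
  have hmac : BGK.MacroBounds α β γ δ ω t₀ c₁ c₂ c₃ (c₄ / 2) c₅ f := by
    have key := fun t (ht : t ∈ Set.Icc 0 t₀) x => hfields t ⟨ht.1, ht.2.trans ht₀2⟩ (f t)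
      (fun x => hfn.measurable.comp (by fun_prop : Measurable fun v : BGK.E N => (t, x, v)))
      (hfn.le t ht) (hfn.ge t ht) x
    refine ⟨fun t ht x => ?_, fun t ht x => ?_, fun t ht x => ?_⟩
    · obtain ⟨-, d1, d2, -, -, -⟩ := key t ht x
      have hW := BGK.densityWeight_pos (α := α) (a := β * γ) (q := (2 * δ + β) * γ + ω) (γ := γ) x
      rw [← BGK.densityWeight_eq]
      exact ⟨(le_div_iff₀ hW).mpr d1, (div_le_iff₀ hW).mpr d2⟩
    · obtain ⟨-, -, -, u, -, -⟩ := key t ht x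
      have ht' : 0 ≤ t := ht.1
      refine u.trans ?_
      rw [mul_right_comm]
      gcongr
      exact (BGK.scale_comparable hγ0.le (by linarith) x).1
    · obtain ⟨-, -, -, -, T1, T2⟩ := key t ht x
      obtain ⟨r1, r2⟩ := BGK.scale_sq_comparable hγ0.le hγh x
      have hr : 0 < 1 + ‖x‖ ^ (2 * γ) := by positivity
      constructor
      · rw [le_div_iff₀ hr]
        calc c₄ / 2 * (1 + ‖x‖ ^ (2 * γ)) ≤ c₄ / 2 * (2 * BGK.scale γ x ^ 2) := by gcongr
          _ = c₄ * BGK.scale γ x ^ 2 := by ring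
          _ ≤ _ := T1
      · rw [div_le_iff₀ hr]
        exact T2.trans (by gcongr)
  refine ⟨t₀, lt_min ht₁ ht₂, c₁, c₂, c₃, c₄ / 2, c₅, h₁, h₂, h₃, by positivity, h₅, f, hf, hmac,
    ?_⟩
  rintro g hg ⟨D₁, D₂, D₃, D₄, D₅, hD₁, -, hD₃, hD₄, hD₅, hgb⟩ t ht x v
  obtain ⟨K₁, hK₁⟩ := hgb.exists_fieldBounds hγ0.le hγh ht₀1 hD₁ hD₃ hD₄ hD₅
  obtain ⟨K₂, hK₂⟩ := hmac.exists_fieldBounds hγ0.le hγh ht₀1 h₁ h₃ (by positivity) h₅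
  set L := max 1 (max K₁ K₂) with hL
  have l1 : K₁ ≤ L := (le_max_left _ _).trans (le_max_right _ _)
  have l2 : K₂ ≤ L := (le_max_right _ _).trans (le_max_right _ _)
  exact BGK.solution_unique hN hex (le_max_left _ _ : 1 ≤ L) ht₀1 hf hg
    ⟨hf.measurable, hf.nonneg, hf.integrable_moments, hK₂ L l2⟩
    ⟨hg.measurable, hg.nonneg, hg.integrable_moments, hK₁ L l1⟩ ht x v
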